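/- Let $K$ be a field with a discrete valuation, $\mathcal{O}_K$ its valuation ring, $\pi$ a uniformiser and $k=\mathcal{O}_K/\pi\mathcal{O}_K$ the residue field; there is no restriction on the characteristics of $K$ and $k$, or on $k$. Let $v$ be the normalised valuation. A cube $S=(s_{ijk})_{1\le i,j,k\le 3}$ over $K$ is sliced into three $3\times 3$ matrices in three ways: $(M^1,N^1,P^1)=((s_{ajk})_{j,k})_{a=1,2,3}$, $(M^2,N^2,P^2)=((s_{jak})_{j,k})_{a=1,2,3}$, $(M^3,N^3,P^3)=((s_{jka})_{j,k})_{a=1,2,3}$. The associated ternary cubics are $F_i(x,y,z)=\det(M^ix+N^iy+P^iz)$. They have the same discriminant (scaled by $1728\Delta=c_4^3-c_6^2$, where $c_4(xyz)=1$ and $c_6(xyz)=-1$), which is denoted $\Delta(S)$; $S$ is non-singular if $\Delta(S)\ne 0$. For a ring $R$ the group $\mathrm{GL}_3(R)^3$ acts on cubes over $R$, where the $i$-th factor $A=(a_{rs})$ acts by $(M^i,N^i,P^i)\mapsto(a_{11}M^i+a_{12}N^i+a_{13}P^i,\ a_{21}M^i+a_{22}N^i+a_{23}P^i,\ a_{31}M^i+a_{32}N^i+a_{33}P^i)$;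 cubes in one orbit are called $R$-equivalent. A cube is integral if its entries lie in $\mathcal{O}_K$, and an integral cube is saturated if for each $i$ the matrices $M^i,N^i,P^i$ are linearly independent mod $\pi$. For non-singular integral cubes that are $K$-equivalent, the level $\ell$ equals $v(\Delta)/12$ up to an additive constant depending only on the $K$-equivalence class, so levels are compared by comparing $v(\Delta)$. An integral cube is non-minimal if it is $K$-equivalent to an integral cube of smaller level. A ternary cubic over $k$ is said to have a unique singular point if the curve it defines in $\mathbb{P}^2$ has a singular point $p\in\mathbb{P}^2(k)$, and no other singular point over a separable closure of $k$ (which is an algebraic closure if $k$ is perfect); a singular point is one where the cubic and its three partial derivatives vanish. **Theorem.** Let $S$ be a non-singular, non-minimal, saturated integral cube, with associated ternary cubics $F_1,F_2,F_3$, and let $f_1,f_2,f_3$ be their reductions mod $\pi$. Then we are in one of the following two situations. (i) At least two of the $f_i$ are non-zero and have a repeated linear factor over $k$. For any choice of two such $f_i,f_j$ ($i\neq j$), we may replace $S$ by an $\mathcal{O}_K$-equivalent cube for which $f_i$ and $f_j$ are divisible by $z^2$, and then apply a transformation in $\mathrm{GL}_3(K)^3$ whose $i$-th and $j$-th components are $\mathrm{Diag}(1,1,\pi)$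 and whose remaining, $m$-th, component $A_m\in\mathrm{GL}_3(K)$ is chosen such that the resulting $M^m,N^m,P^m$ are integral and linearly independent mod $\pi$. (ii) At least two of the $f_i$ define curves with a unique singular point. For any choice of two such $f_i,f_j$ ($i\ne j$), we may replace $S$ by an $\mathcal{O}_K$-equivalent cube for which the unique singular point of each of $f_i$ and $f_j$ is $(1:0:0)$, and then apply a transformation in $\mathrm{GL}_3(K)^3$ whose $i$-th and $j$-th components are $\mathrm{Diag}(1,\pi,\pi)$ and whose remaining component is chosen as in (i). These procedures can always be carried out. Every cube that they give is a non-singular integral cube, $K$-equivalent to $S$, of the same or smaller level; if it is saturated and of the same level then it is again non-minimal, so that the procedures can be repeated. For every sequence of cubes $S=S_0,S_1,S_2,S_3$ in which each $S_{n+1}$ is obtained from $S_n$ by one of these procedures (for any choices), there is $n\in\{1,2,3\}$ such that $S_n$ is not saturated or has smaller level than $S$. -/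

import Mathlib

open MvPolynomial

/-- A `3 × 3 × 3` (Rubik's) cube `S = (s_{ijk})` with entries in `R`. -/
abbrev Cube (R : Type*) := Fin 3 → Fin 3 → Fin 3 → R

section TernaryCubics

variable {R : Type*} [CommRing R]

/-- The coefficient of `x^p y^q z^r`, where `x, y, z` are the variables `X 0, X 1, X 2`. -/
noncomputable def ternaryCoeff (F : MvPolynomial (Fin 3) R) (p q r : ℕ) : R :=
  F.coeff (Finsupp.equivFunOnFinite.symm ![p, q, r])

/-- The (Artin--Rodriguez-Villegas--Tate) Weierstrass equation of the Jacobian of the ternary cubic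
`a x³ + b y³ + c z³ + a₂ x²y + a₃ x²z + b₁ xy² + b₃ y²z + c₁ xz² + c₂ yz² + m xyz`.
It is valid over every ring, and its invariants `c₄`, `c₆`, `Δ` are the classical invariants of
the ternary cubic, scaled so that `c₄(xyz) = 1`, `c₆(xyz) = -1` and `c₄³ - c₆² = 1728 Δ`. -/
noncomputable def ternaryJacobian (F : MvPolynomial (Fin 3) R) : WeierstrassCurve R :=
  let a := ternaryCoeff F 3 0 0
  let b := ternaryCoeff F 0 3 0
  let c := ternaryCoeff F 0 0 3
  let a2 := ternaryCoeff F 2 1 0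
  let a3 := ternaryCoeff F 2 0 1
  let b1 := ternaryCoeff F 1 2 0
  let b3 := ternaryCoeff F 0 2 1
  let c1 := ternaryCoeff F 1 0 2
  let c2 := ternaryCoeff F 0 1 2
  let m := ternaryCoeff F 1 1 1
  { a₁ := m
    a₂ := -(a2 * c2 + a3 * b3 + b1 * c1)
    a₃ := 9 * a * b * c - (a * b3 * c2 + b * a3 * c1 + c * a2 * b1)
      - (a2 * b3 * c1 + a3 * b1 * c2)
    a₄ := -3 * (a * b * c1 * c2 + a * c * b1 * b3 + b * c * a2 * a3)
      + a * (b1 * c2 ^ 2 + b3 ^ 2 * c1) + b * (a2 * c1 ^ 2 + a3 ^ 2 * c2)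
      + c * (a2 ^ 2 * b3 + a3 * b1 ^ 2)
      + a2 * c2 * a3 * b3 + b1 * c1 * a2 * c2 + a3 * b3 * b1 * c1
    a₆ := a * b * c * m ^ 3
      - (b * c * a2 * a3 + a * c * b1 * b3 + a * b * c1 * c2) * m ^ 2
      + (-3 * a * b * c * (b1 * c1 + a3 * b3 + a2 * c2)
        + c * a2 * a3 * b1 * b3 + b * a2 * a3 * c1 * c2 + a * b1 * b3 * c1 * c2
        + b * c * (a3 ^ 2 * b1 + a2 ^ 2 * c1) + a * c * (b1 ^ 2 * c2 + a2 * b3 ^ 2)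
        + a * b * (b3 * c1 ^ 2 + a3 * c2 ^ 2)) * m
      - 27 * a ^ 2 * b ^ 2 * c ^ 2
      + 9 * a * b * c * (c * a2 * b1 + b * a3 * c1 + a * b3 * c2)
      + 3 * a * b * c * (a3 * b1 * c2 + a2 * b3 * c1)
      - a2 * a3 * b1 * b3 * c1 * c2
      - c * (a3 ^ 2 * b1 ^ 2 * b3 + a2 * a3 * b1 ^ 2 * c2 + a2 ^ 2 * b1 * b3 * c1
        + a2 ^ 2 * a3 * b3 ^ 2)
      - b * (a3 ^ 2 * b1 * c1 * c2 + a2 * a3 * b3 * c1 ^ 2 + a2 * a3 ^ 2 * c2 ^ 2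
        + a2 ^ 2 * c1 ^ 2 * c2)
      - a * (b1 * b3 ^ 2 * c1 ^ 2 + b1 ^ 2 * c1 * c2 ^ 2 + a3 * b1 * b3 * c2 ^ 2
        + a2 * b3 ^ 2 * c1 * c2)
      - b * c * a2 * a3 * b1 * c1 - a * c * a2 * b1 * b3 * c2 - a * b * a3 * b3 * c1 * c2
      - b * c ^ 2 * a2 ^ 3 - b ^ 2 * c * a3 ^ 3 - a * c ^ 2 * b1 ^ 3 - a * b ^ 2 * c1 ^ 3
      - a ^ 2 * c * b3 ^ 3 - a ^ 2 * b * c2 ^ 3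
      + 2 * b * c * (a2 * a3 ^ 2 * b3 + a2 ^ 2 * a3 * c2)
      + 2 * a * c * (b1 ^ 2 * b3 * c1 + a3 * b1 * b3 ^ 2)
      + 2 * a * b * (b1 * c1 ^ 2 * c2 + a2 * c1 * c2 ^ 2) }

/-- `f` is non-zero and has a repeated linear factor (with coefficients in `R`). -/
def HasRepeatedLinearFactor (f : MvPolynomial (Fin 3) R) : Prop :=
  f ≠ 0 ∧ ∃ l : Fin 3 → R, l ≠ 0 ∧ (∑ t, C (l t) * X t) ^ 2 ∣ f

end TernaryCubics

section SingularPoints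

variable {k : Type*} [Field k]

/-- The vector `p ≠ 0` represents a singular point, defined over the extension `L` of `k`,
of the plane curve `f = 0`. -/
def IsSingularPoint {L : Type*} [Field L] [Algebra k L] (f : MvPolynomial (Fin 3) k)
    (p : Fin 3 → L) : Prop :=
  p ≠ 0 ∧ aeval p f = 0 ∧ ∀ t, aeval p (pderiv t f) = 0

/-- The point of `ℙ²(k)` represented by `p` is the only singular point of the curve `f = 0`, among
all points defined over a separable closure of `k` (an algebraic closure, if `k` is perfect). -/
def IsUniqueSingularPoint (f : MvPolynomial (Fin 3) k) (p : Fin 3 → k) : Prop :=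
  IsSingularPoint f p ∧
    ∀ q : Fin 3 → SeparableClosure k, IsSingularPoint f q →
      ∃ c : SeparableClosure k, q = fun t => c * algebraMap k (SeparableClosure k) (p t)

end SingularPoints

namespace Cube

section Ring

variable {R : Type*} [CommRing R]

/-- Apply a ring homomorphism to all entries of a cube. -/
def map {R' : Type*} [CommRing R'] (φ : R →+* R') (S : Cube R) : Cube R' :=
  fun i j k => φ (S i j k)

/-- The `i`-th slicing of a cube into three matrices `(Mⁱ, Nⁱ, Pⁱ)`:
`(s_{a j k})_{j,k}`, `(s_{j a k})_{j,k}` and `(s_{j k a})_{j,k}` for `i = 0, 1, 2`. -/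
def slice (S : Cube R) (i : Fin 3) (a : Fin 3) : Matrix (Fin 3) (Fin 3) R :=
  Matrix.of fun j k => (![S a j k, S j a k, S j k a] : Fin 3 → R) i

/-- The ternary cubic `Fᵢ(x,y,z) = det(Mⁱ x + Nⁱ y + Pⁱ z)`. -/
noncomputable def cubic (S : Cube R) (i : Fin 3) : MvPolynomial (Fin 3) R :=
  Matrix.det (∑ a : Fin 3, (X a : MvPolynomial (Fin 3) R) • (S.slice i a).map C)

/-- The discriminant `Δ(S)`, that is, the discriminant of the ternary cubic `F₁`
(the cubics `F₁, F₂, F₃` have the same invariants). -/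
noncomputable def disc (S : Cube R) : R := (ternaryJacobian (S.cubic 0)).Δ

/-- The commuting actions of three matrices on the three slicings: the `i`-th matrix `A = (a_{rs})`
sends `(Mⁱ, Nⁱ, Pⁱ)` to `(a₁₁ Mⁱ + a₁₂ Nⁱ + a₁₃ Pⁱ, a₂₁ Mⁱ + ⋯, a₃₁ Mⁱ + ⋯)`. -/
def act (A : Fin 3 → Matrix (Fin 3) (Fin 3) R) (S : Cube R) : Cube R :=
  fun i j k => ∑ i', ∑ j', ∑ k', A 0 i i' * A 1 j j' * A 2 k k' * S i' j' k'

/-- The action of `GL₃(R)³`. -/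
def glAct (g : Fin 3 → Matrix.GeneralLinearGroup (Fin 3) R) (S : Cube R) : Cube R :=
  S.act fun i => (g i : Matrix (Fin 3) (Fin 3) R)

/-- `R`-equivalence: the two cubes are in the same orbit of `GL₃(R)³`. -/
def Equivalent (S T : Cube R) : Prop :=
  ∃ g : Fin 3 → Matrix.GeneralLinearGroup (Fin 3) R, T = S.glAct g

end Ring

section Local

variable {R : Type*} [CommRing R] [IsLocalRing R]

/-- The reduction of the ternary cubic `Fᵢ` modulo the maximal ideal. -/
noncomputable def redCubic (S : Cube R) (i : Fin 3) :
    MvPolynomial (Fin 3) (IsLocalRing.ResidueField R) :=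
  (S.cubic i).map (IsLocalRing.residue R)

/-- The matrices `Mⁱ, Nⁱ, Pⁱ` are linearly independent modulo the maximal ideal. -/
def SliceIndependent (S : Cube R) (i : Fin 3) : Prop :=
  LinearIndependent (IsLocalRing.ResidueField R)
    fun a => (S.slice i a).map (IsLocalRing.residue R)

/-- A saturated integral cube. -/
def IsSaturated (S : Cube R) : Prop := ∀ i, S.SliceIndependent i

end Local

section DVR

variable {R : Type*} (K : Type*) [CommRing R] [IsDomain R] [IsDiscreteValuationRing R]
  [Field K] [Algebra R K]

/-- The normalised valuation `v(Δ(S))` of the discriminant of an integral cube. The level `ℓ(S)` is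
given by `v(Δ(S)) = v(Δ_E) + 12 κ(P) + 12 ℓ(S)`, where the pair `(E, P)` depends only on the
`K`-equivalence class of `S`; so the levels of `K`-equivalent cubes are compared by `v(Δ)`. -/
noncomputable def discVal (S : Cube R) : ℕ∞ := IsDiscreteValuationRing.addVal R S.disc

/-- Integral cubes that are `K`-equivalent, `K` being the field of fractions. -/
def FracEquivalent (S T : Cube R) : Prop :=
  Equivalent (S.map (algebraMap R K)) (T.map (algebraMap R K))

/-- A cube is non-minimal if some `K`-equivalent integral cube has smaller level. -/
def IsNonMinimal (S : Cube R) : Prop :=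
  ∃ T : Cube R, S.FracEquivalent K T ∧ T.discVal < S.discVal

/-- `T` is obtained from `U` by a transformation over `K` that acts as the matrix `D` on the `i`-th
and the `j`-th slicings, and acts on the remaining `m`-th slicing by some matrix in `GL₃(K)` chosen
such that the matrices `Mᵐ, Nᵐ, Pᵐ` of `T` are integral and linearly independent mod `π`. -/
def Transform (D : Matrix (Fin 3) (Fin 3) K) (i j : Fin 3) (U T : Cube R) : Prop :=
  ∃ A : Fin 3 → Matrix.GeneralLinearGroup (Fin 3) K,
    (A i : Matrix (Fin 3) (Fin 3) K) = D ∧ (A j : Matrix (Fin 3) (Fin 3) K) = D ∧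
    T.map (algebraMap R K) = (U.map (algebraMap R K)).glAct A ∧
    ∀ m, m ≠ i → m ≠ j → T.SliceIndependent m

/-- Procedure (i), using the cubics `fᵢ` and `fⱼ`, which have repeated linear factors: move to an
`𝒪_K`-equivalent cube for which both are divisible by `z²`, then transform by `Diag(1,1,π)`. -/
def StepI (π : R) (i j : Fin 3) (S T : Cube R) : Prop :=
  i ≠ j ∧ ∃ U : Cube R, S.Equivalent U ∧
    (U.redCubic i ≠ 0 ∧ X 2 ^ 2 ∣ U.redCubic i) ∧ (U.redCubic j ≠ 0 ∧ X 2 ^ 2 ∣ U.redCubic j) ∧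
    Transform K (Matrix.diagonal ![1, 1, algebraMap R K π]) i j U T

/-- Procedure (ii), using the cubics `fᵢ` and `fⱼ`, which define curves with a unique singular
point: move to an `𝒪_K`-equivalent cube for which both singular points are `(1:0:0)`, then
transform by `Diag(1,π,π)`. -/
def StepII (π : R) (i j : Fin 3) (S T : Cube R) : Prop :=
  i ≠ j ∧ ∃ U : Cube R, S.Equivalent U ∧
    IsUniqueSingularPoint (U.redCubic i) ![1, 0, 0] ∧
    IsUniqueSingularPoint (U.redCubic j) ![1, 0, 0] ∧
    Transform K (Matrix.diagonal ![1, algebraMap R K π, algebraMap R K π]) i j U T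

/-- One iteration of procedure (i) or (ii), for any admissible choice of two cubics. -/
def Step (π : R) (S T : Cube R) : Prop :=
  ∃ i j, StepI K π i j S T ∨ StepII K π i j S T

end DVR

end Cube

/-!
The argument compares lattices. By the Cartan decomposition over `K` (`Cube.exists_cartan`) the
transformation that witnesses non-minimality is diagonal for suitable bases over `𝒪_K`. So some cube
`𝒪_K`-equivalent to `S` has its `(i, j, k)` entry divisible by `π ^ (a i + b j + c k - s)`, where
the weights `a`, `b`, `c` have least value `0` and total sum at least `3 s + 1`
(`Cube.IsNonMinimal.exists_hasWeight`). Saturation bounds each weight by `s`, and an elementary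
discussion of linear inequalities shows that weights of this kind imply those of one of five types
A, B, C, D, E, up to a permutation of the three slicings (`Cube.IsNonMinimal.exists_type`).

A procedure that uses two of the slicings can be followed in the basis adapted to the weights. Let
`V` be an adapted cube, for which the double lines are `z = 0`, or for which `(1 : 0 : 0)` is a
singular point, in those two slicings. A double line of a non-zero cubic is unique, and so is the
singular point in procedure (ii). Hence the matrices over `𝒪_K` that lead from `V` to the cube used
by the procedure are block triangular modulo `π`, so that conjugation by `Diag(1,1,π)` or
`Diag(1,π,π)` keeps them in `GL₃(𝒪_K)`. In the last slicing the lattice is determined by its being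
saturated. So the result `T` of the procedure can be compared with a diagonal transform of `V`
(`Cube.Transform.exists_levelRatio`): either the level drops, or `T` is `𝒪_K`-equivalent to that
transform, and then it inherits explicit weights (`Cube.Reduces.stepI`, `Cube.Reduces.stepII`).
Levels are compared by `Δ(S) = r ^ 12 Δ(T)` (`Cube.LevelRatio.disc`), which rests on the invariance
of the discriminant of a ternary cubic under linear substitutions (`jacobian_Δ_linSubst`).

The types are then followed through the procedures. As long as the level stays the same and the
cubes stay saturated, type D leads to type A; type B leads to type A, or to a kind of type D for
which the next procedure lowers the level; type C leads to type A or B, and type E to type B or D.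
For type A every procedure lowers the level. So type A needs one procedure, types B and D need at
most two, and types C and E at most three (`Cube.IsNonMinimal.good`, `Cube.Good.exists_lt`).

One of the two situations holds because, in an adapted basis, the relevant reduced cubics have
the form `α x z² + b(y, z)`. A non-zero cubic of this form either has `(1 : 0 : 0)` as its only singular
point or has a repeated linear factor over the residue field: a double root of the binary cubic `b`
over the separable closure is fixed by the Galois group
(`exists_isUniqueSingularPoint_or_hasRepeatedLinearFactor`). If some of the cubics vanish, then the
others have repeated factors, by saturation (`Cube.IsNonMinimal.isAdmissible`). The remaining
component `A_m` of the transformation is given by the Smith normal form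
(`Cube.SliceIndependent.exists_transform`).
-/

/-! ### Ternary cubics and linear substitutions -/

section TernaryCubicForms

variable {R : Type*} [CommRing R]

/-- The ternary cubic with coefficients `c`, in the order
`x³, y³, z³, x²y, x²z, xy², y²z, xz², yz², xyz`. -/
noncomputable def ternaryCubic (c : Fin 10 → R) : MvPolynomial (Fin 3) R :=
  C (c 0) * X 0 ^ 3 + C (c 1) * X 1 ^ 3 + C (c 2) * X 2 ^ 3 + C (c 3) * (X 0 ^ 2 * X 1)
    + C (c 4) * (X 0 ^ 2 * X 2) + C (c 5) * (X 0 * X 1 ^ 2) + C (c 6) * (X 1 ^ 2 * X 2)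
    + C (c 7) * (X 0 * X 2 ^ 2) + C (c 8) * (X 1 * X 2 ^ 2) + C (c 9) * (X 0 * X 1 * X 2)

lemma ternaryCoeff_add (F G : MvPolynomial (Fin 3) R) (p q r : ℕ) :
    ternaryCoeff (F + G) p q r = ternaryCoeff F p q r + ternaryCoeff G p q r := by
  simp [ternaryCoeff]

lemma ternaryCoeff_C_mul (a : R) (F : MvPolynomial (Fin 3) R) (p q r : ℕ) :
    ternaryCoeff (C a * F) p q r = a * ternaryCoeff F p q r := by
  simp [ternaryCoeff]

lemma ternaryCoeff_X0_mul (F : MvPolynomial (Fin 3) R) (p q r : ℕ) :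
    ternaryCoeff (X 0 * F) p q r = if p = 0 then 0 else ternaryCoeff F (p - 1) q r := by
  unfold ternaryCoeff
  rw [coeff_X_mul']
  have : (Finsupp.equivFunOnFinite.symm ![p, q, r] : Fin 3 →₀ ℕ) - Finsupp.single 0 1
      = Finsupp.equivFunOnFinite.symm ![p - 1, q, r] := by
    ext t; fin_cases t <;> simp
  rw [this]
  by_cases hp : p = 0 <;> simp [hp]

lemma ternaryCoeff_X1_mul (F : MvPolynomial (Fin 3) R) (p q r : ℕ) :
    ternaryCoeff (X 1 * F) p q r = if q = 0 then 0 else ternaryCoeff F p (q - 1) r := by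
  unfold ternaryCoeff
  rw [coeff_X_mul']
  have : (Finsupp.equivFunOnFinite.symm ![p, q, r] : Fin 3 →₀ ℕ) - Finsupp.single 1 1
      = Finsupp.equivFunOnFinite.symm ![p, q - 1, r] := by
    ext t; fin_cases t <;> simp
  rw [this]
  by_cases hp : q = 0 <;> simp [hp]

lemma ternaryCoeff_X2_mul (F : MvPolynomial (Fin 3) R) (p q r : ℕ) :
    ternaryCoeff (X 2 * F) p q r = if r = 0 then 0 else ternaryCoeff F p q (r - 1) := by
  unfold ternaryCoeff
  rw [coeff_X_mul']
  have : (Finsupp.equivFunOnFinite.symm ![p, q, r] : Fin 3 →₀ ℕ) - Finsupp.single 2 1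
      = Finsupp.equivFunOnFinite.symm ![p, q, r - 1] := by
    ext t; fin_cases t <;> simp
  rw [this]
  by_cases hp : r = 0 <;> simp [hp]

lemma ternaryCoeff_one (p q r : ℕ) :
    ternaryCoeff (1 : MvPolynomial (Fin 3) R) p q r = if p = 0 ∧ q = 0 ∧ r = 0 then 1 else 0 := by
  unfold ternaryCoeff
  have : (0 : Fin 3 →₀ ℕ) = Finsupp.equivFunOnFinite.symm ![p, q, r] ↔ p = 0 ∧ q = 0 ∧ r = 0 := by
    constructor
    · intro h
      have h' := fun t => DFunLike.congr_fun h t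
      exact ⟨by simpa using (h' 0).symm, by simpa using (h' 1).symm, by simpa using (h' 2).symm⟩
    · rintro ⟨rfl, rfl, rfl⟩
      ext t; fin_cases t <;> rfl
  simp only [coeff_one, this]

lemma ternaryCoeff_ternaryCubic (c : Fin 10 → R) :
    ternaryCoeff (ternaryCubic c) 3 0 0 = c 0 ∧ ternaryCoeff (ternaryCubic c) 0 3 0 = c 1 ∧
    ternaryCoeff (ternaryCubic c) 0 0 3 = c 2 ∧ ternaryCoeff (ternaryCubic c) 2 1 0 = c 3 ∧
    ternaryCoeff (ternaryCubic c) 2 0 1 = c 4 ∧ ternaryCoeff (ternaryCubic c) 1 2 0 = c 5 ∧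
    ternaryCoeff (ternaryCubic c) 0 2 1 = c 6 ∧ ternaryCoeff (ternaryCubic c) 1 0 2 = c 7 ∧
    ternaryCoeff (ternaryCubic c) 0 1 2 = c 8 ∧ ternaryCoeff (ternaryCubic c) 1 1 1 = c 9 := by
  have e : ternaryCubic c = C (c 0) * (X 0 * (X 0 * (X 0 * 1)))
      + C (c 1) * (X 1 * (X 1 * (X 1 * 1))) + C (c 2) * (X 2 * (X 2 * (X 2 * 1)))
      + C (c 3) * (X 0 * (X 0 * (X 1 * 1))) + C (c 4) * (X 0 * (X 0 * (X 2 * 1)))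
      + C (c 5) * (X 0 * (X 1 * (X 1 * 1))) + C (c 6) * (X 1 * (X 1 * (X 2 * 1)))
      + C (c 7) * (X 0 * (X 2 * (X 2 * 1))) + C (c 8) * (X 1 * (X 2 * (X 2 * 1)))
      + C (c 9) * (X 0 * (X 1 * (X 2 * 1))) := by
    unfold ternaryCubic; ring
  rw [e]
  simp only [ternaryCoeff_add, ternaryCoeff_C_mul, ternaryCoeff_X0_mul, ternaryCoeff_X1_mul,
    ternaryCoeff_X2_mul, ternaryCoeff_one]
  simp

lemma ternaryCubic_injective {c d : Fin 10 → R} (h : ternaryCubic c = ternaryCubic d) : c = d := by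
  obtain ⟨c0, c1, c2, c3, c4, c5, c6, c7, c8, c9⟩ := ternaryCoeff_ternaryCubic c
  obtain ⟨d0, d1, d2, d3, d4, d5, d6, d7, d8, d9⟩ := ternaryCoeff_ternaryCubic d
  rw [h] at c0 c1 c2 c3 c4 c5 c6 c7 c8 c9
  ext t
  fin_cases t
  · exact c0.symm.trans d0
  · exact c1.symm.trans d1
  · exact c2.symm.trans d2
  · exact c3.symm.trans d3
  · exact c4.symm.trans d4
  · exact c5.symm.trans d5
  · exact c6.symm.trans d6
  · exact c7.symm.trans d7
  · exact c8.symm.trans d8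
  · exact c9.symm.trans d9

lemma ternaryCubic_zero : ternaryCubic (0 : Fin 10 → R) = 0 := by
  simp [ternaryCubic]

lemma ternaryCubic_eq_zero_iff (c : Fin 10 → R) : ternaryCubic c = 0 ↔ c = 0 :=
  ⟨fun h => ternaryCubic_injective (h.trans ternaryCubic_zero.symm),
    fun h => h ▸ ternaryCubic_zero⟩

lemma C_mul_ternaryCubic (u : R) (c : Fin 10 → R) :
    C u * ternaryCubic c = ternaryCubic (fun t => u * c t) := by
  simp only [ternaryCubic, map_mul]; ring

lemma map_ternaryCubic {R' : Type*} [CommRing R'] (φ : R →+* R') (c : Fin 10 → R) :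
    (ternaryCubic c).map φ = ternaryCubic (fun t => φ (c t)) := by
  simp [ternaryCubic]

lemma aeval_ternaryCubic {A : Type*} [CommRing A] [Algebra R A] (c : Fin 10 → R) (p : Fin 3 → A) :
    aeval p (ternaryCubic c) = algebraMap R A (c 0) * p 0 ^ 3 + algebraMap R A (c 1) * p 1 ^ 3
      + algebraMap R A (c 2) * p 2 ^ 3 + algebraMap R A (c 3) * (p 0 ^ 2 * p 1)
      + algebraMap R A (c 4) * (p 0 ^ 2 * p 2) + algebraMap R A (c 5) * (p 0 * p 1 ^ 2)
      + algebraMap R A (c 6) * (p 1 ^ 2 * p 2) + algebraMap R A (c 7) * (p 0 * p 2 ^ 2)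
      + algebraMap R A (c 8) * (p 1 * p 2 ^ 2) + algebraMap R A (c 9) * (p 0 * p 1 * p 2) := by
  simp [ternaryCubic]

lemma aeval_pderiv_zero_ternaryCubic {A : Type*} [CommRing A] [Algebra R A] (c : Fin 10 → R)
    (p : Fin 3 → A) :
    aeval p (pderiv 0 (ternaryCubic c)) = 3 * algebraMap R A (c 0) * p 0 ^ 2
      + 2 * algebraMap R A (c 3) * (p 0 * p 1) + 2 * algebraMap R A (c 4) * (p 0 * p 2)
      + algebraMap R A (c 5) * p 1 ^ 2 + algebraMap R A (c 7) * p 2 ^ 2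
      + algebraMap R A (c 9) * (p 1 * p 2) := by
  simp [ternaryCubic, Derivation.leibniz_pow, pderiv_X, Derivation.leibniz]
  ring

lemma aeval_pderiv_one_ternaryCubic {A : Type*} [CommRing A] [Algebra R A] (c : Fin 10 → R)
    (p : Fin 3 → A) :
    aeval p (pderiv 1 (ternaryCubic c)) = 3 * algebraMap R A (c 1) * p 1 ^ 2
      + algebraMap R A (c 3) * p 0 ^ 2 + 2 * algebraMap R A (c 5) * (p 0 * p 1)
      + 2 * algebraMap R A (c 6) * (p 1 * p 2) + algebraMap R A (c 8) * p 2 ^ 2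
      + algebraMap R A (c 9) * (p 0 * p 2) := by
  simp [ternaryCubic, Derivation.leibniz_pow, pderiv_X, Derivation.leibniz]
  ring

lemma aeval_pderiv_two_ternaryCubic {A : Type*} [CommRing A] [Algebra R A] (c : Fin 10 → R)
    (p : Fin 3 → A) :
    aeval p (pderiv 2 (ternaryCubic c)) = 3 * algebraMap R A (c 2) * p 2 ^ 2
      + algebraMap R A (c 4) * p 0 ^ 2 + algebraMap R A (c 6) * p 1 ^ 2
      + 2 * algebraMap R A (c 7) * (p 0 * p 2) + 2 * algebraMap R A (c 8) * (p 1 * p 2)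
      + algebraMap R A (c 9) * (p 0 * p 1) := by
  simp [ternaryCubic, Derivation.leibniz_pow, pderiv_X, Derivation.leibniz]
  ring

/-- The coefficients of `l² m`, for linear forms `l` and `m`. -/
def sqMulCoeffs (l m : Fin 3 → R) : Fin 10 → R :=
  ![l 0 ^ 2 * m 0, l 1 ^ 2 * m 1, l 2 ^ 2 * m 2,
    l 0 ^ 2 * m 1 + 2 * l 0 * l 1 * m 0, l 0 ^ 2 * m 2 + 2 * l 0 * l 2 * m 0,
    l 1 ^ 2 * m 0 + 2 * l 0 * l 1 * m 1, l 1 ^ 2 * m 2 + 2 * l 1 * l 2 * m 1,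
    l 2 ^ 2 * m 0 + 2 * l 0 * l 2 * m 2, l 2 ^ 2 * m 1 + 2 * l 1 * l 2 * m 2,
    2 * (l 0 * l 1 * m 2 + l 0 * l 2 * m 1 + l 1 * l 2 * m 0)]

lemma ternaryCubic_sqMulCoeffs (l m : Fin 3 → R) :
    ternaryCubic (sqMulCoeffs l m) = (∑ t, C (l t) * X t) ^ 2 * ∑ t, C (m t) * X t := by
  have h2 : (C 2 : MvPolynomial (Fin 3) R) = 2 := map_ofNat C 2
  simp [ternaryCubic, sqMulCoeffs, Fin.sum_univ_three, h2]
  ring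

/-- A square of a linear form divides a ternary cubic only with a linear quotient. -/
lemma exists_eq_sqMulCoeffs {c : Fin 10 → R} {l : Fin 3 → R}
    (h : (∑ t, C (l t) * X t) ^ 2 ∣ ternaryCubic c) : ∃ m, c = sqMulCoeffs l m := by
  obtain ⟨M, hM⟩ := h
  refine ⟨![ternaryCoeff M 1 0 0, ternaryCoeff M 0 1 0, ternaryCoeff M 0 0 1], ?_⟩
  have e : (∑ t, C (l t) * X t) ^ 2 * M = C (l 0 ^ 2) * (X 0 * (X 0 * M))
      + C (l 1 ^ 2) * (X 1 * (X 1 * M)) + C (l 2 ^ 2) * (X 2 * (X 2 * M))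
      + C (2 * l 0 * l 1) * (X 0 * (X 1 * M)) + C (2 * l 0 * l 2) * (X 0 * (X 2 * M))
      + C (2 * l 1 * l 2) * (X 1 * (X 2 * M)) := by
    have h2 : (C 2 : MvPolynomial (Fin 3) R) = 2 := map_ofNat C 2
    simp [Fin.sum_univ_three, h2]; ring
  rw [e] at hM
  obtain ⟨c0, c1, c2, c3, c4, c5, c6, c7, c8, c9⟩ := ternaryCoeff_ternaryCubic c
  rw [hM] at c0 c1 c2 c3 c4 c5 c6 c7 c8 c9
  simp only [ternaryCoeff_add, ternaryCoeff_C_mul, ternaryCoeff_X0_mul, ternaryCoeff_X1_mul,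
    ternaryCoeff_X2_mul, OfNat.ofNat_ne_zero, one_ne_zero, if_true, if_false, mul_zero, add_zero,
    zero_add, Nat.reduceSub] at c0 c1 c2 c3 c4 c5 c6 c7 c8 c9
  ext t
  fin_cases t <;> simp [sqMulCoeffs]
  · exact c0.symm
  · exact c1.symm
  · exact c2.symm
  · rw [← c3]
  · rw [← c4]
  · rw [← c5]; try ring
  · rw [← c6]
  · rw [← c7]
  · rw [← c8]
  · rw [← c9]; ring

lemma X_two_sq_eq : (X 2 : MvPolynomial (Fin 3) R) ^ 2
    = (∑ t, C ((![0, 0, 1] : Fin 3 → R) t) * X t) ^ 2 := by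
  simp [Fin.sum_univ_three]

/-- Divisibility of a ternary cubic by `z²`, in terms of coefficients. -/
lemma X_two_sq_dvd_iff (c : Fin 10 → R) : X 2 ^ 2 ∣ ternaryCubic c ↔
    c 0 = 0 ∧ c 1 = 0 ∧ c 3 = 0 ∧ c 4 = 0 ∧ c 5 = 0 ∧ c 6 = 0 ∧ c 9 = 0 := by
  constructor
  · intro h
    rw [X_two_sq_eq] at h
    obtain ⟨m, rfl⟩ := exists_eq_sqMulCoeffs h
    simp [sqMulCoeffs]
  · rintro ⟨h0, h1, h3, h4, h5, h6, h9⟩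
    refine ⟨C (c 2) * X 2 + C (c 7) * X 0 + C (c 8) * X 1, ?_⟩
    simp only [ternaryCubic, h0, h1, h3, h4, h5, h6, h9, map_zero]
    ring

/-- Linear substitution: the row vector of variables is multiplied by `g` on the right. -/
noncomputable def linSubst (g : Matrix (Fin 3) (Fin 3) R) :
    MvPolynomial (Fin 3) R →ₐ[R] MvPolynomial (Fin 3) R :=
  aeval fun b => ∑ a, C (g a b) * X a

lemma linSubst_linSubst (g h : Matrix (Fin 3) (Fin 3) R) (f : MvPolynomial (Fin 3) R) :
    linSubst g (linSubst h f) = linSubst (g * h) f := by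
  have : (linSubst g).comp (linSubst h) = linSubst (g * h) := by
    refine algHom_ext fun b => ?_
    simp only [linSubst, AlgHom.comp_apply, aeval_X, Matrix.mul_apply, Fin.sum_univ_three, map_add,
      map_mul, algHom_C, MvPolynomial.algebraMap_eq]
    ring
  exact DFunLike.congr_fun this f

lemma linSubst_one (f : MvPolynomial (Fin 3) R) : linSubst 1 f = f := by
  have : linSubst (1 : Matrix (Fin 3) (Fin 3) R) = AlgHom.id R _ := by
    refine algHom_ext fun b => ?_
    simp [linSubst, Matrix.one_apply]
  rw [this]; rfl

lemma linSubst_linear (g : Matrix (Fin 3) (Fin 3) R) (l : Fin 3 → R) :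
    linSubst g (∑ t, C (l t) * X t) = ∑ t, C (g.mulVec l t) * X t := by
  simp [linSubst, Fin.sum_univ_three, Matrix.mulVec, dotProduct, algHom_C]
  ring

lemma map_linSubst {R' : Type*} [CommRing R'] (φ : R →+* R') (g : Matrix (Fin 3) (Fin 3) R)
    (f : MvPolynomial (Fin 3) R) :
    (linSubst g f).map φ = linSubst (g.map φ) (f.map φ) := by
  simp only [linSubst, aeval_def, eval₂_map]
  rw [eval₂_eq', eval₂_eq', map_sum]
  simp [MvPolynomial.algebraMap_eq]

/-- Linear substitutions preserve the space of ternary cubics. -/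
lemma exists_linSubst_ternaryCubic (g : Matrix (Fin 3) (Fin 3) R) (c : Fin 10 → R) :
    ∃ d, linSubst g (ternaryCubic c) = ternaryCubic d := by
  have key : ∀ p q r : Fin 3 → R, ∃ d : Fin 10 → R,
      (∑ a, C (p a) * X a) * (∑ a, C (q a) * X a) * (∑ a, C (r a) * X a) = ternaryCubic d := by
    intro p q r
    refine ⟨![p 0 * q 0 * r 0, p 1 * q 1 * r 1, p 2 * q 2 * r 2,
      p 0 * q 0 * r 1 + p 0 * q 1 * r 0 + p 1 * q 0 * r 0,
      p 0 * q 0 * r 2 + p 0 * q 2 * r 0 + p 2 * q 0 * r 0,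
      p 0 * q 1 * r 1 + p 1 * q 0 * r 1 + p 1 * q 1 * r 0,
      p 1 * q 1 * r 2 + p 1 * q 2 * r 1 + p 2 * q 1 * r 1,
      p 0 * q 2 * r 2 + p 2 * q 0 * r 2 + p 2 * q 2 * r 0,
      p 1 * q 2 * r 2 + p 2 * q 1 * r 2 + p 2 * q 2 * r 1,
      p 0 * q 1 * r 2 + p 0 * q 2 * r 1 + p 1 * q 0 * r 2 + p 1 * q 2 * r 0 + p 2 * q 0 * r 1
        + p 2 * q 1 * r 0], ?_⟩
    simp [ternaryCubic, Fin.sum_univ_three]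
    ring
  have smul : ∀ (u : R) (F : MvPolynomial (Fin 3) R), (∃ d, F = ternaryCubic d) →
      ∃ d, C u * F = ternaryCubic d := by
    rintro u _ ⟨d, rfl⟩; exact ⟨_, C_mul_ternaryCubic u d⟩
  have add : ∀ F G : MvPolynomial (Fin 3) R, (∃ d, F = ternaryCubic d) →
      (∃ d, G = ternaryCubic d) → ∃ d, F + G = ternaryCubic d := by
    rintro _ _ ⟨d, rfl⟩ ⟨e, rfl⟩
    refine ⟨fun t => d t + e t, ?_⟩
    simp only [ternaryCubic, map_add]; ring
  have e : linSubst g (ternaryCubic c) = C (c 0) * ((∑ a, C (g a 0) * X a) *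
      (∑ a, C (g a 0) * X a) * (∑ a, C (g a 0) * X a))
      + C (c 1) * ((∑ a, C (g a 1) * X a) * (∑ a, C (g a 1) * X a) * (∑ a, C (g a 1) * X a))
      + C (c 2) * ((∑ a, C (g a 2) * X a) * (∑ a, C (g a 2) * X a) * (∑ a, C (g a 2) * X a))
      + C (c 3) * ((∑ a, C (g a 0) * X a) * (∑ a, C (g a 0) * X a) * (∑ a, C (g a 1) * X a))
      + C (c 4) * ((∑ a, C (g a 0) * X a) * (∑ a, C (g a 0) * X a) * (∑ a, C (g a 2) * X a))
      + C (c 5) * ((∑ a, C (g a 0) * X a) * (∑ a, C (g a 1) * X a) * (∑ a, C (g a 1) * X a))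
      + C (c 6) * ((∑ a, C (g a 1) * X a) * (∑ a, C (g a 1) * X a) * (∑ a, C (g a 2) * X a))
      + C (c 7) * ((∑ a, C (g a 0) * X a) * (∑ a, C (g a 2) * X a) * (∑ a, C (g a 2) * X a))
      + C (c 8) * ((∑ a, C (g a 1) * X a) * (∑ a, C (g a 2) * X a) * (∑ a, C (g a 2) * X a))
      + C (c 9) * ((∑ a, C (g a 0) * X a) * (∑ a, C (g a 1) * X a) * (∑ a, C (g a 2) * X a)) := by
    rw [linSubst, aeval_ternaryCubic]
    simp only [MvPolynomial.algebraMap_eq]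
    ring
  rw [e]
  iterate 9 refine add _ _ ?_ (smul _ _ (key _ _ _))
  exact smul _ _ (key _ _ _)

end TernaryCubicForms

/-! ### Invariance of the discriminant -/

section Discriminant

variable {R : Type*} [CommRing R]

lemma C_two : (C 2 : MvPolynomial (Fin 3) R) = 2 := map_ofNat C 2

lemma C_three : (C 3 : MvPolynomial (Fin 3) R) = 3 := map_ofNat C 3

lemma ternaryJacobian_ternaryCubic (c : Fin 10 → R) :
    ternaryJacobian (ternaryCubic c) =
  { a₁ := c 9
    a₂ := -(c 3 * c 8 + c 4 * c 6 + c 5 * c 7)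
    a₃ := 9 * c 0 * c 1 * c 2 - (c 0 * c 6 * c 8 + c 1 * c 4 * c 7 + c 2 * c 3 * c 5)
      - (c 3 * c 6 * c 7 + c 4 * c 5 * c 8)
    a₄ := -3 * (c 0 * c 1 * c 7 * c 8 + c 0 * c 2 * c 5 * c 6 + c 1 * c 2 * c 3 * c 4)
      + c 0 * (c 5 * c 8 ^ 2 + c 6 ^ 2 * c 7) + c 1 * (c 3 * c 7 ^ 2 + c 4 ^ 2 * c 8)
      + c 2 * (c 3 ^ 2 * c 6 + c 4 * c 5 ^ 2)
      + c 3 * c 8 * c 4 * c 6 + c 5 * c 7 * c 3 * c 8 + c 4 * c 6 * c 5 * c 7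
    a₆ := c 0 * c 1 * c 2 * c 9 ^ 3
      - (c 1 * c 2 * c 3 * c 4 + c 0 * c 2 * c 5 * c 6 + c 0 * c 1 * c 7 * c 8) * c 9 ^ 2
      + (-3 * c 0 * c 1 * c 2 * (c 5 * c 7 + c 4 * c 6 + c 3 * c 8)
        + c 2 * c 3 * c 4 * c 5 * c 6 + c 1 * c 3 * c 4 * c 7 * c 8 + c 0 * c 5 * c 6 * c 7 * c 8
        + c 1 * c 2 * (c 4 ^ 2 * c 5 + c 3 ^ 2 * c 7) + c 0 * c 2 * (c 5 ^ 2 * c 8 + c 3 * c 6 ^ 2)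
        + c 0 * c 1 * (c 6 * c 7 ^ 2 + c 4 * c 8 ^ 2)) * c 9
      - 27 * c 0 ^ 2 * c 1 ^ 2 * c 2 ^ 2
      + 9 * c 0 * c 1 * c 2 * (c 2 * c 3 * c 5 + c 1 * c 4 * c 7 + c 0 * c 6 * c 8)
      + 3 * c 0 * c 1 * c 2 * (c 4 * c 5 * c 8 + c 3 * c 6 * c 7)
      - c 3 * c 4 * c 5 * c 6 * c 7 * c 8
      - c 2 * (c 4 ^ 2 * c 5 ^ 2 * c 6 + c 3 * c 4 * c 5 ^ 2 * c 8 + c 3 ^ 2 * c 5 * c 6 * c 7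
        + c 3 ^ 2 * c 4 * c 6 ^ 2)
      - c 1 * (c 4 ^ 2 * c 5 * c 7 * c 8 + c 3 * c 4 * c 6 * c 7 ^ 2 + c 3 * c 4 ^ 2 * c 8 ^ 2
        + c 3 ^ 2 * c 7 ^ 2 * c 8)
      - c 0 * (c 5 * c 6 ^ 2 * c 7 ^ 2 + c 5 ^ 2 * c 7 * c 8 ^ 2 + c 4 * c 5 * c 6 * c 8 ^ 2
        + c 3 * c 6 ^ 2 * c 7 * c 8)
      - c 1 * c 2 * c 3 * c 4 * c 5 * c 7 - c 0 * c 2 * c 3 * c 5 * c 6 * c 8 - c 0 * c 1 * c 4 * c 6 * c 7 * c 8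
      - c 1 * c 2 ^ 2 * c 3 ^ 3 - c 1 ^ 2 * c 2 * c 4 ^ 3 - c 0 * c 2 ^ 2 * c 5 ^ 3 - c 0 * c 1 ^ 2 * c 7 ^ 3
      - c 0 ^ 2 * c 2 * c 6 ^ 3 - c 0 ^ 2 * c 1 * c 8 ^ 3
      + 2 * c 1 * c 2 * (c 3 * c 4 ^ 2 * c 6 + c 3 ^ 2 * c 4 * c 8)
      + 2 * c 0 * c 2 * (c 5 ^ 2 * c 6 * c 7 + c 4 * c 5 * c 6 ^ 2)
      + 2 * c 0 * c 1 * (c 5 * c 7 ^ 2 * c 8 + c 3 * c 7 * c 8 ^ 2) } := by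
  obtain ⟨c0, c1, c2, c3, c4, c5, c6, c7, c8, c9⟩ := ternaryCoeff_ternaryCubic c
  simp only [ternaryJacobian, c0, c1, c2, c3, c4, c5, c6, c7, c8, c9]

/-- The discriminant is unchanged by a change `(r, s, t)` of Weierstrass coordinates. For each
elementary transvection of the variables of a ternary cubic, such a change relates the Jacobians of
the two cubics. -/
lemma jacobian_Δ_eq_of_variableChange (W W' : WeierstrassCurve R) (r s t : R)
    (h1 : W'.a₁ = W.a₁ + 2 * s) (h2 : W'.a₂ = W.a₂ - s * W.a₁ + 3 * r - s ^ 2)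
    (h3 : W'.a₃ = W.a₃ + r * W.a₁ + 2 * t)
    (h4 : W'.a₄ = W.a₄ - s * W.a₃ + 2 * r * W.a₂ - (t + r * s) * W.a₁ + 3 * r ^ 2 - 2 * s * t)
    (h6 : W'.a₆ = W.a₆ + r * W.a₄ + r ^ 2 * W.a₂ + r ^ 3 - t * W.a₃ - t ^ 2 - r * t * W.a₁) :
    W'.Δ = W.Δ := by
  have : W' = (⟨1, r, s, t⟩ : WeierstrassCurve.VariableChange R) • W := by
    ext <;> simp [WeierstrassCurve.variableChange_a₁, WeierstrassCurve.variableChange_a₂,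
      WeierstrassCurve.variableChange_a₃, WeierstrassCurve.variableChange_a₄,
      WeierstrassCurve.variableChange_a₆, h1, h2, h3, h4, h6]
  rw [this, WeierstrassCurve.variableChange_Δ]
  simp

lemma jacobian_Δ_transvection_10 (t : R) (c : Fin 10 → R) :
    (ternaryJacobian (linSubst (Matrix.transvection 1 0 t) (ternaryCubic c))).Δ
      = (ternaryJacobian (ternaryCubic c)).Δ := by
  have e : linSubst (Matrix.transvection 1 0 t) (ternaryCubic c) = ternaryCubic ![c 0, c 5 * t + c
      3 * t ^ 2 + c 1 + c 0 * t ^ 3, c 2, 3 * c 0 * t + c 3, c 4, 3 * c 0 * t ^ 2 + 2 * c 3 * t +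
      c 5, c 9 * t + c 6 + c 4 * t ^ 2, c 7, c 8 + c 7 * t, 2 * c 4 * t + c 9] := by
    rw [linSubst, aeval_ternaryCubic]
    simp [ternaryCubic, Matrix.transvection, Matrix.single, Fin.sum_univ_three, Matrix.one_apply,
      C_two, C_three]
    ring
  rw [e]
  refine jacobian_Δ_eq_of_variableChange _ _ (-(c 3 * c 7 * t) - c 0 * c 8 * t - 2 * c 0 * c 7 * t
    ^ 2) (c 4 * t) (3 * c 0 * c 2 * c 5 * t - c 4 * c 5 * c 7 * t - c 3 * c 4 * c 8 * t - 2 * c 3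
    * c 4 * c 7 * t ^ 2 - c 2 * c 3 ^ 2 * t - c 0 * c 7 * c 9 * t ^ 2 - 2 * c 0 * c 6 * c 7 * t -
    2 * c 0 * c 4 * c 8 * t ^ 2 - 4 * c 0 * c 4 * c 7 * t ^ 3) ?_ ?_ ?_ ?_ ?_
  all_goals
    simp only [ternaryJacobian_ternaryCubic, Matrix.cons_val]
    ring

lemma jacobian_Δ_transvection_20 (t : R) (c : Fin 10 → R) :
    (ternaryJacobian (linSubst (Matrix.transvection 2 0 t) (ternaryCubic c))).Δ
      = (ternaryJacobian (ternaryCubic c)).Δ := by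
  have e : linSubst (Matrix.transvection 2 0 t) (ternaryCubic c) = ternaryCubic ![c 0, c 1, c 7 *
      t + c 4 * t ^ 2 + c 2 + c 0 * t ^ 3, c 3, 3 * c 0 * t + c 4, c 5, c 6 + c 5 * t, 3 * c 0 * t
      ^ 2 + 2 * c 4 * t + c 7, c 9 * t + c 8 + c 3 * t ^ 2, 2 * c 3 * t + c 9] := by
    rw [linSubst, aeval_ternaryCubic]
    simp [ternaryCubic, Matrix.transvection, Matrix.single, Fin.sum_univ_three, Matrix.one_apply,
      C_two, C_three]
    ring
  rw [e]
  refine jacobian_Δ_eq_of_variableChange _ _ (-(c 4 * c 5 * t) - c 0 * c 6 * t - 2 * c 0 * c 5 * t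
    ^ 2) (c 3 * t) (3 * c 0 * c 1 * c 7 * t - c 3 * c 5 * c 7 * t - c 3 * c 4 * c 6 * t - 2 * c 3
    * c 4 * c 5 * t ^ 2 - c 1 * c 4 ^ 2 * t - c 0 * c 5 * c 9 * t ^ 2 - 2 * c 0 * c 5 * c 8 * t -
    2 * c 0 * c 3 * c 6 * t ^ 2 - 4 * c 0 * c 3 * c 5 * t ^ 3) ?_ ?_ ?_ ?_ ?_
  all_goals
    simp only [ternaryJacobian_ternaryCubic, Matrix.cons_val]
    ring

lemma jacobian_Δ_transvection_01 (t : R) (c : Fin 10 → R) :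
    (ternaryJacobian (linSubst (Matrix.transvection 0 1 t) (ternaryCubic c))).Δ
      = (ternaryJacobian (ternaryCubic c)).Δ := by
  have e : linSubst (Matrix.transvection 0 1 t) (ternaryCubic c) = ternaryCubic ![c 5 * t ^ 2 + c
      3 * t + c 1 * t ^ 3 + c 0, c 1, c 2, 3 * c 1 * t ^ 2 + 2 * c 5 * t + c 3, c 9 * t + c 6 * t
      ^ 2 + c 4, 3 * c 1 * t + c 5, c 6, c 8 * t + c 7, c 8, 2 * c 6 * t + c 9] := by
    rw [linSubst, aeval_ternaryCubic]
    simp [ternaryCubic, Matrix.transvection, Matrix.single, Fin.sum_univ_three, Matrix.one_apply,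
      C_two, C_three]
    ring
  rw [e]
  refine jacobian_Δ_eq_of_variableChange _ _ (-(c 5 * c 8 * t) - 2 * c 1 * c 8 * t ^ 2 - c 1 * c 7
    * t) (c 6 * t) (3 * c 1 * c 2 * c 3 * t - 2 * c 5 * c 6 * c 8 * t ^ 2 - c 5 * c 6 * c 7 * t -
    c 3 * c 6 * c 8 * t - c 2 * c 5 ^ 2 * t - c 1 * c 8 * c 9 * t ^ 2 - 4 * c 1 * c 6 * c 8 * t ^
    3 - 2 * c 1 * c 6 * c 7 * t ^ 2 - 2 * c 1 * c 4 * c 8 * t) ?_ ?_ ?_ ?_ ?_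
  all_goals
    simp only [ternaryJacobian_ternaryCubic, Matrix.cons_val]
    ring

lemma jacobian_Δ_transvection_21 (t : R) (c : Fin 10 → R) :
    (ternaryJacobian (linSubst (Matrix.transvection 2 1 t) (ternaryCubic c))).Δ
      = (ternaryJacobian (ternaryCubic c)).Δ := by
  have e : linSubst (Matrix.transvection 2 1 t) (ternaryCubic c) = ternaryCubic ![c 0, c 1, c 8 *
      t + c 6 * t ^ 2 + c 2 + c 1 * t ^ 3, c 3, c 4 + c 3 * t, c 5, 3 * c 1 * t + c 6, c 9 * t + c
      7 + c 5 * t ^ 2, 3 * c 1 * t ^ 2 + 2 * c 6 * t + c 8, 2 * c 5 * t + c 9] := by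
    rw [linSubst, aeval_ternaryCubic]
    simp [ternaryCubic, Matrix.transvection, Matrix.single, Fin.sum_univ_three, Matrix.one_apply,
      C_two, C_three]
    ring
  rw [e]
  refine jacobian_Δ_eq_of_variableChange _ _ (-(c 3 * c 6 * t) - c 1 * c 4 * t - 2 * c 1 * c 3 * t
    ^ 2) (c 5 * t) (3 * c 0 * c 1 * c 8 * t - c 4 * c 5 * c 6 * t - c 3 * c 5 * c 8 * t - 2 * c 3
    * c 5 * c 6 * t ^ 2 - 2 * c 1 * c 4 * c 5 * t ^ 2 - c 1 * c 3 * c 9 * t ^ 2 - 2 * c 1 * c 3 *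
    c 7 * t - 4 * c 1 * c 3 * c 5 * t ^ 3 - c 0 * c 6 ^ 2 * t) ?_ ?_ ?_ ?_ ?_
  all_goals
    simp only [ternaryJacobian_ternaryCubic, Matrix.cons_val]
    ring

lemma jacobian_Δ_transvection_02 (t : R) (c : Fin 10 → R) :
    (ternaryJacobian (linSubst (Matrix.transvection 0 2 t) (ternaryCubic c))).Δ
      = (ternaryJacobian (ternaryCubic c)).Δ := by
  have e : linSubst (Matrix.transvection 0 2 t) (ternaryCubic c) = ternaryCubic ![c 7 * t ^ 2 + c
      4 * t + c 2 * t ^ 3 + c 0, c 1, c 2, c 9 * t + c 8 * t ^ 2 + c 3, 3 * c 2 * t ^ 2 + 2 * c 7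
      * t + c 4, c 6 * t + c 5, c 6, 3 * c 2 * t + c 7, c 8, 2 * c 8 * t + c 9] := by
    rw [linSubst, aeval_ternaryCubic]
    simp [ternaryCubic, Matrix.transvection, Matrix.single, Fin.sum_univ_three, Matrix.one_apply,
      C_two, C_three]
    ring
  rw [e]
  refine jacobian_Δ_eq_of_variableChange _ _ (-(c 6 * c 7 * t) - 2 * c 2 * c 6 * t ^ 2 - c 2 * c 5
    * t) (c 8 * t) (3 * c 1 * c 2 * c 4 * t - 2 * c 6 * c 7 * c 8 * t ^ 2 - c 5 * c 7 * c 8 * t -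
    c 4 * c 6 * c 8 * t - c 2 * c 6 * c 9 * t ^ 2 - 4 * c 2 * c 6 * c 8 * t ^ 3 - 2 * c 2 * c 5 *
    c 8 * t ^ 2 - 2 * c 2 * c 3 * c 6 * t - c 1 * c 7 ^ 2 * t) ?_ ?_ ?_ ?_ ?_
  all_goals
    simp only [ternaryJacobian_ternaryCubic, Matrix.cons_val]
    ring

lemma jacobian_Δ_transvection_12 (t : R) (c : Fin 10 → R) :
    (ternaryJacobian (linSubst (Matrix.transvection 1 2 t) (ternaryCubic c))).Δ
      = (ternaryJacobian (ternaryCubic c)).Δ := by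
  have e : linSubst (Matrix.transvection 1 2 t) (ternaryCubic c) = ternaryCubic ![c 0, c 8 * t ^ 2
      + c 6 * t + c 2 * t ^ 3 + c 1, c 2, c 4 * t + c 3, c 4, c 9 * t + c 7 * t ^ 2 + c 5, 3 * c 2
      * t ^ 2 + 2 * c 8 * t + c 6, c 7, 3 * c 2 * t + c 8, 2 * c 7 * t + c 9] := by
    rw [linSubst, aeval_ternaryCubic]
    simp [ternaryCubic, Matrix.transvection, Matrix.single, Fin.sum_univ_three, Matrix.one_apply,
      C_two, C_three]
    ring
  rw [e]
  refine jacobian_Δ_eq_of_variableChange _ _ (-(c 4 * c 8 * t) - 2 * c 2 * c 4 * t ^ 2 - c 2 * c 3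
    * t) (c 7 * t) (3 * c 0 * c 2 * c 6 * t - 2 * c 4 * c 7 * c 8 * t ^ 2 - c 4 * c 6 * c 7 * t -
    c 3 * c 7 * c 8 * t - c 2 * c 4 * c 9 * t ^ 2 - 4 * c 2 * c 4 * c 7 * t ^ 3 - 2 * c 2 * c 4 *
    c 5 * t - 2 * c 2 * c 3 * c 7 * t ^ 2 - c 0 * c 8 ^ 2 * t) ?_ ?_ ?_ ?_ ?_
  all_goals
    simp only [ternaryJacobian_ternaryCubic, Matrix.cons_val]
    ring


lemma weierstrass_Δ_of_scaling (W W' : WeierstrassCurve R) (u : R) (h1 : W'.a₁ = u * W.a₁)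
    (h2 : W'.a₂ = u ^ 2 * W.a₂) (h3 : W'.a₃ = u ^ 3 * W.a₃) (h4 : W'.a₄ = u ^ 4 * W.a₄)
    (h6 : W'.a₆ = u ^ 6 * W.a₆) : W'.Δ = u ^ 12 * W.Δ := by
  simp only [WeierstrassCurve.Δ, WeierstrassCurve.b₂, WeierstrassCurve.b₄, WeierstrassCurve.b₆,
    WeierstrassCurve.b₈, h1, h2, h3, h4, h6]
  ring

lemma jacobian_Δ_diagonal (d : Fin 3 → R) (c : Fin 10 → R) :
    (ternaryJacobian (linSubst (Matrix.diagonal d) (ternaryCubic c))).Δ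
      = (Matrix.diagonal d).det ^ 12 * (ternaryJacobian (ternaryCubic c)).Δ := by
  have e : linSubst (Matrix.diagonal d) (ternaryCubic c) = ternaryCubic ![c 0 * d 0 ^ 3,
      c 1 * d 1 ^ 3, c 2 * d 2 ^ 3, c 3 * d 0 ^ 2 * d 1, c 4 * d 0 ^ 2 * d 2, c 5 * d 0 * d 1 ^ 2,
      c 6 * d 1 ^ 2 * d 2, c 7 * d 0 * d 2 ^ 2, c 8 * d 1 * d 2 ^ 2, c 9 * d 0 * d 1 * d 2] := by
    rw [linSubst, aeval_ternaryCubic]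
    simp [ternaryCubic, Fin.sum_univ_three, Matrix.diagonal_apply]
    ring
  rw [e, Matrix.det_diagonal, Fin.prod_univ_three]
  refine weierstrass_Δ_of_scaling _ _ _ ?_ ?_ ?_ ?_ ?_
  all_goals
    simp only [ternaryJacobian_ternaryCubic, Matrix.cons_val]
    ring

/-- The discriminant of a ternary cubic is an `SL₃`-invariant of weight `12`. -/
lemma jacobian_Δ_linSubst {K : Type*} [Field K] (g : Matrix (Fin 3) (Fin 3) K) (hg : g.det ≠ 0)
    (c : Fin 10 → K) :
    (ternaryJacobian (linSubst g (ternaryCubic c))).Δ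
      = g.det ^ 12 * (ternaryJacobian (ternaryCubic c)).Δ := by
  revert c
  refine Matrix.diagonal_transvection_induction_of_det_ne_zero (fun g => ∀ c : Fin 10 → K,
    (ternaryJacobian (linSubst g (ternaryCubic c))).Δ
      = g.det ^ 12 * (ternaryJacobian (ternaryCubic c)).Δ) g hg ?_ ?_ ?_
  · exact fun D _ c => jacobian_Δ_diagonal D c
  · rintro ⟨i, j, hij, t⟩ c
    rw [Matrix.TransvectionStruct.det, one_pow, one_mul]
    simp only [Matrix.TransvectionStruct.toMatrix]
    fin_cases i <;> fin_cases j
    · exact absurd rfl hij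
    · exact jacobian_Δ_transvection_01 t c
    · exact jacobian_Δ_transvection_02 t c
    · exact jacobian_Δ_transvection_10 t c
    · exact absurd rfl hij
    · exact jacobian_Δ_transvection_12 t c
    · exact jacobian_Δ_transvection_20 t c
    · exact jacobian_Δ_transvection_21 t c
    · exact absurd rfl hij
  · intro A B _ _ hA hB c
    obtain ⟨d, hd⟩ := exists_linSubst_ternaryCubic B c
    rw [← linSubst_linSubst, hd, hA, ← hd, hB, Matrix.det_mul]
    ring

lemma jacobian_Δ_C_mul (u : R) (c : Fin 10 → R) :
    (ternaryJacobian (C u * ternaryCubic c)).Δ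
      = u ^ 12 * (ternaryJacobian (ternaryCubic c)).Δ := by
  rw [C_mul_ternaryCubic]
  refine weierstrass_Δ_of_scaling _ _ _ (by simp only [ternaryJacobian_ternaryCubic]) ?_ ?_ ?_ ?_
  all_goals
    simp only [ternaryJacobian_ternaryCubic]
    ring

end Discriminant

/-! ### Group actions on cubes and the associated cubics -/

namespace Cube

section Actions

variable {R : Type*} [CommRing R]

/-- The action of a matrix on the first slicing of a cube. -/
def act0 (M : Matrix (Fin 3) (Fin 3) R) (S : Cube R) : Cube R :=
  fun i j k => ∑ i', M i i' * S i' j k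

/-- The action of a matrix on the second slicing of a cube. -/
def act1 (M : Matrix (Fin 3) (Fin 3) R) (S : Cube R) : Cube R :=
  fun i j k => ∑ j', M j j' * S i j' k

/-- The action of a matrix on the third slicing of a cube. -/
def act2 (M : Matrix (Fin 3) (Fin 3) R) (S : Cube R) : Cube R :=
  fun i j k => ∑ k', M k k' * S i j k'

lemma act_eq (A : Fin 3 → Matrix (Fin 3) (Fin 3) R) (S : Cube R) :
    S.act A = act0 (A 0) (act1 (A 1) (act2 (A 2) S)) := by
  funext i j k
  simp only [act, act0, act1, act2, Finset.mul_sum, mul_assoc]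

lemma act0_act0 (M N : Matrix (Fin 3) (Fin 3) R) (S : Cube R) :
    act0 M (act0 N S) = act0 (M * N) S := by
  funext i j k
  simp only [act0, Matrix.mul_apply, Fin.sum_univ_three]
  ring

lemma act1_act1 (M N : Matrix (Fin 3) (Fin 3) R) (S : Cube R) :
    act1 M (act1 N S) = act1 (M * N) S := by
  funext i j k
  simp only [act1, Matrix.mul_apply, Fin.sum_univ_three]
  ring

lemma act2_act2 (M N : Matrix (Fin 3) (Fin 3) R) (S : Cube R) :
    act2 M (act2 N S) = act2 (M * N) S := by
  funext i j k
  simp only [act2, Matrix.mul_apply, Fin.sum_univ_three]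
  ring

lemma act1_act0 (M N : Matrix (Fin 3) (Fin 3) R) (S : Cube R) :
    act1 M (act0 N S) = act0 N (act1 M S) := by
  funext i j k
  simp only [act0, act1, Fin.sum_univ_three]
  ring

lemma act2_act0 (M N : Matrix (Fin 3) (Fin 3) R) (S : Cube R) :
    act2 M (act0 N S) = act0 N (act2 M S) := by
  funext i j k
  simp only [act0, act2, Fin.sum_univ_three]
  ring

lemma act2_act1 (M N : Matrix (Fin 3) (Fin 3) R) (S : Cube R) :
    act2 M (act1 N S) = act1 N (act2 M S) := by
  funext i j k
  simp only [act1, act2, Fin.sum_univ_three]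
  ring

lemma act0_one (S : Cube R) : act0 1 S = S := by
  funext i j k
  simp [act0, Matrix.one_apply]

lemma act1_one (S : Cube R) : act1 1 S = S := by
  funext i j k
  simp [act1, Matrix.one_apply]

lemma act2_one (S : Cube R) : act2 1 S = S := by
  funext i j k
  simp [act2, Matrix.one_apply]

lemma act_act (A B : Fin 3 → Matrix (Fin 3) (Fin 3) R) (S : Cube R) :
    (S.act B).act A = S.act fun t => A t * B t := by
  simp only [act_eq, act2_act0, act2_act1, act1_act0, act2_act2, act1_act1, act0_act0]

lemma act_one (S : Cube R) : S.act (fun _ => 1) = S := by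
  simp only [act_eq, act0_one, act1_one, act2_one]

lemma map_act {R' : Type*} [CommRing R'] (φ : R →+* R') (A : Fin 3 → Matrix (Fin 3) (Fin 3) R)
    (S : Cube R) : (S.act A).map φ = (S.map φ).act fun t => (A t).map φ := by
  funext i j k
  simp [map, act]

lemma map_act0 {R' : Type*} [CommRing R'] (φ : R →+* R') (M : Matrix (Fin 3) (Fin 3) R)
    (S : Cube R) : (act0 M S).map φ = act0 (M.map φ) (S.map φ) := by
  funext i j k
  simp [map, act0]

lemma Equivalent.trans {S T U : Cube R} (h : S.Equivalent T) (h' : T.Equivalent U) :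
    S.Equivalent U := by
  obtain ⟨g, rfl⟩ := h
  obtain ⟨g', rfl⟩ := h'
  exact ⟨fun t => g' t * g t, by simp only [glAct, act_act, Units.val_mul]⟩

lemma Equivalent.symm {S T : Cube R} (h : S.Equivalent T) : T.Equivalent S := by
  obtain ⟨g, rfl⟩ := h
  refine ⟨fun t => (g t)⁻¹, ?_⟩
  simp only [glAct, act_act, ← Units.val_mul, inv_mul_cancel, Units.val_one, act_one]

lemma Equivalent.of_act {S : Cube R} {A : Fin 3 → Matrix (Fin 3) (Fin 3) R}
    (hA : ∀ t, IsUnit (A t).det) : S.Equivalent (S.act A) :=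
  ⟨fun t => ((Matrix.isUnit_iff_isUnit_det _).2 (hA t)).unit, rfl⟩

lemma Equivalent.of_act0 (S : Cube R) {M : Matrix (Fin 3) (Fin 3) R} (hM : IsUnit M.det) :
    S.Equivalent (act0 M S) := by
  have h := Equivalent.of_act (S := S) (A := ![M, 1, 1])
    (fun t => by fin_cases t <;> simp [hM])
  simpa [act_eq, act1_one, act2_one] using h

lemma Equivalent.of_act2 (S : Cube R) {M : Matrix (Fin 3) (Fin 3) R} (hM : IsUnit M.det) :
    S.Equivalent (act2 M S) := by
  have h := Equivalent.of_act (S := S) (A := ![1, 1, M])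
    (fun t => by fin_cases t <;> simp [hM])
  simpa [act_eq, act0_one, act1_one] using h

/-- Exchange of the first two slicings. -/
def sw01 (S : Cube R) : Cube R := fun i j k => S j i k

/-- Exchange of the last two slicings. -/
def sw12 (S : Cube R) : Cube R := fun i j k => S i k j

lemma sw01_act (A : Fin 3 → Matrix (Fin 3) (Fin 3) R) (S : Cube R) :
    (S.act A).sw01 = S.sw01.act ![A 1, A 0, A 2] := by
  rw [act_eq, act_eq, ← act1_act0]
  rfl

lemma sw12_act (A : Fin 3 → Matrix (Fin 3) (Fin 3) R) (S : Cube R) :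
    (S.act A).sw12 = S.sw12.act ![A 0, A 2, A 1] := by
  rw [act_eq, act_eq, ← act2_act1]
  rfl

lemma sw01_glAct (g : Fin 3 → Matrix.GeneralLinearGroup (Fin 3) R) (S : Cube R) :
    (S.glAct g).sw01 = S.sw01.glAct ![g 1, g 0, g 2] := by
  rw [glAct, sw01_act, glAct]
  congr 1; funext t; fin_cases t <;> rfl

lemma sw12_glAct (g : Fin 3 → Matrix.GeneralLinearGroup (Fin 3) R) (S : Cube R) :
    (S.glAct g).sw12 = S.sw12.glAct ![g 0, g 2, g 1] := by
  rw [glAct, sw12_act, glAct]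
  congr 1; funext t; fin_cases t <;> rfl

lemma Equivalent.sw01 {S T : Cube R} (h : S.Equivalent T) : S.sw01.Equivalent T.sw01 := by
  obtain ⟨g, rfl⟩ := h
  exact ⟨_, sw01_glAct g S⟩

lemma Equivalent.sw12 {S T : Cube R} (h : S.Equivalent T) : S.sw12.Equivalent T.sw12 := by
  obtain ⟨g, rfl⟩ := h
  exact ⟨_, sw12_glAct g S⟩

end Actions

section Cubics

variable {R : Type*} [CommRing R]

/-- The exchange of the first two slicings, on indices of slicings. -/
def idx01 : Fin 3 → Fin 3 := ![1, 0, 2]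

/-- The exchange of the last two slicings, on indices of slicings. -/
def idx12 : Fin 3 → Fin 3 := ![0, 2, 1]

lemma cubic_zero_eq (S : Cube R) : S.cubic 0 =
    (Matrix.of fun j k => ∑ a, X a * C (S a j k)).det := by
  rw [cubic]
  congr 1

lemma cubic_one_eq (S : Cube R) : S.cubic 1 =
    (Matrix.of fun j k => ∑ a, X a * C (S j a k)).det := by
  rw [cubic]
  congr 1

lemma cubic_two_eq (S : Cube R) : S.cubic 2 =
    (Matrix.of fun j k => ∑ a, X a * C (S j k a)).det := by
  rw [cubic]
  congr 1

lemma cubic_sw01 (S : Cube R) (i : Fin 3) : S.sw01.cubic (idx01 i) = S.cubic i := by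
  fin_cases i
  · exact (cubic_one_eq _).trans (cubic_zero_eq S).symm
  · exact (cubic_zero_eq _).trans (cubic_one_eq S).symm
  · refine (cubic_two_eq _).trans (Eq.trans ?_ (cubic_two_eq S).symm)
    rw [← Matrix.det_transpose]
    rfl

lemma cubic_sw12 (S : Cube R) (i : Fin 3) : S.sw12.cubic (idx12 i) = S.cubic i := by
  fin_cases i
  · refine (cubic_zero_eq _).trans (Eq.trans ?_ (cubic_zero_eq S).symm)
    rw [← Matrix.det_transpose]
    rfl
  · exact (cubic_two_eq _).trans (cubic_one_eq S).symm
  · exact (cubic_one_eq _).trans (cubic_two_eq S).symm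

lemma map_cubic {R' : Type*} [CommRing R'] (φ : R →+* R') (S : Cube R) (i : Fin 3) :
    (S.cubic i).map φ = (S.map φ).cubic i := by
  have key : ∀ S : Cube R, (S.cubic 0).map φ = (S.map φ).cubic 0 := by
    intro S
    rw [cubic_zero_eq, cubic_zero_eq, RingHom.map_det]
    congr 1
    ext1 j k
    simp [map]
  fin_cases i
  · exact key S
  · have h := key S.sw01
    rwa [show (0 : Fin 3) = idx01 1 from rfl, cubic_sw01,
      show S.sw01.map φ = (S.map φ).sw01 from rfl, cubic_sw01] at h
  · have h := key S.sw12.sw01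
    rwa [show (0 : Fin 3) = idx01 1 from rfl, cubic_sw01,
      show S.sw12.sw01.map φ = (S.map φ).sw12.sw01 from rfl, cubic_sw01,
      show (1 : Fin 3) = idx12 2 from rfl, cubic_sw12, cubic_sw12] at h

lemma cubic_zero_act (A : Fin 3 → Matrix (Fin 3) (Fin 3) R) (S : Cube R) :
    (S.act A).cubic 0 = C ((A 1).det * (A 2).det) * linSubst (A 0) (S.cubic 0) := by
  rw [cubic_zero_eq, cubic_zero_eq, AlgHom.map_det, map_mul]
  have e1 : (C (A 1).det : MvPolynomial (Fin 3) R) = ((A 1).map C).det := RingHom.map_det _ _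
  have e2 : (C (A 2).det : MvPolynomial (Fin 3) R) = ((A 2).map C).transpose.det := by
    rw [Matrix.det_transpose]; exact RingHom.map_det _ _
  rw [e1, e2, mul_right_comm, ← Matrix.det_mul, ← Matrix.det_mul]
  congr 1
  ext1 j k
  simp only [act_eq, act0, act1, act2, linSubst, Matrix.of_apply, Matrix.mul_apply, Matrix.map_apply,
    Matrix.transpose_apply, Fin.sum_univ_three, map_add, map_mul, AlgHom.mapMatrix_apply, aeval_X,
    algHom_C, MvPolynomial.algebraMap_eq]
  ring

/-- Each associated cubic changes, under the group action, by a linear substitution and a unit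
factor. -/
lemma exists_cubic_glAct (g : Fin 3 → Matrix.GeneralLinearGroup (Fin 3) R) (S : Cube R)
    (i : Fin 3) : ∃ u : R, IsUnit u ∧
      (S.glAct g).cubic i = C u * linSubst (g i : Matrix (Fin 3) (Fin 3) R) (S.cubic i) := by
  have hu : ∀ a : Matrix.GeneralLinearGroup (Fin 3) R,
      IsUnit (a : Matrix (Fin 3) (Fin 3) R).det := fun a =>
    (Matrix.isUnit_iff_isUnit_det _).1 a.isUnit
  have key : ∀ (g : Fin 3 → Matrix.GeneralLinearGroup (Fin 3) R) (S : Cube R),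
      ∃ u : R, IsUnit u ∧
      (S.glAct g).cubic 0 = C u * linSubst (g 0 : Matrix (Fin 3) (Fin 3) R) (S.cubic 0) :=
    fun g S => ⟨_, (hu (g 1)).mul (hu (g 2)), cubic_zero_act _ S⟩
  fin_cases i
  · exact key g S
  · obtain ⟨u, hu, h⟩ := key ![g 1, g 0, g 2] S.sw01
    refine ⟨u, hu, ?_⟩
    rw [← sw01_glAct, show (0 : Fin 3) = idx01 1 from rfl, cubic_sw01, cubic_sw01] at h
    exact h
  · obtain ⟨u, hu, h⟩ := key ![g 2, g 0, g 1] S.sw12.sw01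
    refine ⟨u, hu, ?_⟩
    have e : S.sw12.sw01.glAct ![g 2, g 0, g 1] = (S.glAct g).sw12.sw01 := by
      rw [sw12_glAct, sw01_glAct]; rfl
    rw [e, show (0 : Fin 3) = idx01 1 from rfl, cubic_sw01, cubic_sw01,
      show (1 : Fin 3) = idx12 2 from rfl, cubic_sw12, cubic_sw12] at h
    exact h

/-- The determinant with rows `u`, `v`, `w`. -/
def rowDet (u v w : Fin 3 → R) : R :=
  u 0 * (v 1 * w 2 - v 2 * w 1) - u 1 * (v 0 * w 2 - v 2 * w 0) + u 2 * (v 0 * w 1 - v 1 * w 0)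

/-- The mixed determinant that contributes to the coefficient of `x_a x_b x_c` in `F₁`. -/
def mixedDet (S : Cube R) (a b c : Fin 3) : R := rowDet (S a 0) (S b 1) (S c 2)

/-- The coefficients of the cubic `F₁`. -/
def coeffs (S : Cube R) : Fin 10 → R :=
  ![S.mixedDet 0 0 0, S.mixedDet 1 1 1, S.mixedDet 2 2 2,
    S.mixedDet 0 0 1 + S.mixedDet 0 1 0 + S.mixedDet 1 0 0,
    S.mixedDet 0 0 2 + S.mixedDet 0 2 0 + S.mixedDet 2 0 0,
    S.mixedDet 0 1 1 + S.mixedDet 1 0 1 + S.mixedDet 1 1 0,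
    S.mixedDet 1 1 2 + S.mixedDet 1 2 1 + S.mixedDet 2 1 1,
    S.mixedDet 0 2 2 + S.mixedDet 2 0 2 + S.mixedDet 2 2 0,
    S.mixedDet 1 2 2 + S.mixedDet 2 1 2 + S.mixedDet 2 2 1,
    S.mixedDet 0 1 2 + S.mixedDet 0 2 1 + S.mixedDet 1 0 2 + S.mixedDet 1 2 0
      + S.mixedDet 2 0 1 + S.mixedDet 2 1 0]

lemma cubic_zero_eq_ternaryCubic (S : Cube R) : S.cubic 0 = ternaryCubic S.coeffs := by
  rw [cubic_zero_eq, Matrix.det_fin_three]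
  simp only [ternaryCubic, coeffs, mixedDet, rowDet, Matrix.of_apply, Fin.sum_univ_three, map_add,
    map_mul, map_sub, Matrix.cons_val]
  ring

lemma cubic_one_eq_ternaryCubic (S : Cube R) : S.cubic 1 = ternaryCubic S.sw01.coeffs := by
  rw [← cubic_zero_eq_ternaryCubic, ← cubic_sw01 S 1]
  rfl

lemma cubic_two_eq_ternaryCubic (S : Cube R) : S.cubic 2 = ternaryCubic S.sw12.sw01.coeffs := by
  rw [← cubic_zero_eq_ternaryCubic, ← cubic_sw12 S 2, ← cubic_sw01 S.sw12 _]
  rfl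

lemma exists_cubic_eq_ternaryCubic (S : Cube R) (i : Fin 3) :
    ∃ c, S.cubic i = ternaryCubic c := by
  fin_cases i
  · exact ⟨_, cubic_zero_eq_ternaryCubic S⟩
  · exact ⟨_, cubic_one_eq_ternaryCubic S⟩
  · exact ⟨_, cubic_two_eq_ternaryCubic S⟩

lemma disc_act {K : Type*} [Field K] (A : Fin 3 → Matrix (Fin 3) (Fin 3) K)
    (hA : (A 0).det ≠ 0) (S : Cube K) :
    (S.act A).disc = ((A 0).det * (A 1).det * (A 2).det) ^ 12 * S.disc := by
  rw [disc, cubic_zero_act, disc, cubic_zero_eq_ternaryCubic]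
  obtain ⟨d, hd⟩ := exists_linSubst_ternaryCubic (A 0) S.coeffs
  rw [hd, jacobian_Δ_C_mul, ← hd, jacobian_Δ_linSubst _ hA]
  ring

lemma map_disc {R' : Type*} [CommRing R'] (φ : R →+* R') (S : Cube R) :
    (S.map φ).disc = φ S.disc := by
  rw [disc, disc, ← map_cubic, cubic_zero_eq_ternaryCubic, map_ternaryCubic,
    ternaryJacobian_ternaryCubic, ternaryJacobian_ternaryCubic]
  rw [← WeierstrassCurve.map_Δ]
  congr 1
  ext <;> simp [map_ofNat φ 3, map_ofNat φ 9, map_ofNat φ 27, map_ofNat φ 2]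

end Cubics

end Cube

/-! ### Saturation and the Smith normal form -/

namespace Cube

lemma isUnit_det_gl {A : Type*} [CommRing A] (g : Matrix.GeneralLinearGroup (Fin 3) A) :
    IsUnit (g : Matrix (Fin 3) (Fin 3) A).det :=
  (Matrix.isUnit_iff_isUnit_det _).1 g.isUnit

section Saturation

variable {R : Type*} [CommRing R] [IsLocalRing R]

local notation "res" => IsLocalRing.residue R

lemma sliceIndependent_zero_iff (S : Cube R) : S.SliceIndependent 0 ↔
    ∀ c : Fin 3 → IsLocalRing.ResidueField R, (∀ j l, ∑ a, c a * res (S a j l) = 0) → c = 0 := by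
  rw [SliceIndependent, Fintype.linearIndependent_iff]
  refine forall_congr' fun c => ?_
  rw [← Matrix.ext_iff, funext_iff]
  simp [Matrix.sum_apply, slice]

lemma sliceIndependent_one_iff (S : Cube R) : S.SliceIndependent 1 ↔
    ∀ c : Fin 3 → IsLocalRing.ResidueField R, (∀ j l, ∑ a, c a * res (S j a l) = 0) → c = 0 := by
  rw [SliceIndependent, Fintype.linearIndependent_iff]
  refine forall_congr' fun c => ?_
  rw [← Matrix.ext_iff, funext_iff]
  simp [Matrix.sum_apply, slice]

lemma sliceIndependent_two_iff (S : Cube R) : S.SliceIndependent 2 ↔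
    ∀ c : Fin 3 → IsLocalRing.ResidueField R, (∀ j l, ∑ a, c a * res (S j l a) = 0) → c = 0 := by
  rw [SliceIndependent, Fintype.linearIndependent_iff]
  refine forall_congr' fun c => ?_
  rw [← Matrix.ext_iff, funext_iff]
  simp [Matrix.sum_apply, slice]

lemma sliceIndependent_sw01 (S : Cube R) (i : Fin 3) :
    S.sw01.SliceIndependent (idx01 i) ↔ S.SliceIndependent i := by
  fin_cases i
  · exact (sliceIndependent_one_iff _).trans (sliceIndependent_zero_iff S).symm
  · exact (sliceIndependent_zero_iff _).trans (sliceIndependent_one_iff S).symm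
  · refine (sliceIndependent_two_iff _).trans
      (Iff.trans (forall_congr' fun c => ?_) (sliceIndependent_two_iff S).symm)
    rw [forall_comm]
    rfl

lemma sliceIndependent_sw12 (S : Cube R) (i : Fin 3) :
    S.sw12.SliceIndependent (idx12 i) ↔ S.SliceIndependent i := by
  fin_cases i
  · refine (sliceIndependent_zero_iff _).trans
      (Iff.trans (forall_congr' fun c => ?_) (sliceIndependent_zero_iff S).symm)
    rw [forall_comm]
    rfl
  · exact (sliceIndependent_two_iff _).trans (sliceIndependent_one_iff S).symm
  · exact (sliceIndependent_one_iff _).trans (sliceIndependent_two_iff S).symm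

lemma IsSaturated.sw01 {S : Cube R} (h : S.IsSaturated) : S.sw01.IsSaturated := by
  intro i
  have : i = idx01 (idx01 i) := by fin_cases i <;> rfl
  rw [this, sliceIndependent_sw01]
  exact h _

lemma IsSaturated.sw12 {S : Cube R} (h : S.IsSaturated) : S.sw12.IsSaturated := by
  intro i
  have : i = idx12 (idx12 i) := by fin_cases i <;> rfl
  rw [this, sliceIndependent_sw12]
  exact h _

lemma isUnit_det_map_residue {M : Matrix (Fin 3) (Fin 3) R} (hM : IsUnit M.det) :
    IsUnit (M.map res).det := by
  have := hM.map res
  rwa [RingHom.map_det] at this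

lemma SliceIndependent.act_zero {S : Cube R} (h : S.SliceIndependent 0)
    {A : Fin 3 → Matrix (Fin 3) (Fin 3) R} (hA : ∀ t, IsUnit (A t).det) :
    (S.act A).SliceIndependent 0 := by
  rw [sliceIndependent_zero_iff] at h ⊢
  intro c hc
  set B := fun t => (A t).map res with hB
  have hBu : ∀ t, IsUnit (B t) := fun t =>
    (Matrix.isUnit_iff_isUnit_det _).2 (isUnit_det_map_residue (hA t))
  set D := Matrix.vecMul c (B 0) with hD
  set Y : Matrix (Fin 3) (Fin 3) (IsLocalRing.ResidueField R) :=
    Matrix.of fun j l => ∑ a, D a * res (S a j l) with hY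
  have e : B 1 * Y * (B 2).transpose = 0 := by
    ext j l
    refine Eq.trans ?_ (hc j l)
    simp only [act_eq, act0, act1, act2, hY, hD, hB, Matrix.mul_apply, Matrix.of_apply,
      Matrix.vecMul, dotProduct, Matrix.transpose_apply, Matrix.map_apply, Fin.sum_univ_three,
      map_add, map_mul]
    ring
  have e' : Y = 0 := by
    have h2 : IsUnit (B 2).transpose := (Matrix.isUnit_transpose _).2 (hBu 2)
    have := h2.mul_left_eq_zero.1 e
    exact (hBu 1).mul_right_eq_zero.1 this
  have hD0 : D = 0 := h D fun j l => congr_fun (congr_fun e' j) l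
  exact (Matrix.vecMul_injective_iff_isUnit.2 (hBu 0)) (by
    change Matrix.vecMul c (B 0) = Matrix.vecMul 0 (B 0)
    rw [← hD, hD0, Matrix.zero_vecMul])

lemma SliceIndependent.act {S : Cube R} {i : Fin 3} (h : S.SliceIndependent i)
    {A : Fin 3 → Matrix (Fin 3) (Fin 3) R} (hA : ∀ t, IsUnit (A t).det) :
    (S.act A).SliceIndependent i := by
  fin_cases i
  · exact h.act_zero hA
  · have h' := (sliceIndependent_sw01 S 1).2 h
    have := SliceIndependent.act_zero (A := ![A 1, A 0, A 2]) h'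
      (fun t => by fin_cases t <;> simp [hA])
    rw [← sw01_act] at this
    exact (sliceIndependent_sw01 (S.act A) 1).1 this
  · have h' := (sliceIndependent_sw01 S.sw12 1).2 ((sliceIndependent_sw12 S 2).2 h)
    have := SliceIndependent.act_zero (A := ![A 2, A 0, A 1]) h'
      (fun t => by fin_cases t <;> simp [hA])
    have e : S.sw12.sw01.act ![A 2, A 0, A 1] = (S.act A).sw12.sw01 := by
      rw [sw12_act, sw01_act]; rfl
    change SliceIndependent (S.sw12.sw01.act ![A 2, A 0, A 1]) 0 at this
    rw [e] at this
    exact (sliceIndependent_sw12 (S.act A) 2).1 ((sliceIndependent_sw01 (S.act A).sw12 1).1 this)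

lemma SliceIndependent.equivalent {S T : Cube R} {i : Fin 3} (h : S.SliceIndependent i)
    (e : S.Equivalent T) : T.SliceIndependent i := by
  obtain ⟨g, rfl⟩ := e
  exact h.act fun t => isUnit_det_gl (g t)

lemma IsSaturated.equivalent {S T : Cube R} (h : S.IsSaturated)
    (e : S.Equivalent T) : T.IsSaturated := fun i => (h i).equivalent e

end Saturation

section SmithNormalForm

variable {R : Type*} [CommRing R] [IsDomain R] [IsPrincipalIdealRing R] [IsLocalRing R]

/-- Smith normal form of three linearly independent row vectors over a local principal ideal
domain: they are obtained, by an invertible matrix and a diagonal one, from rows that are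
linearly independent over the residue field. -/
lemma exists_smith {ι : Type*} [Fintype ι] [DecidableEq ι] (W : Matrix (Fin 3) ι R)
    (hW : LinearIndependent R fun i => W i) :
    ∃ (P : Matrix (Fin 3) (Fin 3) R) (a : Fin 3 → R) (Y : Matrix (Fin 3) ι R),
      IsUnit P.det ∧ (∀ i, a i ≠ 0) ∧
      LinearIndependent (IsLocalRing.ResidueField R) (fun i t => IsLocalRing.residue R (Y i t)) ∧
      W = P * Matrix.diagonal a * Y := by
  classical
  set N := Submodule.span R (Set.range fun i => W i) with hN
  let bW : Module.Basis (Fin 3) R N := Module.Basis.span hW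
  obtain ⟨n, snf⟩ := Submodule.smithNormalForm (Pi.basisFun R ι) N
  have hn : n = 3 := by
    have h1 := Module.finrank_eq_card_basis snf.bN
    have h2 := Module.finrank_eq_card_basis bW
    simpa using h1.symm.trans h2
  subst hn
  refine ⟨(snf.bN.toMatrix bW).transpose, snf.a, Matrix.of fun i => snf.bM (snf.f i), ?_, ?_, ?_, ?_⟩
  · rw [Matrix.det_transpose, ← Module.Basis.det_apply]
    exact snf.bN.isUnit_det bW
  · intro i h0
    have := snf.snf i
    rw [h0, zero_smul] at this
    exact snf.bN.ne_zero i (Subtype.ext this)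
  · have hu : IsUnit (((Pi.basisFun R ι).toMatrix snf.bM).map (IsLocalRing.residue R)).transpose := by
      rw [Matrix.isUnit_transpose, Matrix.isUnit_iff_isUnit_det]
      have := ((Pi.basisFun R ι).isUnit_det snf.bM).map (IsLocalRing.residue R)
      rwa [Module.Basis.det_apply, RingHom.map_det] at this
    exact (Matrix.linearIndependent_rows_of_isUnit hu).comp snf.f snf.f.injective
  · ext i t
    have h1 : (bW i : ι → R) = W i := by
      rw [Module.Basis.span_apply]
    have h2 : (bW i : ι → R) = ∑ j, snf.bN.repr (bW i) j • (snf.bN j : ι → R) := by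
      have := congrArg Subtype.val (snf.bN.sum_repr (bW i))
      rw [AddSubmonoidClass.coe_finsetSum] at this
      exact this.symm
    rw [← h1, h2]
    rw [Matrix.mul_apply]
    simp only [snf.snf, Finset.sum_apply, Pi.smul_apply, smul_eq_mul, Matrix.mul_diagonal,
      Matrix.transpose_apply, Module.Basis.toMatrix_apply, Matrix.of_apply]
    exact Finset.sum_congr rfl fun j _ => by ring

end SmithNormalForm

end Cube

/-! ### Weights and levels -/

namespace Cube

section Weights

variable {R : Type*} [CommRing R]

/-- The cube `S` is equivalent to a cube whose `(i,j,k)` entry is divisible by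
`π ^ (a i + b j + c k - s)`. The subtraction is truncated, as the cube is integral anyway. -/
def HasWeight (π : R) (s : ℕ) (a b c : Fin 3 → ℕ) (S : Cube R) : Prop :=
  ∃ V : Cube R, S.Equivalent V ∧ ∀ i j k, π ^ (a i + b j + c k - s) ∣ V i j k

lemma HasWeight.sw01 {π : R} {s : ℕ} {a b c : Fin 3 → ℕ} {S : Cube R}
    (h : S.HasWeight π s a b c) : S.sw01.HasWeight π s b a c := by
  obtain ⟨V, hV, hd⟩ := h
  refine ⟨V.sw01, hV.sw01, fun i j k => ?_⟩
  rw [add_comm (b i)]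
  exact hd j i k

lemma HasWeight.sw12 {π : R} {s : ℕ} {a b c : Fin 3 → ℕ} {S : Cube R}
    (h : S.HasWeight π s a b c) : S.sw12.HasWeight π s a c b := by
  obtain ⟨V, hV, hd⟩ := h
  refine ⟨V.sw12, hV.sw12, fun i j k => ?_⟩
  rw [add_right_comm]
  exact hd i k j

lemma HasWeight.mono {π : R} {s s' : ℕ} {a b c a' b' c' : Fin 3 → ℕ} {S : Cube R}
    (h : S.HasWeight π s a b c)
    (hle : ∀ i j k, a' i + b' j + c' k - s' ≤ a i + b j + c k - s) :
    S.HasWeight π s' a' b' c' := by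
  obtain ⟨V, hV, hd⟩ := h
  exact ⟨V, hV, fun i j k => (pow_dvd_pow _ (hle i j k)).trans (hd i j k)⟩

lemma equivalent_perm (S : Cube R) (σ τ ρ : Equiv.Perm (Fin 3)) :
    S.Equivalent fun i j k => S (σ i) (τ j) (ρ k) := by
  have h := Equivalent.of_act (S := S) (A := ![σ.permMatrix R, τ.permMatrix R, ρ.permMatrix R])
    (fun t => by
      have hu : ∀ ω : Equiv.Perm (Fin 3), IsUnit (ω.permMatrix R).det := fun ω => by
        rw [Matrix.det_permutation]
        exact ((Equiv.Perm.sign ω).isUnit.map (Int.castRingHom R))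
      fin_cases t
      exacts [hu σ, hu τ, hu ρ])
  convert h using 1
  funext i j k
  simp [act_eq, act0, act1, act2, Equiv.Perm.permMatrix, PEquiv.toMatrix_apply]

lemma HasWeight.perm {π : R} {s : ℕ} {a b c : Fin 3 → ℕ} {S : Cube R}
    (h : S.HasWeight π s a b c) (σ τ ρ : Equiv.Perm (Fin 3)) :
    S.HasWeight π s (a ∘ σ) (b ∘ τ) (c ∘ ρ) := by
  obtain ⟨V, hV, hd⟩ := h
  exact ⟨_, hV.trans (equivalent_perm V σ τ ρ), fun i j k => hd _ _ _⟩

end Weights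

section Levels

lemma disc_act_of_domain {R : Type*} [CommRing R] [IsDomain R] (A : Fin 3 → Matrix (Fin 3) (Fin 3) R)
    (hA : (A 0).det ≠ 0) (S : Cube R) :
    (S.act A).disc = ((A 0).det * (A 1).det * (A 2).det) ^ 12 * S.disc := by
  apply IsFractionRing.injective R (FractionRing R)
  have e : ∀ t, ((A t).map (algebraMap R (FractionRing R))).det = algebraMap R _ (A t).det :=
    fun t => (RingHom.map_det _ _).symm
  rw [← map_disc, map_act, disc_act _ ?_, map_disc]
  · simp only [e, map_mul, map_pow]
  · rw [e]
    exact fun h => hA ((map_eq_zero_iff _ (IsFractionRing.injective R (FractionRing R))).1 h)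

variable {R : Type*} (K : Type*) [CommRing R] [Field K] [Algebra R K]

/-- The integral cube `T` is obtained from `S` by an element of `GL₃(K)³` whose determinants have
product `r⁻¹`. Then `Δ(S) = r¹² Δ(T)`: the level drops by the valuation of `r`. -/
def LevelRatio (S T : Cube R) (r : R) : Prop :=
  ∃ A : Fin 3 → Matrix.GeneralLinearGroup (Fin 3) K,
    T.map (algebraMap R K) = (S.map (algebraMap R K)).glAct A ∧
    (A 0 : Matrix (Fin 3) (Fin 3) K).det * (A 1 : Matrix (Fin 3) (Fin 3) K).det
      * (A 2 : Matrix (Fin 3) (Fin 3) K).det * algebraMap R K r = 1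

variable {K}

lemma LevelRatio.sw01 {S T : Cube R} {r : R} (h : LevelRatio K S T r) :
    LevelRatio K S.sw01 T.sw01 r := by
  obtain ⟨A, hA, hr⟩ := h
  refine ⟨![A 1, A 0, A 2], ?_, ?_⟩
  · have := congrArg Cube.sw01 hA
    rw [sw01_glAct] at this
    exact this
  · rw [← hr]
    simp only [Matrix.cons_val]
    ring

lemma LevelRatio.sw12 {S T : Cube R} {r : R} (h : LevelRatio K S T r) :
    LevelRatio K S.sw12 T.sw12 r := by
  obtain ⟨A, hA, hr⟩ := h
  refine ⟨![A 0, A 2, A 1], ?_, ?_⟩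
  · have := congrArg Cube.sw12 hA
    rw [sw12_glAct] at this
    exact this
  · rw [← hr]
    simp only [Matrix.cons_val]
    ring

lemma LevelRatio.trans {S T U : Cube R} {r r' : R} (h : LevelRatio K S T r)
    (h' : LevelRatio K T U r') : LevelRatio K S U (r * r') := by
  obtain ⟨A, hA, hr⟩ := h
  obtain ⟨B, hB, hr'⟩ := h'
  refine ⟨fun t => B t * A t, ?_, ?_⟩
  · rw [hB, hA]
    simp only [glAct, act_act, Units.val_mul]
  · simp only [Units.val_mul, Matrix.det_mul, map_mul]
    linear_combination hr' + hr * ((B 0 : Matrix (Fin 3) (Fin 3) K).det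
      * (B 1 : Matrix (Fin 3) (Fin 3) K).det * (B 2 : Matrix (Fin 3) (Fin 3) K).det
      * algebraMap R K r')

lemma LevelRatio.fracEquivalent {S T : Cube R} {r : R} (h : LevelRatio K S T r) :
    S.FracEquivalent K T := by
  obtain ⟨A, hA, -⟩ := h
  exact ⟨A, hA⟩

lemma LevelRatio.disc [IsDomain R] [IsFractionRing R K] {S T : Cube R} {r : R}
    (h : LevelRatio K S T r) : S.disc = r ^ 12 * T.disc := by
  obtain ⟨A, hA, hr⟩ := h
  apply IsFractionRing.injective R K
  have e := congrArg Cube.disc hA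
  rw [glAct, disc_act _ (isUnit_det_gl (A 0)).ne_zero, map_disc, map_disc] at e
  rw [map_mul, map_pow, e, ← mul_assoc, ← mul_pow, mul_comm (algebraMap R K r), hr, one_pow, one_mul]

lemma Equivalent.exists_levelRatio [IsDomain R] {S T : Cube R} (h : S.Equivalent T) :
    ∃ r, IsUnit r ∧ LevelRatio K S T r := by
  obtain ⟨g, rfl⟩ := h
  obtain ⟨u, hu⟩ := ((isUnit_det_gl (g 0)).mul (isUnit_det_gl (g 1))).mul (isUnit_det_gl (g 2))
  refine ⟨(u⁻¹ : Rˣ), u⁻¹.isUnit, fun t => Matrix.GeneralLinearGroup.map (algebraMap R K) (g t),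
    ?_, ?_⟩
  · rw [glAct, map_act]
    rfl
  · have e : ∀ t, ((Matrix.GeneralLinearGroup.map (algebraMap R K) (g t) :
        Matrix (Fin 3) (Fin 3) K)).det = algebraMap R K (g t : Matrix (Fin 3) (Fin 3) R).det := by
      intro t
      rw [RingHom.map_det]
      rfl
    rw [e, e, e, ← map_mul, ← map_mul, ← map_mul, ← hu, Units.mul_inv, map_one]

end Levels

section Nonminimal

variable {R K : Type*} [CommRing R] [IsDomain R] [IsDiscreteValuationRing R]
  [Field K] [Algebra R K] [IsFractionRing R K]

/-- The Cartan decomposition of an invertible matrix over the field of fractions of a discrete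
valuation ring. -/
lemma exists_cartan {π : R} (hπ : Irreducible π) (A : Matrix (Fin 3) (Fin 3) K) (hA : A.det ≠ 0) :
    ∃ (N : ℕ) (m : Fin 3 → ℕ) (P Q : Matrix (Fin 3) (Fin 3) R), IsUnit P.det ∧ IsUnit Q.det ∧
      algebraMap R K π ^ N • A
        = (P * Matrix.diagonal (fun i => π ^ m i) * Q).map (algebraMap R K) := by
  obtain ⟨⟨b, hb⟩, hW⟩ := IsLocalization.exist_integer_multiples_of_finite (nonZeroDivisors R)
    (fun p : Fin 3 × Fin 3 => A p.1 p.2)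
  obtain ⟨N, u, hbu⟩ := IsDiscreteValuationRing.eq_unit_mul_pow_irreducible
    (nonZeroDivisors.ne_zero hb) hπ
  choose W' hW' using hW
  set W : Matrix (Fin 3) (Fin 3) R := Matrix.of fun i j => ((u⁻¹ : Rˣ) : R) * W' (i, j) with hWdef
  have hWA : algebraMap R K π ^ N • A = W.map (algebraMap R K) := by
    ext i j
    have := hW' (i, j)
    simp only [Algebra.smul_def, hbu, map_mul, map_pow] at this
    simp only [hWdef, Matrix.smul_apply, Matrix.map_apply, Matrix.of_apply, smul_eq_mul, map_mul,
      this]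
    rw [← mul_assoc, ← mul_assoc, ← map_mul, Units.inv_mul, map_one, one_mul]
  have hπ0 : algebraMap R K π ≠ 0 := fun h =>
    hπ.ne_zero ((map_eq_zero_iff _ (IsFractionRing.injective R K)).1 h)
  have hWdet : W.det ≠ 0 := by
    intro h0
    have : (W.map (algebraMap R K)).det = algebraMap R K W.det := (RingHom.map_det _ _).symm
    rw [← hWA, h0, map_zero, Matrix.det_smul] at this
    exact (mul_ne_zero (pow_ne_zero _ (pow_ne_zero _ hπ0)) hA) this
  obtain ⟨P, a, Y, hP, ha, hY, hWP⟩ := exists_smith W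
    (Matrix.linearIndependent_rows_of_det_ne_zero hWdet)
  choose m v hm using fun i =>
    IsDiscreteValuationRing.eq_unit_mul_pow_irreducible (ha i) hπ
  refine ⟨N, m, P * Matrix.diagonal (fun i => (v i : R)), Y, ?_, ?_, ?_⟩
  · rw [Matrix.det_mul, Matrix.det_diagonal]
    exact hP.mul (by simp [Fin.prod_univ_three])
  · have h1 : IsUnit (Y.map (IsLocalRing.residue R)).det :=
      (Matrix.isUnit_iff_isUnit_det _).1 (Matrix.linearIndependent_rows_iff_isUnit.1 hY)
    rw [← RingHom.mapMatrix_apply, ← RingHom.map_det] at h1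
    exact isUnit_of_map_unit _ _ h1
  · rw [hWA, hWP]
    congr 2
    rw [Matrix.mul_assoc P, Matrix.diagonal_mul_diagonal]
    congr 2
    funext i
    exact hm i

/-- Adapted bases for a pair of lattices: a cube equivalent to `S` is carried by diagonal matrices
to an integral cube of smaller level. -/
lemma IsNonMinimal.exists_pow_mul_eq {π : R} (hπ : Irreducible π) {S : Cube R}
    (h : S.IsNonMinimal K) : ∃ (N : ℕ) (m : Fin 3 → Fin 3 → ℕ) (U T : Cube R), S.Equivalent U ∧
      (∀ i j k, π ^ N * T i j k = π ^ (m 0 i + m 1 j + m 2 k) * U i j k) ∧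
      ∑ i, (m 0 i + m 1 i + m 2 i) < 3 * N := by
  obtain ⟨T, ⟨A, hA⟩, hlt⟩ := h
  choose N m P Q hP hQ hPQ using fun t =>
    exists_cartan hπ (A t : Matrix (Fin 3) (Fin 3) K) (isUnit_det_gl (A t)).ne_zero
  have hinj := IsFractionRing.injective R K
  have hPi : ∀ t, (P t)⁻¹ * P t = 1 := fun t => Matrix.nonsing_inv_mul _ (hP t)
  set D : Fin 3 → Matrix (Fin 3) (Fin 3) R := fun t => Matrix.diagonal fun i => π ^ m t i with hD
  -- over `R`, the identity `π^N • T = P D Q S`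
  have e1 : T.act (fun t => π ^ N t • 1) = S.act fun t => P t * D t * Q t := by
    have : (T.act fun t => π ^ N t • 1).map (algebraMap R K)
        = (S.act fun t => P t * D t * Q t).map (algebraMap R K) := by
      rw [map_act, map_act, hA, glAct, act_act]
      congr 1
      funext t
      have e : (π ^ N t • (1 : Matrix (Fin 3) (Fin 3) R)).map (algebraMap R K)
          = algebraMap R K π ^ N t • 1 := by
        ext i j
        by_cases hij : i = j <;> simp [hij]
      rw [hD, ← hPQ, e, Matrix.smul_mul, Matrix.one_mul]
    funext i j k
    exact hinj (congr_fun (congr_fun (congr_fun this i) j) k)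
  have e2 : (T.act fun t => (P t)⁻¹).act (fun t => π ^ N t • 1) = (S.act Q).act D := by
    have := congrArg (Cube.act fun t => (P t)⁻¹) e1
    rw [act_act, act_act] at this
    rw [act_act, act_act]
    simpa [Matrix.mul_assoc, ← Matrix.mul_assoc, hPi] using this
  have hST : (T.act fun t => (P t)⁻¹).disc
      = ((P 0)⁻¹.det * (P 1)⁻¹.det * (P 2)⁻¹.det) ^ 12 * T.disc :=
    disc_act_of_domain _ (Matrix.isUnit_nonsing_inv_det _ (hP 0)).ne_zero _
  have hSQ : (S.act Q).disc = ((Q 0).det * (Q 1).det * (Q 2).det) ^ 12 * S.disc :=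
    disc_act_of_domain _ (hQ 0).ne_zero _
  refine ⟨N 0 + N 1 + N 2, m, S.act Q, T.act fun t => (P t)⁻¹, Equivalent.of_act hQ, ?_, ?_⟩
  · intro i j k
    have := congr_fun (congr_fun (congr_fun e2 i) j) k
    rw [act_eq, act_eq (A := D)] at this
    simp only [act0, act1, act2, hD, Matrix.smul_apply, Matrix.one_apply, Matrix.diagonal_apply,
      smul_eq_mul, mul_ite, ite_mul, mul_one, mul_zero, zero_mul, Finset.sum_ite_eq,
      Finset.mem_univ, if_true] at this
    linear_combination this
  · by_contra hge
    rw [not_lt] at hge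
    have hp : ∀ n : ℕ, π ^ n ≠ 0 := fun n => pow_ne_zero _ hπ.ne_zero
    have e3 := congrArg Cube.disc e2
    rw [disc_act_of_domain (fun t => π ^ N t • 1) (by simp [hp]),
      disc_act_of_domain D (by simp [hD, Matrix.det_diagonal, Fin.prod_univ_three, hp]),
      hST, hSQ] at e3
    simp only [Matrix.det_smul, Matrix.det_one, hD, Matrix.det_diagonal, Fin.prod_univ_three,
      Fintype.card_fin, mul_one] at e3
    rw [Fin.sum_univ_three] at hge
    obtain ⟨d, hd⟩ := Nat.exists_eq_add_of_le hge
    obtain ⟨u, hu⟩ := ((Matrix.isUnit_nonsing_inv_det _ (hP 0)).mul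
      (Matrix.isUnit_nonsing_inv_det _ (hP 1))).mul (Matrix.isUnit_nonsing_inv_det _ (hP 2))
    have e4 : π ^ (36 * (N 0 + N 1 + N 2)) * ((u : R) ^ 12 * T.disc)
        = π ^ (36 * (N 0 + N 1 + N 2)) * (π ^ (12 * d) *
          (((Q 0).det * (Q 1).det * (Q 2).det) ^ 12 * S.disc)) := by
      rw [hu, ← mul_assoc (π ^ _) (π ^ (12 * d)), ← pow_add, show 36 * (N 0 + N 1 + N 2) + 12 * d =
        12 * (m 0 0 + m 1 0 + m 2 0 + (m 0 1 + m 1 1 + m 2 1) + (m 0 2 + m 1 2 + m 2 2)) by omega]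
      refine Eq.trans ?_ (e3.trans ?_) <;> ring
    have e5 := mul_left_cancel₀ (hp _) e4
    have hdvd : S.disc ∣ T.disc := by
      have : S.disc ∣ (u : R) ^ 12 * T.disc := by
        rw [e5]
        exact ((dvd_refl _).mul_left _).mul_left _
      rw [← Units.val_pow_eq_pow_val] at this
      exact Units.dvd_mul_left.1 this
    exact absurd (IsDiscreteValuationRing.addVal_le_iff_dvd.2 hdvd) (not_le.2 hlt)

lemma IsSaturated.exists_not_dvd {π : R} (hπ : Irreducible π) {S : Cube R} (h : S.IsSaturated) :
    (∀ i, ∃ j k, ¬ π ∣ S i j k) ∧ (∀ j, ∃ i k, ¬ π ∣ S i j k) ∧ ∀ k, ∃ i j, ¬ π ∣ S i j k := by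
  have hres : ∀ x : R, π ∣ x → IsLocalRing.residue R x = 0 := fun x hx => by
    rw [IsLocalRing.residue_eq_zero_iff, hπ.maximalIdeal_eq]
    exact Ideal.mem_span_singleton.2 hx
  refine ⟨fun i => ?_, fun j => ?_, fun k => ?_⟩ <;> by_contra! hc
  · have := (sliceIndependent_zero_iff S).1 (h 0) (Pi.single i 1) (fun j k => by
      simp [Pi.single_apply, hres _ (hc j k)])
    simpa using congr_fun this i
  · have := (sliceIndependent_one_iff S).1 (h 1) (Pi.single j 1) (fun i k => by
      simp [Pi.single_apply, hres _ (hc i k)])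
    simpa using congr_fun this j
  · have := (sliceIndependent_two_iff S).1 (h 2) (Pi.single k 1) (fun i j => by
      simp [Pi.single_apply, hres _ (hc i j)])
    simpa using congr_fun this k

/-- A non-minimal saturated cube admits weights that witness the non-minimality. -/
lemma IsNonMinimal.exists_hasWeight {π : R} (hπ : Irreducible π) {S : Cube R}
    (hsat : S.IsSaturated) (h : S.IsNonMinimal K) : ∃ (s : ℕ) (a b c : Fin 3 → ℕ),
      Antitone a ∧ Antitone b ∧ Antitone c ∧ a 2 = 0 ∧ b 2 = 0 ∧ c 2 = 0 ∧
      a 0 ≤ s ∧ b 0 ≤ s ∧ c 0 ≤ s ∧ 3 * s + 1 ≤ ∑ i, (a i + b i + c i) ∧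
      S.HasWeight π s a b c := by
  obtain ⟨N, m, U, T, hU, hm, hlt⟩ := h.exists_pow_mul_eq hπ
  obtain ⟨h0, h1, h2⟩ := (hsat.equivalent hU).exists_not_dvd hπ
  choose M σ hσ hM using fun t => show ∃ (M : ℕ) (σ : Equiv.Perm (Fin 3)),
      (∀ i j, i ≤ j → m t (σ i) ≤ m t (σ j)) ∧ M = m t (σ 2) from
    ⟨_, Tuple.sort (m t), fun i j hij => Tuple.monotone_sort (m t) hij, rfl⟩
  have hle : ∀ t i, m t i ≤ M t := fun t i => by
    have := hσ t ((σ t).symm i) 2 (Fin.le_last _)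
    rwa [Equiv.apply_symm_apply, ← hM] at this
  have hdvd : ∀ i j k, π ^ (N - (m 0 i + m 1 j + m 2 k)) ∣ U i j k := by
    intro i j k
    rcases le_total N (m 0 i + m 1 j + m 2 k) with hN | hN
    · rw [Nat.sub_eq_zero_of_le hN, pow_zero]
      exact one_dvd _
    · have e := hm i j k
      obtain ⟨d, hd⟩ := Nat.exists_eq_add_of_le hN
      rw [hd, pow_add, mul_assoc] at e
      rw [hd, Nat.add_sub_cancel_left]
      exact ⟨_, (mul_left_cancel₀ (pow_ne_zero _ hπ.ne_zero) e).symm⟩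
  have hN : ∀ i j k, ¬ π ∣ U i j k → N ≤ m 0 i + m 1 j + m 2 k := by
    intro i j k hn
    by_contra! hlt
    exact hn ((dvd_pow_self π (by omega)).trans (hdvd i j k))
  have hN0 : ∀ i, N ≤ m 0 i + M 1 + M 2 := fun i => by
    obtain ⟨j, k, hn⟩ := h0 i
    have := hN i j k hn; have := hle 1 j; have := hle 2 k; omega
  have hN1 : ∀ j, N ≤ M 0 + m 1 j + M 2 := fun j => by
    obtain ⟨i, k, hn⟩ := h1 j
    have := hN i j k hn; have := hle 0 i; have := hle 2 k; omega
  have hN2 : ∀ k, N ≤ M 0 + M 1 + m 2 k := fun k => by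
    obtain ⟨i, j, hn⟩ := h2 k
    have := hN i j k hn; have := hle 0 i; have := hle 1 j; omega
  have hanti : ∀ t, Antitone fun i => M t - m t (σ t i) := fun t i j hij =>
    Nat.sub_le_sub_left (hσ t i j hij) _
  refine ⟨M 0 + M 1 + M 2 - N, fun i => M 0 - m 0 (σ 0 i), fun i => M 1 - m 1 (σ 1 i),
    fun i => M 2 - m 2 (σ 2 i), hanti 0, hanti 1, hanti 2, by simp [hM], by simp [hM],
    by simp [hM], ?_, ?_, ?_, ?_, _, hU.trans (equivalent_perm U (σ 0) (σ 1) (σ 2)), ?_⟩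
  · change M 0 - m 0 (σ 0 0) ≤ _
    have := hN0 (σ 0 0); have := hle 0 (σ 0 0); have := hle 1 0; have := hle 2 0; omega
  · change M 1 - m 1 (σ 1 0) ≤ _
    have := hN1 (σ 1 0); have := hle 1 (σ 1 0); omega
  · change M 2 - m 2 (σ 2 0) ≤ _
    have := hN2 (σ 2 0); have := hle 2 (σ 2 0); omega
  · have hsum : ∀ t, ∑ i, m t (σ t i) = ∑ i, m t i := fun t => Equiv.sum_comp (σ t) (m t)
    have s0 := hsum 0; have s1 := hsum 1; have s2 := hsum 2
    simp only [Fin.sum_univ_three] at s0 s1 s2 hlt ⊢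
    have l := fun t i => hle t (σ t i)
    have := l 0 0; have := l 0 1; have := l 0 2; have := l 1 0; have := l 1 1; have := l 1 2
    have := l 2 0; have := l 2 1; have := l 2 2; have := hN0 (σ 0 0)
    omega
  · intro i j k
    refine (pow_dvd_pow _ ?_).trans (hdvd (σ 0 i) (σ 1 j) (σ 2 k))
    change M 0 - m 0 (σ 0 i) + (M 1 - m 1 (σ 1 j)) + (M 2 - m 2 (σ 2 k)) - _ ≤ _
    have := hle 0 (σ 0 i); have := hle 1 (σ 1 j); have := hle 2 (σ 2 k); have := hN0 (σ 0 i)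
    omega

end Nonminimal

end Cube

/-! ### The five types of weights -/

namespace Cube

section Types

variable {R : Type*} [CommRing R]

/-- Weights of type A: level shift `1`, weights `(1,1,0)`, `(1,1,0)`, `(0,0,0)`. -/
def IsTypeA (π : R) (S : Cube R) : Prop :=
  S.HasWeight π 1 ![1, 1, 0] ![1, 1, 0] ![0, 0, 0]

/-- Weights of type B: level shift `1`, weights `(1,0,0)`, `(1,0,0)`, `(1,1,0)`. -/
def IsTypeB (π : R) (S : Cube R) : Prop :=
  S.HasWeight π 1 ![1, 0, 0] ![1, 0, 0] ![1, 1, 0]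

/-- Weights of type C: level shift `2`, weights `(2,1,0)`, `(2,1,0)`, `(1,0,0)`. -/
def IsTypeC (π : R) (S : Cube R) : Prop :=
  S.HasWeight π 2 ![2, 1, 0] ![2, 1, 0] ![1, 0, 0]

/-- Weights of type D: level shift `2`, weights `(1,1,0)`, `(1,1,0)`, `(2,1,0)`. -/
def IsTypeD (π : R) (S : Cube R) : Prop :=
  S.HasWeight π 2 ![1, 1, 0] ![1, 1, 0] ![2, 1, 0]

/-- Weights of type E: level shift `3`, weights `(2,1,0)`, `(2,1,0)`, `(3,1,0)`. -/
def IsTypeE (π : R) (S : Cube R) : Prop :=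
  S.HasWeight π 3 ![2, 1, 0] ![2, 1, 0] ![3, 1, 0]

/-- A property that singles out the last slicing, imposed for one of the three slicings. -/
def UpToSlots (P : Cube R → Prop) (S : Cube R) : Prop := P S ∨ P S.sw12 ∨ P S.sw01.sw12

lemma IsTypeA.sw01 {π : R} {S : Cube R} (h : S.IsTypeA π) : S.sw01.IsTypeA π :=
  HasWeight.sw01 h

lemma IsTypeB.sw01 {π : R} {S : Cube R} (h : S.IsTypeB π) : S.sw01.IsTypeB π :=
  HasWeight.sw01 h

lemma IsTypeC.sw01 {π : R} {S : Cube R} (h : S.IsTypeC π) : S.sw01.IsTypeC π :=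
  HasWeight.sw01 h

lemma IsTypeD.sw01 {π : R} {S : Cube R} (h : S.IsTypeD π) : S.sw01.IsTypeD π :=
  HasWeight.sw01 h

lemma IsTypeE.sw01 {π : R} {S : Cube R} (h : S.IsTypeE π) : S.sw01.IsTypeE π :=
  HasWeight.sw01 h

variable {π : R} {s : ℕ} {a b c : Fin 3 → ℕ} {S : Cube R}

lemma HasWeight.isTypeA (h : S.HasWeight π s a b c) (_ : a 1 ≤ a 0) (_ : b 1 ≤ b 0)
    (_h1 : s + 1 ≤ a 1 + b 1 := by omega) :
    S.IsTypeA π := by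
  refine h.mono fun i j k => ?_
  fin_cases i <;> fin_cases j <;> fin_cases k <;> simp <;> omega

lemma HasWeight.isTypeB (h : S.HasWeight π s a b c) (_ : c 1 ≤ c 0)
    (_h1 : s + 1 ≤ a 0 + b 0 := by omega)
    (_h2 : s + 2 ≤ a 0 + b 0 + c 1 := by omega)
    (_h3 : s + 1 ≤ a 0 + c 1 := by omega)
    (_h4 : s + 1 ≤ b 0 + c 1 := by omega) :
    S.IsTypeB π := by
  refine h.mono fun i j k => ?_
  fin_cases i <;> fin_cases j <;> fin_cases k <;> simp <;> omega

lemma HasWeight.isTypeC (h : S.HasWeight π s a b c) (_ : a 1 ≤ a 0) (_ : b 1 ≤ b 0)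
    (_h1 : s + 3 ≤ a 0 + b 0 + c 0 := by omega)
    (_h2 : s + 2 ≤ a 0 + b 1 + c 0 := by omega)
    (_h3 : s + 1 ≤ a 0 + c 0 := by omega)
    (_h4 : s + 2 ≤ a 1 + b 0 + c 0 := by omega)
    (_h5 : s + 1 ≤ a 1 + b 1 + c 0 := by omega)
    (_h6 : s + 1 ≤ b 0 + c 0 := by omega)
    (_h7 : s + 2 ≤ a 0 + b 0 := by omega)
    (_h8 : s + 1 ≤ a 0 + b 1 := by omega)
    (_h9 : s + 1 ≤ a 1 + b 0 := by omega) :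
    S.IsTypeC π := by
  refine h.mono fun i j k => ?_
  fin_cases i <;> fin_cases j <;> fin_cases k <;> simp <;> omega

lemma HasWeight.isTypeD (h : S.HasWeight π s a b c) (_ : a 1 ≤ a 0) (_ : b 1 ≤ b 0)
    (_h1 : s + 2 ≤ a 1 + b 1 + c 0 := by omega)
    (_h2 : s + 1 ≤ a 1 + c 0 := by omega)
    (_h3 : s + 1 ≤ b 1 + c 0 := by omega)
    (_h4 : s + 1 ≤ a 1 + b 1 + c 1 := by omega) :
    S.IsTypeD π := by
  refine h.mono fun i j k => ?_
  fin_cases i <;> fin_cases j <;> fin_cases k <;> simp <;> omega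

lemma HasWeight.isTypeE (h : S.HasWeight π s a b c) (_ : a 1 ≤ a 0) (_ : b 1 ≤ b 0) (_ : c 1 ≤ c 0)
    (_h1 : s + 4 ≤ a 0 + b 0 + c 0 := by omega)
    (_h2 : s + 3 ≤ a 0 + b 1 + c 0 := by omega)
    (_h3 : s + 2 ≤ a 0 + c 0 := by omega)
    (_h4 : s + 3 ≤ a 1 + b 0 + c 0 := by omega)
    (_h5 : s + 2 ≤ a 1 + b 1 + c 0 := by omega)
    (_h6 : s + 1 ≤ a 1 + c 0 := by omega)
    (_h7 : s + 2 ≤ b 0 + c 0 := by omega)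
    (_h8 : s + 1 ≤ b 1 + c 0 := by omega)
    (_h9 : s + 2 ≤ a 0 + b 0 + c 1 := by omega)
    (_h10 : s + 1 ≤ a 0 + b 1 + c 1 := by omega)
    (_h11 : s + 1 ≤ a 1 + b 0 + c 1 := by omega)
    (_h12 : s + 1 ≤ a 0 + b 0 := by omega) :
    S.IsTypeE π := by
  refine h.mono fun i j k => ?_
  fin_cases i <;> fin_cases j <;> fin_cases k <;> simp <;> omega

/-- Witnessing weights of non-minimality can be replaced by one of five explicit types. The case
distinction asks which partial sums of the weights exceed `s`; in each case these inequalities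
imply those that characterise one of the types. -/
lemma HasWeight.exists_type (h : S.HasWeight π s a b c) (ha : a 1 ≤ a 0) (hb : b 1 ≤ b 0)
    (hc : c 1 ≤ c 0) (ha0 : a 0 ≤ s) (hb0 : b 0 ≤ s) (hc0 : c 0 ≤ s)
    (hs : 3 * s + 1 ≤ a 0 + b 0 + c 0 + a 1 + b 1 + c 1) :
    UpToSlots (IsTypeA π) S ∨ UpToSlots (IsTypeB π) S ∨ UpToSlots (IsTypeC π) S ∨
      UpToSlots (IsTypeD π) S ∨ UpToSlots (IsTypeE π) S := by
  have h' : S.sw12.HasWeight π s a c b := h.sw12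
  have h'' : S.sw01.sw12.HasWeight π s b c a := h.sw01.sw12
  by_cases hd1 : s + 1 ≤ a 1 + b 1
  · exact .inl (.inl (h.isTypeA ha hb))
  · by_cases hd2 : s + 1 ≤ a 0 + c 1
    · by_cases hd3 : s + 1 ≤ a 1 + c 1
      · exact .inl (.inr (.inl (h'.isTypeA ha hc)))
      · by_cases hd4 : s + 1 ≤ b 0 + c 1
        · by_cases hd5 : s + 1 ≤ a 0 + b 0
          · exact .inr (.inl (.inl (h.isTypeB hc)))
          · by_cases hd6 : s + 1 ≤ c 0 + a 1
            · exact .inr (.inr (.inr (.inl (.inl (h.isTypeD ha hb)))))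
            · exact .inl (.inr (.inr (h''.isTypeA hb hc)))
        · by_cases hd5 : s + 1 ≤ c 0 + b 1
          · by_cases hd6 : s + 1 ≤ a 0 + b 1
            · exact .inr (.inl (.inr (.inl (h'.isTypeB hb))))
            · by_cases hd7 : s + 1 ≤ a 0 + b 0
              · exact .inr (.inr (.inl (.inr (.inl (h'.isTypeC ha hc)))))
              · exact .inr (.inr (.inr (.inl (.inl (h.isTypeD ha hb)))))
          · by_cases hd6 : s + 1 ≤ a 1 + b 1 + c 1
            · by_cases hd7 : s + 1 ≤ a 0 + b 1
              · exact .inr (.inr (.inr (.inl (.inr (.inr (h''.isTypeD hb hc))))))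
              · exact .inr (.inr (.inl (.inr (.inl (h'.isTypeC ha hc)))))
            · by_cases hd7 : s + 1 ≤ a 0 + b 1
              · exact .inr (.inr (.inr (.inr (.inr (.inr (h''.isTypeE hb hc ha))))))
              · exact .inr (.inr (.inl (.inr (.inl (h'.isTypeC ha hc)))))
    · by_cases hd3 : s + 1 ≤ a 0 + b 1
      · by_cases hd4 : s + 1 ≤ b 0 + a 1
        · by_cases hd5 : s + 1 ≤ a 0 + c 0
          · exact .inr (.inr (.inl (.inl (h.isTypeC ha hb))))
          · exact .inr (.inr (.inr (.inl (.inr (.inl (h'.isTypeD ha hc))))))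
        · by_cases hd5 : s + 1 ≤ a 0 + c 0
          · exact .inr (.inl (.inr (.inl (h'.isTypeB hb))))
          · exact .inl (.inr (.inr (h''.isTypeA hb hc)))
      · by_cases hd4 : s + 1 ≤ b 1 + c 1
        · exact .inl (.inr (.inr (h''.isTypeA hb hc)))
        · by_cases hd5 : s + 1 ≤ b 0 + a 1
          · by_cases hd6 : s + 1 ≤ c 0 + a 1
            · exact .inr (.inl (.inr (.inr (h''.isTypeB ha))))
            · by_cases hd7 : s + 1 ≤ a 0 + c 0
              · exact .inr (.inr (.inr (.inr (.inr (.inl (h'.isTypeE ha hc hb))))))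
              · exact .inr (.inr (.inr (.inl (.inr (.inl (h'.isTypeD ha hc))))))
          · by_cases hd6 : s + 1 ≤ a 0 + b 0
            · by_cases hd7 : s + 1 ≤ b 0 + c 1
              · exact .inr (.inr (.inl (.inr (.inr (h''.isTypeC hb hc)))))
              · exact .inr (.inr (.inr (.inr (.inl (h.isTypeE ha hb hc)))))
            · exact .inr (.inr (.inr (.inl (.inl (h.isTypeD ha hb)))))

end Types

lemma IsNonMinimal.exists_type {R K : Type*} [CommRing R] [IsDomain R] [IsDiscreteValuationRing R]
    [Field K] [Algebra R K] [IsFractionRing R K] {π : R} (hπ : Irreducible π) {S : Cube R}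
    (hsat : S.IsSaturated) (h : S.IsNonMinimal K) :
    UpToSlots (IsTypeA π) S ∨ UpToSlots (IsTypeB π) S ∨ UpToSlots (IsTypeC π) S ∨
      UpToSlots (IsTypeD π) S ∨ UpToSlots (IsTypeE π) S := by
  obtain ⟨s, a, b, c, ha, hb, hc, ha2, hb2, hc2, ha0, hb0, hc0, hs, hw⟩ := h.exists_hasWeight hπ hsat
  simp only [Fin.sum_univ_three, ha2, hb2, hc2] at hs
  exact hw.exists_type (ha (by decide)) (hb (by decide)) (hc (by decide)) ha0 hb0 hc0 (by omega)

end Cube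

/-! ### Singular points and double lines under linear substitutions -/

section Substitution

variable {R : Type*} [CommRing R]

lemma pderiv_linSubst (g : Matrix (Fin 3) (Fin 3) R) (f : MvPolynomial (Fin 3) R) (t : Fin 3) :
    pderiv t (linSubst g f) = ∑ b, C (g t b) * linSubst g (pderiv b f) := by
  induction f using MvPolynomial.induction_on with
  | C a => simp [linSubst]
  | add p q hp hq => simp only [map_add, hp, hq, mul_add, Finset.sum_add_distrib]
  | mul_X p i hp =>
    have hX : pderiv t (linSubst g (X i)) = C (g t i) := by
      simp [linSubst, pderiv_X, Pi.single_apply]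
    simp only [map_mul, Derivation.leibniz, hp, hX, smul_eq_mul, map_add, mul_add,
      Finset.sum_add_distrib, Finset.mul_sum, pderiv_X, Pi.single_apply]
    congr 1
    · rw [Finset.sum_eq_single i (fun b _ hb => by simp [hb.symm]) (by simp)]
      simp only [if_true, map_one, mul_one]
      ring
    · exact Finset.sum_congr rfl fun b _ => by ring

variable {A : Type*} [CommRing A] [Algebra R A]

lemma aeval_linSubst (g : Matrix (Fin 3) (Fin 3) R) (f : MvPolynomial (Fin 3) R) (p : Fin 3 → A) :
    aeval p (linSubst g f) = aeval (Matrix.vecMul p (g.map (algebraMap R A))) f := by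
  rw [linSubst, ← AlgHom.comp_apply]
  congr 1
  ext b
  simp [Matrix.vecMul, dotProduct, mul_comm]

end Substitution

section Field

variable {k : Type*} [Field k] {L : Type*} [Field L] [Algebra k L]

/-- The points of the transformed curve are those of the original one, moved by the inverse
matrix. -/
lemma isSingularPoint_linSubst_iff {g : Matrix (Fin 3) (Fin 3) k} (hg : IsUnit g.det)
    (f : MvPolynomial (Fin 3) k) (p : Fin 3 → L) :
    IsSingularPoint (linSubst g f) p ↔
      IsSingularPoint f (Matrix.vecMul p (g.map (algebraMap k L))) := by
  have hu : IsUnit (g.map (algebraMap k L)) := by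
    rw [Matrix.isUnit_iff_isUnit_det, ← RingHom.mapMatrix_apply, ← RingHom.map_det]
    exact hg.map _
  have h0 : Matrix.vecMul p (g.map (algebraMap k L)) = 0 ↔ p = 0 := by
    refine ⟨fun h => ?_, fun h => by rw [h, Matrix.zero_vecMul]⟩
    exact Matrix.vecMul_injective_of_isUnit hu (h.trans (Matrix.zero_vecMul _).symm)
  have hd : (∀ t, aeval p (pderiv t (linSubst g f)) = 0) ↔
      ∀ t, aeval (Matrix.vecMul p (g.map (algebraMap k L))) (pderiv t f) = 0 := by
    set w : Fin 3 → L := fun b => aeval (Matrix.vecMul p (g.map (algebraMap k L))) (pderiv b f)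
    have e : ∀ t, aeval p (pderiv t (linSubst g f)) = (g.map (algebraMap k L)).mulVec w t := by
      intro t
      simp [pderiv_linSubst, aeval_linSubst, Matrix.mulVec, dotProduct, w]
    simp only [e]
    refine ⟨fun h => ?_, fun h t => ?_⟩
    · have : w = 0 := Matrix.mulVec_injective_of_isUnit hu (by
        rw [Matrix.mulVec_zero]; exact funext h)
      exact congr_fun this
    · rw [show w = 0 from funext h, Matrix.mulVec_zero]
      rfl
  rw [IsSingularPoint, IsSingularPoint, aeval_linSubst, hd, ne_eq, ne_eq, h0]

lemma isSingularPoint_C_mul_iff {u : k} (hu : u ≠ 0) (f : MvPolynomial (Fin 3) k) (p : Fin 3 → L) :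
    IsSingularPoint (C u * f) p ↔ IsSingularPoint f p := by
  have hu' : algebraMap k L u ≠ 0 := by simpa using hu
  simp [IsSingularPoint, Derivation.leibniz, hu']

lemma isSingularPoint_algebraMap_iff (f : MvPolynomial (Fin 3) k) (p : Fin 3 → k) :
    IsSingularPoint f (fun t => algebraMap k L (p t)) ↔ IsSingularPoint f p := by
  have h0 : (fun t => algebraMap k L (p t)) = 0 ↔ p = 0 := by
    simp [funext_iff]
  have e : ∀ F : MvPolynomial (Fin 3) k, aeval (fun t => algebraMap k L (p t)) F
      = algebraMap k L (aeval p F) := fun F => aeval_algebraMap_apply _ _ _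
  simp only [IsSingularPoint, ne_eq, h0, e, map_eq_zero]

/-- Two non-proportional squares of linear forms cannot both divide a non-zero cubic. -/
lemma eq_zero_of_sq_dvd {c : Fin 10 → k} (hc : ternaryCubic c ≠ 0) (hz : X 2 ^ 2 ∣ ternaryCubic c)
    {l : Fin 3 → k} (hl : (∑ t, C (l t) * X t) ^ 2 ∣ ternaryCubic c) : l 0 = 0 ∧ l 1 = 0 := by
  obtain ⟨h0, h1, h3, h4, h5, h6, h9⟩ := (X_two_sq_dvd_iff c).1 hz
  obtain ⟨m, rfl⟩ := exists_eq_sqMulCoeffs hl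
  simp only [sqMulCoeffs, Matrix.cons_val] at h0 h1 h3 h4 h5 h6 h9
  have key : m ≠ 0 := by
    rintro rfl
    apply hc
    rw [ternaryCubic_eq_zero_iff]
    funext t
    fin_cases t <;> simp [sqMulCoeffs]
  constructor <;> by_contra hne <;> apply key <;> funext t
  · have m0 : m 0 = 0 := by simpa [hne] using h0
    have m1 : m 1 = 0 := by simpa [hne, m0] using h3
    have m2 : m 2 = 0 := by simpa [hne, m0] using h4
    fin_cases t <;> assumption
  · have m1 : m 1 = 0 := by simpa [hne] using h1
    have m0 : m 0 = 0 := by simpa [hne, m1] using h5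
    have m2 : m 2 = 0 := by simpa [hne, m1] using h6
    fin_cases t <;> assumption

/-- If a unique singular point is moved to a singular point of the original curve, both being
`(1 : 0 : 0)`, then the matrix fixes that point. -/
lemma IsUniqueSingularPoint.eq_zero_of_linSubst {g : Matrix (Fin 3) (Fin 3) k} (hg : IsUnit g.det)
    {f : MvPolynomial (Fin 3) k} (h : IsUniqueSingularPoint (linSubst g f) ![1, 0, 0])
    (hf : IsSingularPoint f (![1, 0, 0] : Fin 3 → k)) : g 0 1 = 0 ∧ g 0 2 = 0 := by
  set q : Fin 3 → k := Matrix.vecMul ![1, 0, 0] g⁻¹ with hq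
  have hqg : Matrix.vecMul q g = ![1, 0, 0] := by
    rw [hq, Matrix.vecMul_vecMul, Matrix.nonsing_inv_mul _ hg, Matrix.vecMul_one]
  have h1 : IsSingularPoint (linSubst g f) q := by
    rw [isSingularPoint_linSubst_iff hg]
    have : g.map (algebraMap k k) = g := by ext; rfl
    rwa [this, hqg]
  obtain ⟨c, hc⟩ := h.2 _ ((isSingularPoint_algebraMap_iff (L := SeparableClosure k) _ _).2 h1)
  have e : ∀ t, algebraMap k (SeparableClosure k) (q t)
      = c * algebraMap k (SeparableClosure k) ((![1, 0, 0] : Fin 3 → k) t) := congr_fun hc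
  have q1 : q 1 = 0 := by simpa using e 1
  have q2 : q 2 = 0 := by simpa using e 2
  have hv : ∀ t, (q 0) * g 0 t = (![1, 0, 0] : Fin 3 → k) t := fun t => by
    rw [← hqg]
    simp [Matrix.vecMul, dotProduct, Fin.sum_univ_three, q1, q2]
  have q0 : q 0 ≠ 0 := fun h0 => by simpa [h0] using hv 0
  exact ⟨by simpa [q0] using hv 1, by simpa [q0] using hv 2⟩

end Field

namespace Cube

variable {R : Type*} [CommRing R] [IsLocalRing R]

/-- The matrices acting on the reductions of the cubics. -/
lemma exists_redCubic_glAct (g : Fin 3 → Matrix.GeneralLinearGroup (Fin 3) R) (S : Cube R)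
    (i : Fin 3) : ∃ u, u ≠ 0 ∧ (S.glAct g).redCubic i = C u *
      linSubst ((g i : Matrix (Fin 3) (Fin 3) R).map (IsLocalRing.residue R)) (S.redCubic i) := by
  obtain ⟨u, hu, h⟩ := exists_cubic_glAct g S i
  exact ⟨IsLocalRing.residue R u, (hu.map _).ne_zero, by
    rw [redCubic, h, map_mul, map_C, map_linSubst, redCubic]⟩

lemma redCubic_eq (S : Cube R) (i : Fin 3) :
    S.redCubic i = (S.map (IsLocalRing.residue R)).cubic i := map_cubic _ _ _

lemma residue_align_of_sq_dvd {g : Fin 3 → Matrix.GeneralLinearGroup (Fin 3) R} {V : Cube R}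
    {i : Fin 3} (hV : X 2 ^ 2 ∣ V.redCubic i) (h0 : (V.glAct g).redCubic i ≠ 0)
    (hz : X 2 ^ 2 ∣ (V.glAct g).redCubic i) :
    IsLocalRing.residue R ((g i : Matrix (Fin 3) (Fin 3) R) 0 2) = 0 ∧
      IsLocalRing.residue R ((g i : Matrix (Fin 3) (Fin 3) R) 1 2) = 0 := by
  obtain ⟨u, hu, h⟩ := exists_redCubic_glAct g V i
  obtain ⟨c, hc⟩ := exists_cubic_eq_ternaryCubic ((V.glAct g).map (IsLocalRing.residue R)) i
  rw [← redCubic_eq] at hc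
  have hl := linSubst_linear ((g i : Matrix (Fin 3) (Fin 3) R).map (IsLocalRing.residue R))
    ![0, 0, 1]
  have hdvd : (∑ t, C (((g i : Matrix (Fin 3) (Fin 3) R).map (IsLocalRing.residue R)).mulVec
      ![0, 0, 1] t) * X t) ^ 2 ∣ ternaryCubic c := by
    rw [← hl, ← map_pow, ← X_two_sq_eq, ← hc, h]
    exact (map_dvd _ hV).mul_left _
  rw [hc] at h0 hz
  simpa [Matrix.mulVec, dotProduct, Fin.sum_univ_three] using eq_zero_of_sq_dvd h0 hz hdvd

lemma residue_align_of_isUniqueSingularPoint {g : Fin 3 → Matrix.GeneralLinearGroup (Fin 3) R}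
    {V : Cube R} {i : Fin 3}
    (hV : IsSingularPoint (V.redCubic i) (![1, 0, 0] : Fin 3 → IsLocalRing.ResidueField R))
    (h : IsUniqueSingularPoint ((V.glAct g).redCubic i) ![1, 0, 0]) :
    IsLocalRing.residue R ((g i : Matrix (Fin 3) (Fin 3) R) 0 1) = 0 ∧
      IsLocalRing.residue R ((g i : Matrix (Fin 3) (Fin 3) R) 0 2) = 0 := by
  obtain ⟨u, hu, e⟩ := exists_redCubic_glAct g V i
  rw [e] at h
  refine IsUniqueSingularPoint.eq_zero_of_linSubst (isUnit_det_map_residue (isUnit_det_gl (g i))) (f := V.redCubic i)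
    ⟨?_, fun q hq => h.2 q ?_⟩ hV
  · exact (isSingularPoint_C_mul_iff hu _ _).1 h.1
  · exact (isSingularPoint_C_mul_iff hu _ _).2 hq

end Cube

/-! ### Procedures in an adapted basis -/

namespace Cube

variable {R K : Type*} [CommRing R] [IsDomain R] [IsDiscreteValuationRing R]
  [Field K] [Algebra R K] [IsFractionRing R K]

lemma dvd_iff_residue_eq_zero {π : R} (hπ : Irreducible π) (x : R) :
    π ∣ x ↔ IsLocalRing.residue R x = 0 := by
  rw [IsLocalRing.residue_eq_zero_iff, hπ.maximalIdeal_eq, Ideal.mem_span_singleton]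

lemma act_one_one {A : Type*} [CommRing A] (M : Matrix (Fin 3) (Fin 3) A) (S : Cube A) :
    S.act ![1, 1, M] = act2 M S := by
  rw [act_eq]
  change act0 1 (act1 1 (act2 M S)) = _
  rw [act0_one, act1_one]

/-- If `T` has independent slices modulo `π`, then an integral cube whose slices are combinations
over `K` of those of `T` is already an integral combination of them. -/
lemma exists_map_eq_of_sliceIndependent {π : R} (hπ : Irreducible π) {T W : Cube R}
    (hT : T.SliceIndependent 2) {B : Matrix (Fin 3) (Fin 3) K}
    (h : ∀ i j k, algebraMap R K (W i j k) = ∑ k', B k k' * algebraMap R K (T i j k')) :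
    ∃ M : Matrix (Fin 3) (Fin 3) R, M.map (algebraMap R K) = B := by
  have hinj := IsFractionRing.injective R K
  have key : ∀ (N : ℕ) (c : Fin 3 → R), (∀ i j, π ^ N ∣ ∑ k, c k * T i j k) → ∀ k, π ^ N ∣ c k := by
    intro N
    induction N with
    | zero => simp
    | succ N ih =>
      intro c hc
      have hN := ih c fun i j => (pow_dvd_pow _ (Nat.le_succ N)).trans (hc i j)
      choose c' hc' using hN
      have h1 : ∀ i j, π ∣ ∑ k, c' k * T i j k := fun i j => by
        have := hc i j
        simp only [hc', mul_assoc, ← Finset.mul_sum, pow_succ] at this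
        exact (mul_dvd_mul_iff_left (pow_ne_zero _ hπ.ne_zero)).1 this
      intro k
      have h2 := (sliceIndependent_two_iff T).1 hT (fun k => IsLocalRing.residue R (c' k))
        (fun i j => by
          have := (dvd_iff_residue_eq_zero hπ _).1 (h1 i j)
          simpa using this)
      rw [hc' k, pow_succ]
      exact mul_dvd_mul_left _ ((dvd_iff_residue_eq_zero hπ _).2 (congr_fun h2 k))
  obtain ⟨⟨b, hb⟩, hW⟩ := IsLocalization.exist_integer_multiples_of_finite (nonZeroDivisors R)
    (fun p : Fin 3 × Fin 3 => B p.1 p.2)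
  obtain ⟨N, u, hbu⟩ := IsDiscreteValuationRing.eq_unit_mul_pow_irreducible
    (nonZeroDivisors.ne_zero hb) hπ
  choose B' hB' using hW
  simp only [Algebra.smul_def] at hB'
  have hdvd : ∀ k k', π ^ N ∣ B' (k, k') := by
    intro k
    refine key N (fun k' => B' (k, k')) fun i j => ⟨u * W i j k, hinj ?_⟩
    rw [map_sum]
    simp only [map_mul, hB', mul_assoc, ← Finset.mul_sum, ← h]
    rw [hbu, map_mul, map_pow]
    ring
  choose M hM using hdvd
  have hb0 : algebraMap R K b ≠ 0 := fun h0 =>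
    nonZeroDivisors.ne_zero hb ((map_eq_zero_iff _ hinj).1 h0)
  have hπ0 : algebraMap R K π ^ N ≠ 0 := pow_ne_zero _ fun h =>
    hπ.ne_zero ((map_eq_zero_iff _ hinj).1 h)
  refine ⟨Matrix.of fun k k' => ((u⁻¹ : Rˣ) : R) * M k k', ?_⟩
  ext k k'
  have e := hB' (k, k')
  rw [hM, hbu, map_mul, map_mul, map_pow, mul_comm, mul_right_comm] at e
  have e2 := mul_right_cancel₀ hπ0 e
  rw [Matrix.map_apply, Matrix.of_apply, map_mul]
  rw [mul_comm] at e
  have e3 : algebraMap R K (M k k') = algebraMap R K u * B k k' := by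
    apply mul_right_cancel₀ hπ0
    linear_combination e
  rw [e3, ← mul_assoc, ← map_mul, Units.inv_mul, map_one, one_mul]

/-- Conjugating by a diagonal matrix of powers of `π` preserves `GL₃` of the valuation ring, when
the relevant entries are divisible by `π`. -/
lemma exists_diagonal_mul_eq {π : R} (hπ : Irreducible π) {d : Fin 3 → ℕ} (hd : ∀ i, d i ≤ 1)
    {h : Matrix (Fin 3) (Fin 3) R} (hu : IsUnit h.det)
    (hh : ∀ i j, d i < d j → π ∣ h i j) : ∃ h' : Matrix (Fin 3) (Fin 3) R, IsUnit h'.det ∧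
      Matrix.diagonal (fun i => π ^ d i) * h = h' * Matrix.diagonal (fun i => π ^ d i) := by
  have : ∀ i j, ∃ x, π ^ d i * h i j = x * π ^ d j := by
    intro i j
    rcases lt_or_ge (d i) (d j) with hlt | hge
    · obtain ⟨y, hy⟩ := hh i j hlt
      have := hd j
      refine ⟨y, ?_⟩
      rw [show d i = 0 by omega, show d j = 1 by omega, hy]
      ring
    · obtain ⟨e, he⟩ := Nat.exists_eq_add_of_le hge
      exact ⟨π ^ e * h i j, by rw [he, pow_add]; ring⟩
  choose h' hh' using this
  have e : Matrix.diagonal (fun i => π ^ d i) * h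
      = Matrix.of h' * Matrix.diagonal (fun i => π ^ d i) := by
    ext i j
    rw [Matrix.diagonal_mul, Matrix.mul_diagonal, Matrix.of_apply, hh']
  refine ⟨Matrix.of h', ?_, e⟩
  have e2 := congrArg Matrix.det e
  rw [Matrix.det_mul, Matrix.det_mul, mul_comm] at e2
  have hne : (Matrix.diagonal fun i => π ^ d i).det ≠ 0 := by
    rw [Matrix.det_diagonal]
    exact Finset.prod_ne_zero_iff.2 fun i _ => pow_ne_zero _ hπ.ne_zero
  rwa [← mul_right_cancel₀ hne e2]

/-- The result of a procedure applied to the first two slicings can be computed in any adapted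
basis `V`, provided that passing from `V` to the cube `U = g V` used in the procedure is compatible
with the diagonal matrices. The cube `T''` is the transform of `V`, with the last slicing divided
by the powers `π ^ γ k`. -/
lemma Transform.exists_levelRatio {π : R} (hπ : Irreducible π) {d γ : Fin 3 → ℕ}
    (hd : ∀ i, d i ≤ 1) (hγ : 2 * ∑ i, d i ≤ ∑ i, γ i)
    {g : Fin 3 → Matrix.GeneralLinearGroup (Fin 3) R} {V T T'' : Cube R}
    (hg0 : ∀ i j, d i < d j → π ∣ (g 0 : Matrix (Fin 3) (Fin 3) R) i j)
    (hg1 : ∀ i j, d i < d j → π ∣ (g 1 : Matrix (Fin 3) (Fin 3) R) i j)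
    (hT : Transform K (Matrix.diagonal fun i => algebraMap R K π ^ d i) 0 1 (V.glAct g) T)
    (hV : ∀ i j k, T'' i j k * π ^ γ k = V i j k * π ^ (d i + d j)) :
    ∃ r, LevelRatio K V T r ∧ (IsUnit r → ∑ i, γ i = 2 * ∑ i, d i ∧ T''.Equivalent T) := by
  obtain ⟨A, hA0, hA1, hA, hind⟩ := hT
  have hinj := IsFractionRing.injective R K
  obtain ⟨h0, hu0, e0⟩ := exists_diagonal_mul_eq hπ hd (isUnit_det_gl (g 0)) hg0
  obtain ⟨h1, hu1, e1⟩ := exists_diagonal_mul_eq hπ hd (isUnit_det_gl (g 1)) hg1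
  set D : Matrix (Fin 3) (Fin 3) R := Matrix.diagonal (fun i => π ^ d i) with hD
  set G : Matrix (Fin 3) (Fin 3) R := Matrix.diagonal (fun i => π ^ γ i) with hG
  have hDK : (Matrix.diagonal fun i => algebraMap R K π ^ d i) = D.map (algebraMap R K) := by
    rw [hD, Matrix.diagonal_map (map_zero _)]
    simp
  have hGdet : G.det = π ^ ∑ i, γ i := by
    rw [hG, Matrix.det_diagonal, Finset.prod_pow_eq_pow_sum]
  have hDdet : D.det = π ^ ∑ i, d i := by
    rw [hD, Matrix.det_diagonal, Finset.prod_pow_eq_pow_sum]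
  have hp : ∀ n, algebraMap R K π ^ n ≠ 0 := fun n => pow_ne_zero _ fun h =>
    hπ.ne_zero ((map_eq_zero_iff _ hinj).1 h)
  set A2 : Matrix (Fin 3) (Fin 3) K := (A 2 : Matrix (Fin 3) (Fin 3) K) with hA2
  set H : Matrix (Fin 3) (Fin 3) R := (g 2 : Matrix (Fin 3) (Fin 3) R) with hH
  -- the transformation of the last slicing, relative to the cube `W`, equivalent to `T''`
  set B : Matrix (Fin 3) (Fin 3) K := A2 * (H * G).map (algebraMap R K) with hB
  set W : Cube R := T''.act ![h0, h1, 1] with hW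
  have hdetmap : ∀ M : Matrix (Fin 3) (Fin 3) R, (M.map (algebraMap R K)).det
      = algebraMap R K M.det := fun M => (RingHom.map_det _ _).symm
  have hA2u : IsUnit A2.det := isUnit_det_gl (A 2)
  have hHu : IsUnit H.det := isUnit_det_gl (g 2)
  have hBdet : B.det = A2.det * algebraMap R K H.det * algebraMap R K π ^ ∑ i, γ i := by
    rw [hB, Matrix.det_mul, hdetmap, Matrix.det_mul, hGdet, map_mul, map_pow, mul_assoc]
  have hBu : IsUnit B.det := by
    rw [hBdet]
    exact (hA2u.mul (hHu.map _)).mul (hp _).isUnit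
  have hVT : V.act ![D, D, 1] = T''.act ![1, 1, G] := by
    funext i j k
    rw [act_one_one, act_eq]
    change act0 D (act1 D (act2 1 V)) i j k = _
    simp only [act0, act1, act2, hD, hG, Matrix.one_apply, Matrix.diagonal_apply,
      mul_ite, ite_mul, mul_one, mul_zero, zero_mul, one_mul, Finset.sum_ite_eq,
      Finset.mem_univ, if_true]
    linear_combination -hV i j k
  have hTW : T.map (algebraMap R K) = (W.map (algebraMap R K)).act ![1, 1, B] := by
    have hcomp : ((V.glAct g).act ![D, D, 1]) = (T''.act ![h0, h1, H * G]) := by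
      rw [glAct, act_act]
      have : (fun t => (![D, D, 1] : Fin 3 → Matrix (Fin 3) (Fin 3) R) t
          * (g t : Matrix (Fin 3) (Fin 3) R))
          = fun t => (![h0, h1, H] : Fin 3 → Matrix (Fin 3) (Fin 3) R) t
            * (![D, D, 1] : Fin 3 → Matrix (Fin 3) (Fin 3) R) t := by
        funext t
        fin_cases t
        · exact e0
        · exact e1
        · exact (Matrix.one_mul _).trans (Matrix.mul_one _).symm
      rw [this, ← act_act, hVT, act_act]
      congr 1
      funext t
      fin_cases t
      exacts [Matrix.mul_one _, Matrix.mul_one _, rfl]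
    have e : (fun t => (A t : Matrix (Fin 3) (Fin 3) K))
        = fun t => (![1, 1, A2] : Fin 3 → Matrix (Fin 3) (Fin 3) K) t
          * ((![D, D, 1] : Fin 3 → Matrix (Fin 3) (Fin 3) R) t).map (algebraMap R K) := by
      funext t
      fin_cases t
      · exact (hA0.trans hDK).trans (Matrix.one_mul _).symm
      · exact (hA1.trans hDK).trans (Matrix.one_mul _).symm
      · change _ = A2 * (1 : Matrix (Fin 3) (Fin 3) R).map (algebraMap R K)
        rw [Matrix.map_one _ (map_zero _) (map_one _), Matrix.mul_one]
        rfl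
    rw [hA, glAct, e, ← act_act, ← map_act, hcomp, hW, map_act, map_act, act_act, act_act]
    congr 1
    funext t
    fin_cases t
    · rfl
    · rfl
    · change _ = B * (1 : Matrix (Fin 3) (Fin 3) R).map (algebraMap R K)
      rw [Matrix.map_one _ (map_zero _) (map_one _), Matrix.mul_one]
      rfl
  have hBi : B⁻¹ * B = 1 := Matrix.nonsing_inv_mul _ hBu
  have hWT : W.map (algebraMap R K) = (T.map (algebraMap R K)).act ![1, 1, B⁻¹] := by
    rw [hTW, act_act]
    have : (fun t => (![1, 1, B⁻¹] : Fin 3 → Matrix (Fin 3) (Fin 3) K) t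
        * (![1, 1, B] : Fin 3 → Matrix (Fin 3) (Fin 3) K) t) = fun _ => 1 := by
      funext t
      fin_cases t
      exacts [Matrix.one_mul _, Matrix.one_mul _, hBi]
    rw [this, act_one]
  obtain ⟨M, hM⟩ := exists_map_eq_of_sliceIndependent hπ (hind 2 (by decide) (by decide)) (W := W)
    (B := B⁻¹) (fun i j k => by
      have := congr_fun (congr_fun (congr_fun hWT i) j) k
      rwa [act_one_one] at this)
  have hMdet : algebraMap R K M.det * B.det = 1 := by
    rw [← hdetmap, hM, ← Matrix.det_mul, hBi, Matrix.det_one]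
  obtain ⟨δ, hδ⟩ := Nat.exists_eq_add_of_le hγ
  obtain ⟨w, hwu, hw⟩ := Equivalent.exists_levelRatio (K := K) (S := V) (T := V.glAct g) ⟨g, rfl⟩
  refine ⟨w * (H.det * π ^ δ * M.det), hw.trans ⟨A, hA, ?_⟩, fun hr => ?_⟩
  · have hDd : (Matrix.diagonal fun i => algebraMap R K π ^ d i).det
        = algebraMap R K π ^ ∑ i, d i := by
      rw [Matrix.det_diagonal, Finset.prod_pow_eq_pow_sum]
    rw [hBdet, hδ] at hMdet
    rw [hA0, hA1, hDd, ← hA2, ← hMdet]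
    simp only [map_mul, map_pow]
    ring
  · have h2 : IsUnit (H.det * π ^ δ * M.det) := isUnit_of_mul_isUnit_right hr
    have hMu : IsUnit M.det := isUnit_of_mul_isUnit_right h2
    have h3 : IsUnit (π ^ δ) := isUnit_of_mul_isUnit_right (isUnit_of_mul_isUnit_left h2)
    have hδ0 : δ = 0 := by
      by_contra hne
      exact hπ.not_isUnit ((isUnit_pow_iff hne).1 h3)
    refine ⟨by omega, ?_⟩
    have hTM : W = T.act2 M := by
      funext i j k
      apply hinj
      have := congr_fun (congr_fun (congr_fun hWT i) j) k
      rw [act_one_one, ← hM] at this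
      rw [act2, map_sum]
      simp only [map_mul]
      exact this
    have hW1 : T''.Equivalent W := Equivalent.of_act (fun t => by
      fin_cases t
      exacts [hu0, hu1, by simp])
    refine hW1.trans ?_
    rw [hTM]
    exact (Equivalent.of_act2 T hMu).symm

end Cube

/-! ### Weights and the reduction of an adapted cube -/

namespace Cube

section Frames

variable {R : Type*} [CommRing R] [IsLocalRing R]

/-- Some cube equivalent to `S` satisfies the divisibilities prescribed by the weights and has
reduction `u`. -/
def Reduces (π : R) (s : ℕ) (a b c : Fin 3 → ℕ) (S : Cube R)
    (u : Cube (IsLocalRing.ResidueField R)) : Prop :=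
  ∃ V : Cube R, S.Equivalent V ∧ (∀ i j k, π ^ (a i + b j + c k - s) ∣ V i j k) ∧
    V.map (IsLocalRing.residue R) = u

lemma HasWeight.exists_reduces {π : R} {s : ℕ} {a b c : Fin 3 → ℕ} {S : Cube R}
    (h : S.HasWeight π s a b c) : ∃ u, Reduces π s a b c S u := by
  obtain ⟨V, hV, hd⟩ := h
  exact ⟨_, V, hV, hd, rfl⟩

/-- Lifts of invertible matrices from the residue field, keeping the zero entries. -/
lemma exists_lift_matrix (G : Matrix (Fin 3) (Fin 3) (IsLocalRing.ResidueField R)) (hG : G.det ≠ 0) :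
    ∃ M : Matrix (Fin 3) (Fin 3) R, IsUnit M.det ∧ M.map (IsLocalRing.residue R) = G ∧
      ∀ i j, G i j = 0 → M i j = 0 := by
  have : ∀ x : (IsLocalRing.ResidueField R), ∃ y : R, IsLocalRing.residue R y = x ∧ (x = 0 → y = 0) := by
    intro x
    by_cases hx : x = 0
    · exact ⟨0, by simp [hx]⟩
    · obtain ⟨y, hy⟩ := IsLocalRing.residue_surjective x
      exact ⟨y, hy, fun h => absurd h hx⟩
  choose f hf hf0 using this
  have hM : (Matrix.of fun i j => f (G i j)).map (IsLocalRing.residue R) = G := by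
    ext i j
    exact hf _
  refine ⟨Matrix.of fun i j => f (G i j), ?_, hM, fun i j h => hf0 _ h⟩
  apply isUnit_of_map_unit (IsLocalRing.residue R)
  rw [RingHom.map_det, RingHom.mapMatrix_apply, hM]
  exact hG.isUnit

variable {π : R} {s : ℕ} {a b c : Fin 3 → ℕ} {S : Cube R} {u : Cube (IsLocalRing.ResidueField R)}

lemma Reduces.sw01 (h : Reduces π s a b c S u) : Reduces π s b a c S.sw01 u.sw01 := by
  obtain ⟨V, hV, hd, rfl⟩ := h
  refine ⟨V.sw01, hV.sw01, fun i j k => ?_, rfl⟩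
  rw [add_comm (b i)]
  exact hd j i k

lemma Reduces.sw12 (h : Reduces π s a b c S u) : Reduces π s a c b S.sw12 u.sw12 := by
  obtain ⟨V, hV, hd, rfl⟩ := h
  refine ⟨V.sw12, hV.sw12, fun i j k => ?_, rfl⟩
  rw [add_right_comm]
  exact hd i k j

/-- A matrix over the residue field acts on the frame, if it only adds rows of larger weight to
rows of smaller weight. -/
lemma Reduces.act0 (h : Reduces π s a b c S u) (G : Matrix (Fin 3) (Fin 3) (IsLocalRing.ResidueField R)) (hG : G.det ≠ 0)
    (hw : ∀ i j, a j < a i → G i j = 0) : Reduces π s a b c S (Cube.act0 G u) := by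
  obtain ⟨V, hV, hd, rfl⟩ := h
  obtain ⟨M, hM, rfl, h0⟩ := exists_lift_matrix G hG
  refine ⟨Cube.act0 M V, hV.trans (Equivalent.of_act0 V hM), fun i j k => ?_, map_act0 _ _ _⟩
  refine Finset.dvd_sum fun i' _ => ?_
  by_cases hlt : a i' < a i
  · rw [h0 i i' (hw i i' hlt), zero_mul]
    exact dvd_zero _
  · exact ((pow_dvd_pow _ (by omega)).trans (hd i' j k)).mul_left _

lemma Reduces.perm (h : Reduces π s a b c S u) (σ τ ρ : Equiv.Perm (Fin 3)) :
    Reduces π s (a ∘ σ) (b ∘ τ) (c ∘ ρ) S fun i j k => u (σ i) (τ j) (ρ k) := by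
  obtain ⟨V, hV, hd, rfl⟩ := h
  exact ⟨_, hV.trans (equivalent_perm V σ τ ρ), fun i j k => hd _ _ _, rfl⟩

lemma Reduces.saturated (h : Reduces π s a b c S u) (hS : S.IsSaturated) :
    (∀ x : Fin 3 → (IsLocalRing.ResidueField R), (∀ j k, ∑ i, x i * u i j k = 0) → x = 0) ∧
    (∀ x : Fin 3 → (IsLocalRing.ResidueField R), (∀ i k, ∑ j, x j * u i j k = 0) → x = 0) ∧
    ∀ x : Fin 3 → (IsLocalRing.ResidueField R), (∀ i j, ∑ k, x k * u i j k = 0) → x = 0 := by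
  obtain ⟨V, hV, -, rfl⟩ := h
  have := hS.equivalent hV
  exact ⟨(sliceIndependent_zero_iff V).1 (this 0), (sliceIndependent_one_iff V).1 (this 1),
    (sliceIndependent_two_iff V).1 (this 2)⟩

lemma Reduces.toHasWeight (h : Reduces π s a b c S u) : S.HasWeight π s a b c := by
  obtain ⟨V, hV, hd, -⟩ := h
  exact ⟨V, hV, hd⟩

/-- The exponents given by the weights, raised to at least `1` at the entries in the list `E`. -/
def refinedExponent (s : ℕ) (a b c : Fin 3 → ℕ) (E : List (Fin 3 × Fin 3 × Fin 3))
    (i j k : Fin 3) : ℕ :=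
  max (a i + b j + c k - s) (if (i, j, k) ∈ E then 1 else 0)

end Frames

section DVR

variable {R K : Type*} [CommRing R] [IsDomain R] [IsDiscreteValuationRing R]
  [Field K] [Algebra R K] [IsFractionRing R K]

variable {π : R} {s : ℕ} {a b c : Fin 3 → ℕ} {S : Cube R} {u : Cube (IsLocalRing.ResidueField R)}

lemma pow_refinedExponent_dvd (hπ : Irreducible π) {V : Cube R}
    (hd : ∀ i j k, π ^ (a i + b j + c k - s) ∣ V i j k)
    {E : List (Fin 3 × Fin 3 × Fin 3)}
    (hE : ∀ p ∈ E, V.map (IsLocalRing.residue R) p.1 p.2.1 p.2.2 = 0) (i j k : Fin 3) :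
    π ^ refinedExponent s a b c E i j k ∣ V i j k := by
  rw [refinedExponent]
  rcases le_total (if (i, j, k) ∈ E then 1 else 0) (a i + b j + c k - s) with h | h
  · rw [max_eq_left h]
    exact hd i j k
  · rw [max_eq_right h]
    split_ifs with hm
    · rw [pow_one]
      exact (dvd_iff_residue_eq_zero hπ _).2 (hE _ hm)
    · simp

lemma Reduces.eq_zero (hπ : Irreducible π) (h : Reduces π s a b c S u) {i j k : Fin 3}
    (hlt : s < a i + b j + c k) : u i j k = 0 := by
  obtain ⟨V, -, hd, rfl⟩ := h
  exact (dvd_iff_residue_eq_zero hπ _).1 ((dvd_pow_self π (by omega)).trans (hd i j k))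

/-- Vanishing of further entries of the reduction gives further weights. -/
lemma Reduces.hasWeight (hπ : Irreducible π) (h : Reduces π s a b c S u)
    (E : List (Fin 3 × Fin 3 × Fin 3)) (hE : ∀ p ∈ E, u p.1 p.2.1 p.2.2 = 0)
    {s' : ℕ} {a' b' c' : Fin 3 → ℕ}
    (hle : ∀ i j k, a' i + b' j + c' k - s' ≤ refinedExponent s a b c E i j k) :
    S.HasWeight π s' a' b' c' := by
  obtain ⟨V, hV, hd, rfl⟩ := h
  exact ⟨V, hV, fun i j k =>
    (pow_dvd_pow _ (hle i j k)).trans (pow_refinedExponent_dvd hπ hd hE i j k)⟩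

/-- The transform of `V` by `Diag(π ^ d)` in the first two slicings, with the last slicing divided by
the powers `π ^ γ k`, is integral if `γ` is small enough. -/
lemma exists_transform {V : Cube R} {n : Fin 3 → Fin 3 → Fin 3 → ℕ}
    {d γ : Fin 3 → ℕ} (hn : ∀ i j k, π ^ n i j k ∣ V i j k)
    (hγ : ∀ i j k, γ k ≤ n i j k + d i + d j) : ∃ T : Cube R,
      (∀ i j k, T i j k * π ^ γ k = V i j k * π ^ (d i + d j)) ∧
      ∀ i j k, π ^ (n i j k + d i + d j - γ k) ∣ T i j k := by
  choose W hW using hn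
  refine ⟨fun i j k => π ^ (n i j k + d i + d j - γ k) * W i j k, fun i j k => ?_,
    fun i j k => dvd_mul_right _ _⟩
  rw [hW, mul_right_comm, ← pow_add, Nat.sub_add_cancel (hγ i j k), mul_right_comm, ← pow_add,
    add_assoc]

/-- The result of procedure (i) can be computed from any equivalent cube `V` whose first two cubics
are divisible by `z²` modulo `π`: the double lines of `V` and of the cube used by the procedure
coincide. -/
lemma StepI.exists_levelRatio (hπ : Irreducible π) {V T T'' : Cube R} {γ : Fin 3 → ℕ}
    (h : StepI K π 0 1 S T) (hV : S.Equivalent V)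
    (h0 : X 2 ^ 2 ∣ V.redCubic 0) (h1 : X 2 ^ 2 ∣ V.redCubic 1) (hγ : 2 ≤ ∑ k, γ k)
    (hT'' : ∀ i j k, T'' i j k * π ^ γ k
      = V i j k * π ^ ((![0, 0, 1] : Fin 3 → ℕ) i + (![0, 0, 1] : Fin 3 → ℕ) j)) :
    ∃ r, LevelRatio K S T r ∧ (IsUnit r → ∑ k, γ k = 2 ∧ T''.Equivalent T) := by
  obtain ⟨-, U, hU, ⟨hne0, hz0⟩, ⟨hne1, hz1⟩, hT⟩ := h
  obtain ⟨g, rfl⟩ := hV.symm.trans hU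
  obtain ⟨w, hwu, hw⟩ := hV.exists_levelRatio (K := K)
  have e0 := residue_align_of_sq_dvd h0 hne0 hz0
  have e1 := residue_align_of_sq_dvd h1 hne1 hz1
  simp only [← dvd_iff_residue_eq_zero hπ] at e0 e1
  have hD : (Matrix.diagonal ![1, 1, algebraMap R K π])
      = Matrix.diagonal fun i => algebraMap R K π ^ (![0, 0, 1] : Fin 3 → ℕ) i := by
    congr 1
    funext i
    fin_cases i <;> simp
  rw [hD] at hT
  obtain ⟨r, hr, hr'⟩ := hT.exists_levelRatio hπ (d := ![0, 0, 1]) (γ := γ) (by decide)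
    (by simpa [Fin.sum_univ_three] using hγ)
    (fun i j => by fin_cases i <;> fin_cases j <;> simp [e0])
    (fun i j => by fin_cases i <;> fin_cases j <;> simp [e1]) hT''
  refine ⟨w * r, hw.trans hr, fun hu => ?_⟩
  have := hr' (isUnit_of_mul_isUnit_right hu)
  exact ⟨by simpa [Fin.sum_univ_three] using this.1, this.2⟩

/-- The result of procedure (ii) can be computed from any equivalent cube `V` whose first two cubics
are singular at `(1 : 0 : 0)` modulo `π`. -/
lemma StepII.exists_levelRatio (hπ : Irreducible π) {V T T'' : Cube R} {γ : Fin 3 → ℕ}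
    (h : StepII K π 0 1 S T) (hV : S.Equivalent V)
    (h0 : IsSingularPoint (V.redCubic 0) (![1, 0, 0] : Fin 3 → (IsLocalRing.ResidueField R)))
    (h1 : IsSingularPoint (V.redCubic 1) (![1, 0, 0] : Fin 3 → (IsLocalRing.ResidueField R))) (hγ : 4 ≤ ∑ k, γ k)
    (hT'' : ∀ i j k, T'' i j k * π ^ γ k
      = V i j k * π ^ ((![0, 1, 1] : Fin 3 → ℕ) i + (![0, 1, 1] : Fin 3 → ℕ) j)) :
    ∃ r, LevelRatio K S T r ∧ (IsUnit r → ∑ k, γ k = 4 ∧ T''.Equivalent T) := by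
  obtain ⟨-, U, hU, hs0, hs1, hT⟩ := h
  obtain ⟨g, rfl⟩ := hV.symm.trans hU
  obtain ⟨w, hwu, hw⟩ := hV.exists_levelRatio (K := K)
  have e0 := residue_align_of_isUniqueSingularPoint h0 hs0
  have e1 := residue_align_of_isUniqueSingularPoint h1 hs1
  simp only [← dvd_iff_residue_eq_zero hπ] at e0 e1
  have hD : (Matrix.diagonal ![1, algebraMap R K π, algebraMap R K π])
      = Matrix.diagonal fun i => algebraMap R K π ^ (![0, 1, 1] : Fin 3 → ℕ) i := by
    congr 1
    funext i
    fin_cases i <;> simp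
  rw [hD] at hT
  obtain ⟨r, hr, hr'⟩ := hT.exists_levelRatio hπ (d := ![0, 1, 1]) (γ := γ) (by decide)
    (by simpa [Fin.sum_univ_three] using hγ)
    (fun i j => by fin_cases i <;> fin_cases j <;> simp [e0])
    (fun i j => by fin_cases i <;> fin_cases j <;> simp [e1]) hT''
  refine ⟨w * r, hw.trans hr, fun hu => ?_⟩
  have := hr' (isUnit_of_mul_isUnit_right hu)
  exact ⟨by simpa [Fin.sum_univ_three] using this.1, this.2⟩

/-- The outcome of procedure (i) on the first two slicings, read off from a frame, together with
what is known about the reduction of the new frame. -/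
lemma Reduces.stepI (hπ : Irreducible π) (h : Reduces π s a b c S u) {T : Cube R}
    (hT : StepI K π 0 1 S T) (h0 : X 2 ^ 2 ∣ u.cubic 0) (h1 : X 2 ^ 2 ∣ u.cubic 1)
    (E : List (Fin 3 × Fin 3 × Fin 3)) (hE : ∀ p ∈ E, u p.1 p.2.1 p.2.2 = 0) (γ : Fin 3 → ℕ)
    (hγ : ∀ i j k, γ k ≤ refinedExponent s a b c E i j k + (![0, 0, 1] : Fin 3 → ℕ) i
      + (![0, 0, 1] : Fin 3 → ℕ) j) (h2 : 2 ≤ ∑ k, γ k)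
    {s' : ℕ} {a' b' c' : Fin 3 → ℕ}
    (hle : ∀ i j k, a' i + b' j + c' k - s' ≤ refinedExponent s a b c E i j k
      + (![0, 0, 1] : Fin 3 → ℕ) i + (![0, 0, 1] : Fin 3 → ℕ) j - γ k) :
    ∃ r, LevelRatio K S T r ∧ (IsUnit r → ∑ k, γ k = 2 ∧ ∃ w, Reduces π s' a' b' c' T w ∧
      (∀ i j k, (![0, 0, 1] : Fin 3 → ℕ) i + (![0, 0, 1] : Fin 3 → ℕ) j = γ k →
        w i j k = u i j k) ∧
      ∀ i j k, γ k < refinedExponent s a b c E i j k + (![0, 0, 1] : Fin 3 → ℕ) i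
        + (![0, 0, 1] : Fin 3 → ℕ) j → w i j k = 0) := by
  obtain ⟨V, hV, hd, rfl⟩ := h
  obtain ⟨T'', e, hd''⟩ := exists_transform (pow_refinedExponent_dvd hπ hd hE) hγ
  rw [← redCubic_eq] at h0 h1
  obtain ⟨r, hr, hr'⟩ := hT.exists_levelRatio hπ hV h0 h1 h2 e
  refine ⟨r, hr, fun hu => ⟨(hr' hu).1, _, ⟨T'', (hr' hu).2.symm, fun i j k =>
    (pow_dvd_pow _ (hle i j k)).trans (hd'' i j k), rfl⟩, fun i j k h => ?_, fun i j k h => ?_⟩⟩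
  · have := e i j k
    rw [h] at this
    rw [Cube.map, Cube.map, mul_right_cancel₀ (pow_ne_zero _ hπ.ne_zero) this]
  · exact (dvd_iff_residue_eq_zero hπ _).1 ((dvd_pow_self π (by omega)).trans (hd'' i j k))

/-- The outcome of procedure (ii) on the first two slicings, read off from a frame. -/
lemma Reduces.stepII (hπ : Irreducible π) (h : Reduces π s a b c S u) {T : Cube R}
    (hT : StepII K π 0 1 S T) (h0 : IsSingularPoint (u.cubic 0) (![1, 0, 0] : Fin 3 → (IsLocalRing.ResidueField R)))
    (h1 : IsSingularPoint (u.cubic 1) (![1, 0, 0] : Fin 3 → (IsLocalRing.ResidueField R)))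
    (E : List (Fin 3 × Fin 3 × Fin 3)) (hE : ∀ p ∈ E, u p.1 p.2.1 p.2.2 = 0) (γ : Fin 3 → ℕ)
    (hγ : ∀ i j k, γ k ≤ refinedExponent s a b c E i j k + (![0, 1, 1] : Fin 3 → ℕ) i
      + (![0, 1, 1] : Fin 3 → ℕ) j) (h2 : 4 ≤ ∑ k, γ k)
    {s' : ℕ} {a' b' c' : Fin 3 → ℕ}
    (hle : ∀ i j k, a' i + b' j + c' k - s' ≤ refinedExponent s a b c E i j k
      + (![0, 1, 1] : Fin 3 → ℕ) i + (![0, 1, 1] : Fin 3 → ℕ) j - γ k) :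
    ∃ r, LevelRatio K S T r ∧ (IsUnit r → ∑ k, γ k = 4 ∧ T.HasWeight π s' a' b' c') := by
  obtain ⟨V, hV, hd, rfl⟩ := h
  obtain ⟨T'', e, hd''⟩ := exists_transform (pow_refinedExponent_dvd hπ hd hE) hγ
  rw [← redCubic_eq] at h0 h1
  obtain ⟨r, hr, hr'⟩ := hT.exists_levelRatio hπ hV h0 h1 h2 e
  refine ⟨r, hr, fun hu => ⟨(hr' hu).1, T'', (hr' hu).2.symm, fun i j k =>
    (pow_dvd_pow _ (hle i j k)).trans (hd'' i j k)⟩⟩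

end DVR

end Cube

/-! ### Permutations of the slicings and sequences of procedures -/

section Transfer

variable {k : Type*} [Field k]

lemma linSubst_injective {g : Matrix (Fin 3) (Fin 3) k} (hg : IsUnit g.det)
    {f f' : MvPolynomial (Fin 3) k} (h : linSubst g f = linSubst g f') : f = f' := by
  have := congrArg (linSubst g⁻¹) h
  rwa [linSubst_linSubst, linSubst_linSubst, Matrix.nonsing_inv_mul _ hg, linSubst_one,
    linSubst_one] at this

lemma HasRepeatedLinearFactor.C_mul_linSubst {f : MvPolynomial (Fin 3) k}
    (h : HasRepeatedLinearFactor f) {u : k} (hu : u ≠ 0) {g : Matrix (Fin 3) (Fin 3) k}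
    (hg : IsUnit g.det) : HasRepeatedLinearFactor (C u * linSubst g f) := by
  obtain ⟨hf, l, hl, hd⟩ := h
  refine ⟨mul_ne_zero (by simpa using hu) fun h0 => hf (linSubst_injective hg (by rw [h0, map_zero])),
    g.mulVec l, fun h0 => hl ?_, ?_⟩
  · exact Matrix.mulVec_injective_of_isUnit ((Matrix.isUnit_iff_isUnit_det _).2 hg)
      (h0.trans (Matrix.mulVec_zero _).symm)
  · rw [← linSubst_linear, ← map_pow]
    exact (map_dvd _ hd).mul_left _

lemma IsUniqueSingularPoint.C_mul_linSubst {f : MvPolynomial (Fin 3) k} {p : Fin 3 → k}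
    (h : IsUniqueSingularPoint f p) {u : k} (hu : u ≠ 0) {g : Matrix (Fin 3) (Fin 3) k}
    (hg : IsUnit g.det) : IsUniqueSingularPoint (C u * linSubst g f) (Matrix.vecMul p g⁻¹) := by
  have hid : ∀ M : Matrix (Fin 3) (Fin 3) k, M.map (algebraMap k k) = M := fun M => by ext; rfl
  refine ⟨(isSingularPoint_C_mul_iff hu _ _).2 ((isSingularPoint_linSubst_iff hg _ _).2 ?_),
    fun q hq => ?_⟩
  · rw [hid, Matrix.vecMul_vecMul, Matrix.nonsing_inv_mul _ hg, Matrix.vecMul_one]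
    exact h.1
  · obtain ⟨c, hc⟩ := h.2 _ ((isSingularPoint_linSubst_iff hg _ _).1
      ((isSingularPoint_C_mul_iff hu _ _).1 hq))
    refine ⟨c, ?_⟩
    set φ := algebraMap k (SeparableClosure k)
    have h1 : g.map φ * g⁻¹.map φ = 1 := by
      rw [← Matrix.map_mul, Matrix.mul_nonsing_inv _ hg, Matrix.map_one _ (map_zero _) (map_one _)]
    have h2 := congrArg (fun v => Matrix.vecMul v (g⁻¹.map φ)) hc
    simp only [Matrix.vecMul_vecMul, h1, Matrix.vecMul_one] at h2
    rw [h2]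
    funext t
    simp [Matrix.vecMul, dotProduct, Finset.mul_sum, mul_assoc]

lemma not_isUniqueSingularPoint_of_sq_dvd {f : MvPolynomial (Fin 3) k} (h : X 2 ^ 2 ∣ f)
    (p : Fin 3 → k) : ¬ IsUniqueSingularPoint f p := by
  rintro ⟨-, hp⟩
  obtain ⟨F, rfl⟩ := h
  have key : ∀ q : Fin 3 → SeparableClosure k, q ≠ 0 → q 2 = 0 →
      IsSingularPoint (X 2 ^ 2 * F) q := fun q hq h2 =>
    ⟨hq, by simp [h2], fun t => by simp [h2, Derivation.leibniz, Derivation.leibniz_pow]⟩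
  obtain ⟨c, hc⟩ := hp ![1, 0, 0] (key _ (fun h => by simpa using congr_fun h 0) rfl)
  obtain ⟨c', hc'⟩ := hp ![0, 1, 0] (key _ (fun h => by simpa using congr_fun h 1) rfl)
  have e0 := congr_fun hc 0
  have e1 := congr_fun hc 1
  have e2 := congr_fun hc' 1
  simp only [Matrix.cons_val] at e0 e1 e2
  have hc0 : c ≠ 0 := fun h0 => by simp [h0] at e0
  have p1 := (mul_eq_zero.1 e1.symm).resolve_left hc0
  simp [p1] at e2

end Transfer

namespace Cube

section Equivalence

variable {R : Type*} [CommRing R] [IsLocalRing R] {S V : Cube R}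

lemma Equivalent.hasRepeatedLinearFactor (e : S.Equivalent V) {i : Fin 3}
    (h : HasRepeatedLinearFactor (S.redCubic i)) : HasRepeatedLinearFactor (V.redCubic i) := by
  obtain ⟨g, rfl⟩ := e
  obtain ⟨u, hu, e⟩ := exists_redCubic_glAct g S i
  rw [e]
  exact h.C_mul_linSubst hu (isUnit_det_map_residue (isUnit_det_gl (g i)))

lemma Equivalent.exists_isUniqueSingularPoint (e : S.Equivalent V) {i : Fin 3}
    (h : ∃ p, IsUniqueSingularPoint (S.redCubic i) p) :
    ∃ p, IsUniqueSingularPoint (V.redCubic i) p := by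
  obtain ⟨g, rfl⟩ := e
  obtain ⟨p, hp⟩ := h
  obtain ⟨u, hu, e⟩ := exists_redCubic_glAct g S i
  rw [e]
  exact ⟨_, hp.C_mul_linSubst hu (isUnit_det_map_residue (isUnit_det_gl (g i)))⟩

lemma redCubic_sw01 (S : Cube R) (i : Fin 3) : S.sw01.redCubic (idx01 i) = S.redCubic i := by
  rw [redCubic, cubic_sw01, redCubic]

lemma redCubic_sw12 (S : Cube R) (i : Fin 3) : S.sw12.redCubic (idx12 i) = S.redCubic i := by
  rw [redCubic, cubic_sw12, redCubic]

end Equivalence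

section Steps

variable {R K : Type*} [CommRing R] [IsDomain R] [IsDiscreteValuationRing R]
  [Field K] [Algebra R K]

lemma idx01_idx01 (i : Fin 3) : idx01 (idx01 i) = i := by
  fin_cases i <;> rfl

lemma idx12_idx12 (i : Fin 3) : idx12 (idx12 i) = i := by
  fin_cases i <;> rfl

lemma Transform.sw01 {D : Matrix (Fin 3) (Fin 3) K} {i j : Fin 3} {U T : Cube R}
    (h : Transform K D i j U T) : Transform K D (idx01 i) (idx01 j) U.sw01 T.sw01 := by
  obtain ⟨A, hi, hj, hA, hm⟩ := h
  refine ⟨fun t => A (idx01 t), ?_, ?_, ?_, fun m h1 h2 => ?_⟩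
  · simpa only [idx01_idx01] using hi
  · simpa only [idx01_idx01] using hj
  · have := congrArg Cube.sw01 hA
    rw [sw01_glAct] at this
    refine Eq.trans this ?_
    congr 1
    funext t
    fin_cases t <;> rfl
  · have := (sliceIndependent_sw01 T (idx01 m)).2 (hm (idx01 m)
      (fun h => h1 (by rw [← h, idx01_idx01])) (fun h => h2 (by rw [← h, idx01_idx01])))
    rwa [idx01_idx01] at this

lemma Transform.sw12 {D : Matrix (Fin 3) (Fin 3) K} {i j : Fin 3} {U T : Cube R}
    (h : Transform K D i j U T) : Transform K D (idx12 i) (idx12 j) U.sw12 T.sw12 := by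
  obtain ⟨A, hi, hj, hA, hm⟩ := h
  refine ⟨fun t => A (idx12 t), ?_, ?_, ?_, fun m h1 h2 => ?_⟩
  · simpa only [idx12_idx12] using hi
  · simpa only [idx12_idx12] using hj
  · have := congrArg Cube.sw12 hA
    rw [sw12_glAct] at this
    refine Eq.trans this ?_
    congr 1
    funext t
    fin_cases t <;> rfl
  · have := (sliceIndependent_sw12 T (idx12 m)).2 (hm (idx12 m)
      (fun h => h1 (by rw [← h, idx12_idx12])) (fun h => h2 (by rw [← h, idx12_idx12])))
    rwa [idx12_idx12] at this

lemma Transform.symm {D : Matrix (Fin 3) (Fin 3) K} {i j : Fin 3} {U T : Cube R}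
    (h : Transform K D i j U T) : Transform K D j i U T := by
  obtain ⟨A, hi, hj, hA, hm⟩ := h
  exact ⟨A, hj, hi, hA, fun m h1 h2 => hm m h2 h1⟩

variable {π : R} {i j : Fin 3} {S T : Cube R}

lemma StepI.symm (h : StepI K π i j S T) : StepI K π j i S T := by
  obtain ⟨hij, U, hU, hi, hj, hT⟩ := h
  exact ⟨hij.symm, U, hU, hj, hi, hT.symm⟩

lemma StepII.symm (h : StepII K π i j S T) : StepII K π j i S T := by
  obtain ⟨hij, U, hU, hi, hj, hT⟩ := h
  exact ⟨hij.symm, U, hU, hj, hi, hT.symm⟩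

lemma StepI.sw01 (h : StepI K π i j S T) : StepI K π (idx01 i) (idx01 j) S.sw01 T.sw01 := by
  obtain ⟨hij, U, hU, hi, hj, hT⟩ := h
  refine ⟨fun h => hij ?_, U.sw01, hU.sw01, ?_, ?_, hT.sw01⟩
  · rw [← idx01_idx01 i, h, idx01_idx01]
  · have e := redCubic_sw01 U i
    simpa only [e] using hi
  · have e := redCubic_sw01 U j
    simpa only [e] using hj

lemma StepI.sw12 (h : StepI K π i j S T) : StepI K π (idx12 i) (idx12 j) S.sw12 T.sw12 := by
  obtain ⟨hij, U, hU, hi, hj, hT⟩ := h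
  refine ⟨fun h => hij ?_, U.sw12, hU.sw12, ?_, ?_, hT.sw12⟩
  · rw [← idx12_idx12 i, h, idx12_idx12]
  · have e := redCubic_sw12 U i
    simpa only [e] using hi
  · have e := redCubic_sw12 U j
    simpa only [e] using hj

lemma StepII.sw01 (h : StepII K π i j S T) : StepII K π (idx01 i) (idx01 j) S.sw01 T.sw01 := by
  obtain ⟨hij, U, hU, hi, hj, hT⟩ := h
  refine ⟨fun h => hij ?_, U.sw01, hU.sw01, ?_, ?_, hT.sw01⟩
  · rw [← idx01_idx01 i, h, idx01_idx01]
  · have e := redCubic_sw01 U i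
    simpa only [e] using hi
  · have e := redCubic_sw01 U j
    simpa only [e] using hj

lemma StepII.sw12 (h : StepII K π i j S T) : StepII K π (idx12 i) (idx12 j) S.sw12 T.sw12 := by
  obtain ⟨hij, U, hU, hi, hj, hT⟩ := h
  refine ⟨fun h => hij ?_, U.sw12, hU.sw12, ?_, ?_, hT.sw12⟩
  · rw [← idx12_idx12 i, h, idx12_idx12]
  · have e := redCubic_sw12 U i
    simpa only [e] using hi
  · have e := redCubic_sw12 U j
    simpa only [e] using hj

lemma Step.sw01 (h : Step K π S T) : Step K π S.sw01 T.sw01 := by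
  obtain ⟨i, j, h | h⟩ := h
  exacts [⟨_, _, .inl h.sw01⟩, ⟨_, _, .inr h.sw01⟩]

lemma Step.sw12 (h : Step K π S T) : Step K π S.sw12 T.sw12 := by
  obtain ⟨i, j, h | h⟩ := h
  exacts [⟨_, _, .inl h.sw12⟩, ⟨_, _, .inr h.sw12⟩]

lemma hasRepeatedLinearFactor_of_X_two_sq_dvd {k : Type*} [Field k] {f : MvPolynomial (Fin 3) k} (h0 : f ≠ 0)
    (h : X 2 ^ 2 ∣ f) : HasRepeatedLinearFactor f :=
  ⟨h0, ![0, 0, 1], fun h => by simpa using congr_fun h 2, by rwa [← X_two_sq_eq]⟩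

lemma StepI.hasRepeatedLinearFactor (h : StepI K π i j S T) {V : Cube R} (e : S.Equivalent V) :
    HasRepeatedLinearFactor (V.redCubic i) ∧ HasRepeatedLinearFactor (V.redCubic j) := by
  obtain ⟨-, U, hU, hi, hj, -⟩ := h
  exact ⟨(hU.symm.trans e).hasRepeatedLinearFactor (hasRepeatedLinearFactor_of_X_two_sq_dvd hi.1 hi.2),
    (hU.symm.trans e).hasRepeatedLinearFactor (hasRepeatedLinearFactor_of_X_two_sq_dvd hj.1 hj.2)⟩

lemma StepII.exists_isUniqueSingularPoint (h : StepII K π i j S T) {V : Cube R}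
    (e : S.Equivalent V) : (∃ p, IsUniqueSingularPoint (V.redCubic i) p) ∧
      ∃ p, IsUniqueSingularPoint (V.redCubic j) p := by
  obtain ⟨-, U, hU, hi, hj, -⟩ := h
  exact ⟨(hU.symm.trans e).exists_isUniqueSingularPoint ⟨_, hi⟩,
    (hU.symm.trans e).exists_isUniqueSingularPoint ⟨_, hj⟩⟩

variable (K π)

/-- Each sequence of `n` procedures starting at `S` meets a drop of the level, or a cube that is not
saturated. -/
def Good : ℕ → Cube R → Prop
  | 0, _ => False
  | n + 1, S => ∀ T, Step K π S T → ∃ r, LevelRatio K S T r ∧ (IsUnit r → T.IsSaturated → Good n T)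

/-- As in the definition of `Good (n + 1)`, but only for the procedures that use the first two
slicings. -/
def GoodStep (n : ℕ) (S : Cube R) : Prop :=
  ∀ T, StepI K π 0 1 S T ∨ StepII K π 0 1 S T →
    ∃ r, LevelRatio K S T r ∧ (IsUnit r → T.IsSaturated → Good K π n T)

variable {K π} {n : ℕ}

lemma Good.sw01 (h : Good K π n S) : Good K π n S.sw01 := by
  induction n generalizing S with
  | zero => exact h
  | succ n ih =>
    intro T hT
    obtain ⟨r, hr, hr'⟩ := h T.sw01 hT.sw01
    exact ⟨r, hr.sw01, fun hu hs => ih (hr' hu hs.sw01)⟩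

lemma Good.sw12 (h : Good K π n S) : Good K π n S.sw12 := by
  induction n generalizing S with
  | zero => exact h
  | succ n ih =>
    intro T hT
    obtain ⟨r, hr, hr'⟩ := h T.sw12 hT.sw12
    exact ⟨r, hr.sw12, fun hu hs => ih (hr' hu hs.sw12)⟩

lemma Good.succ (h : Good K π n S) : Good K π (n + 1) S := by
  induction n generalizing S with
  | zero => exact h.elim
  | succ n ih =>
    intro T hT
    obtain ⟨r, hr, hr'⟩ := h T hT
    exact ⟨r, hr, fun hu hs => ih (hr' hu hs)⟩

lemma GoodStep.sw01 (h : GoodStep K π n S) : GoodStep K π n S.sw01 := by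
  intro T hT
  obtain ⟨r, hr, hr'⟩ := h T.sw01 (hT.imp (fun h => h.sw01.symm) fun h => h.sw01.symm)
  exact ⟨r, hr.sw01, fun hu hs => (hr' hu hs.sw01).sw01⟩

/-- The three pairs of slicings can be moved to the first two places. -/
lemma Good.of_goodStep (h01 : GoodStep K π n S) (h02 : GoodStep K π n S.sw12)
    (h12 : GoodStep K π n S.sw01.sw12) : Good K π (n + 1) S := by
  have key : ∀ i j T, i < j → (StepI K π i j S T ∨ StepII K π i j S T) →
      ∃ r, LevelRatio K S T r ∧ (IsUnit r → T.IsSaturated → Good K π n T) := by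
    intro i j T hij hT
    fin_cases i <;> fin_cases j <;> try exact absurd hij (by decide)
    · exact h01 T hT
    · obtain ⟨r, hr, hr'⟩ := h02 T.sw12 (hT.imp (fun h => h.sw12) fun h => h.sw12)
      exact ⟨r, hr.sw12, fun hu hs => (hr' hu hs.sw12).sw12⟩
    · obtain ⟨r, hr, hr'⟩ := h12 T.sw01.sw12 (hT.imp (fun h => h.sw01.sw12) fun h => h.sw01.sw12)
      exact ⟨r, hr.sw12.sw01, fun hu hs => (hr' hu hs.sw01.sw12).sw12.sw01⟩
  rintro T ⟨i, j, hT⟩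
  rcases lt_trichotomy i j with hij | rfl | hij
  · exact key i j T hij hT
  · exact (hT.elim (fun h => h.1 rfl) fun h => h.1 rfl).elim
  · exact key j i T hij (hT.imp StepI.symm StepII.symm)

/-- A property that singles out the last slicing, but is symmetric in the first two, has to be
examined for two pairs of slicings only. -/
lemma UpToSlots.good {P : Cube R → Prop} (hP : ∀ S, P S → P S.sw01)
    (h01 : ∀ S, P S → GoodStep K π n S) (h12 : ∀ S, P S → GoodStep K π n S.sw12.sw01)
    (h : UpToSlots P S) : Good K π (n + 1) S := by
  have key : ∀ S, P S → Good K π (n + 1) S := fun S hS =>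
    Good.of_goodStep (h01 S hS) (h12 S hS).sw01 (h12 _ (hP S hS)).sw01
  rcases h with h | h | h
  · exact key _ h
  · exact (key _ h).sw12
  · exact (key _ h).sw12.sw01

end Steps

end Cube

/-! ### Outcomes of the procedures and type A -/

namespace Cube

section Steps

variable {R K : Type*} [CommRing R] [IsDomain R] [IsDiscreteValuationRing R]
  [Field K] [Algebra R K] [IsFractionRing R K]
  {π : R} {s : ℕ} {a b c : Fin 3 → ℕ} {S T : Cube R} {u : Cube (IsLocalRing.ResidueField R)} {n : ℕ}

/-- Procedure (i) lowers the level when the exponents `γ` have sum at least `3`. -/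
lemma Reduces.stepI_drop (hπ : Irreducible π) (h : Reduces π s a b c S u)
    (hT : StepI K π 0 1 S T) (h0 : X 2 ^ 2 ∣ u.cubic 0) (h1 : X 2 ^ 2 ∣ u.cubic 1)
    (E : List (Fin 3 × Fin 3 × Fin 3)) (hE : ∀ p ∈ E, u p.1 p.2.1 p.2.2 = 0) (γ : Fin 3 → ℕ)
    (hγ : ∀ i j k, γ k ≤ refinedExponent s a b c E i j k + (![0, 0, 1] : Fin 3 → ℕ) i
      + (![0, 0, 1] : Fin 3 → ℕ) j) (h2 : 2 < ∑ k, γ k) :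
    ∃ r, LevelRatio K S T r ∧ (IsUnit r → T.IsSaturated → Good K π n T) := by
  obtain ⟨r, hr, hr'⟩ := h.stepI hπ hT h0 h1 E hE γ hγ h2.le (s' := 0) (a' := 0) (b' := 0)
    (c' := 0) (by simp)
  exact ⟨r, hr, fun hu => absurd (hr' hu).1 h2.ne'⟩

/-- Procedure (i) leads to a new weight when the exponents `γ` have sum `2`. -/
lemma Reduces.stepI_good (hπ : Irreducible π) (h : Reduces π s a b c S u)
    (hT : StepI K π 0 1 S T) (h0 : X 2 ^ 2 ∣ u.cubic 0) (h1 : X 2 ^ 2 ∣ u.cubic 1)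
    (E : List (Fin 3 × Fin 3 × Fin 3)) (hE : ∀ p ∈ E, u p.1 p.2.1 p.2.2 = 0) (γ : Fin 3 → ℕ)
    (hγ : ∀ i j k, γ k ≤ refinedExponent s a b c E i j k + (![0, 0, 1] : Fin 3 → ℕ) i
      + (![0, 0, 1] : Fin 3 → ℕ) j) (h2 : 2 ≤ ∑ k, γ k)
    (s' : ℕ) (a' b' c' : Fin 3 → ℕ)
    (hle : ∀ i j k, a' i + b' j + c' k - s' ≤ refinedExponent s a b c E i j k
      + (![0, 0, 1] : Fin 3 → ℕ) i + (![0, 0, 1] : Fin 3 → ℕ) j - γ k)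
    (hgood : T.HasWeight π s' a' b' c' → T.IsSaturated → Good K π n T) :
    ∃ r, LevelRatio K S T r ∧ (IsUnit r → T.IsSaturated → Good K π n T) := by
  obtain ⟨r, hr, hr'⟩ := h.stepI hπ hT h0 h1 E hE γ hγ h2 hle
  refine ⟨r, hr, fun hu => ?_⟩
  obtain ⟨-, w, hw, -⟩ := hr' hu
  exact hgood hw.toHasWeight

/-- Procedure (ii) lowers the level when the exponents `γ` have sum at least `5`. -/
lemma Reduces.stepII_drop (hπ : Irreducible π) (h : Reduces π s a b c S u)
    (hT : StepII K π 0 1 S T)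
    (h0 : IsSingularPoint (u.cubic 0) (![1, 0, 0] : Fin 3 → (IsLocalRing.ResidueField R)))
    (h1 : IsSingularPoint (u.cubic 1) (![1, 0, 0] : Fin 3 → (IsLocalRing.ResidueField R)))
    (E : List (Fin 3 × Fin 3 × Fin 3)) (hE : ∀ p ∈ E, u p.1 p.2.1 p.2.2 = 0) (γ : Fin 3 → ℕ)
    (hγ : ∀ i j k, γ k ≤ refinedExponent s a b c E i j k + (![0, 1, 1] : Fin 3 → ℕ) i
      + (![0, 1, 1] : Fin 3 → ℕ) j) (h2 : 4 < ∑ k, γ k) :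
    ∃ r, LevelRatio K S T r ∧ (IsUnit r → T.IsSaturated → Good K π n T) := by
  obtain ⟨r, hr, hr'⟩ := h.stepII hπ hT h0 h1 E hE γ hγ h2.le (s' := 0) (a' := 0) (b' := 0)
    (c' := 0) (by simp)
  exact ⟨r, hr, fun hu => absurd (hr' hu).1 h2.ne'⟩

/-- Procedure (ii) leads to a new weight when the exponents `γ` have sum `4`. -/
lemma Reduces.stepII_good (hπ : Irreducible π) (h : Reduces π s a b c S u)
    (hT : StepII K π 0 1 S T)
    (h0 : IsSingularPoint (u.cubic 0) (![1, 0, 0] : Fin 3 → (IsLocalRing.ResidueField R)))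
    (h1 : IsSingularPoint (u.cubic 1) (![1, 0, 0] : Fin 3 → (IsLocalRing.ResidueField R)))
    (E : List (Fin 3 × Fin 3 × Fin 3)) (hE : ∀ p ∈ E, u p.1 p.2.1 p.2.2 = 0) (γ : Fin 3 → ℕ)
    (hγ : ∀ i j k, γ k ≤ refinedExponent s a b c E i j k + (![0, 1, 1] : Fin 3 → ℕ) i
      + (![0, 1, 1] : Fin 3 → ℕ) j) (h2 : 4 ≤ ∑ k, γ k)
    (s' : ℕ) (a' b' c' : Fin 3 → ℕ)
    (hle : ∀ i j k, a' i + b' j + c' k - s' ≤ refinedExponent s a b c E i j k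
      + (![0, 1, 1] : Fin 3 → ℕ) i + (![0, 1, 1] : Fin 3 → ℕ) j - γ k)
    (hgood : T.HasWeight π s' a' b' c' → T.IsSaturated → Good K π n T) :
    ∃ r, LevelRatio K S T r ∧ (IsUnit r → T.IsSaturated → Good K π n T) := by
  obtain ⟨r, hr, hr'⟩ := h.stepII hπ hT h0 h1 E hE γ hγ h2 hle
  exact ⟨r, hr, fun hu => hgood (hr' hu).2⟩

lemma Reduces.hasRepeatedLinearFactor (h : Reduces π s a b c S u) (hT : StepI K π 0 1 S T) :
    HasRepeatedLinearFactor (u.cubic 0) ∧ HasRepeatedLinearFactor (u.cubic 1) := by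
  obtain ⟨V, hV, -, rfl⟩ := h
  rw [← redCubic_eq, ← redCubic_eq]
  exact hT.hasRepeatedLinearFactor hV

lemma Reduces.not_stepII (h : Reduces π s a b c S u) (hz : X 2 ^ 2 ∣ u.cubic 0 ∨ X 2 ^ 2 ∣ u.cubic 1) :
    ¬ StepII K π 0 1 S T := by
  intro hT
  obtain ⟨V, hV, -, rfl⟩ := h
  rw [← redCubic_eq, ← redCubic_eq] at hz
  obtain ⟨⟨p, hp⟩, q, hq⟩ := hT.exists_isUniqueSingularPoint hV
  exact hz.elim (fun hz => not_isUniqueSingularPoint_of_sq_dvd hz p hp)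
    fun hz => not_isUniqueSingularPoint_of_sq_dvd hz q hq

end Steps

section Criteria

variable {k : Type*} [Field k] {u : Cube k}

lemma X_two_sq_dvd_cubic_zero (h : u.coeffs 0 = 0 ∧ u.coeffs 1 = 0 ∧ u.coeffs 3 = 0 ∧
    u.coeffs 4 = 0 ∧ u.coeffs 5 = 0 ∧ u.coeffs 6 = 0 ∧ u.coeffs 9 = 0) : X 2 ^ 2 ∣ u.cubic 0 := by
  rw [cubic_zero_eq_ternaryCubic]
  exact (X_two_sq_dvd_iff _).2 h

lemma X_two_sq_dvd_cubic_one (h : u.sw01.coeffs 0 = 0 ∧ u.sw01.coeffs 1 = 0 ∧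
    u.sw01.coeffs 3 = 0 ∧ u.sw01.coeffs 4 = 0 ∧ u.sw01.coeffs 5 = 0 ∧ u.sw01.coeffs 6 = 0 ∧
    u.sw01.coeffs 9 = 0) : X 2 ^ 2 ∣ u.cubic 1 := by
  rw [cubic_one_eq_ternaryCubic]
  exact (X_two_sq_dvd_iff _).2 h

lemma isSingularPoint_ternaryCubic {c : Fin 10 → k} (h0 : c 0 = 0) (h3 : c 3 = 0) (h4 : c 4 = 0) :
    IsSingularPoint (ternaryCubic c) (![1, 0, 0] : Fin 3 → k) := by
  refine ⟨fun h => by simpa using congr_fun h 0, ?_, fun t => ?_⟩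
  · simp [aeval_ternaryCubic, h0]
  · fin_cases t
    · simp [aeval_pderiv_zero_ternaryCubic, h0]
    · simp [aeval_pderiv_one_ternaryCubic, h3]
    · simp [aeval_pderiv_two_ternaryCubic, h4]

end Criteria

section TypeA

variable {R K : Type*} [CommRing R] [IsDomain R] [IsDiscreteValuationRing R]
  [Field K] [Algebra R K] [IsFractionRing R K] {π : R} {S T : Cube R}

lemma IsTypeA.goodStep (hπ : Irreducible π) (h : S.IsTypeA π) : GoodStep K π 0 S := by
  intro T hT
  obtain ⟨u, hu⟩ := HasWeight.exists_reduces h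
  have hz0 : X 2 ^ 2 ∣ u.cubic 0 := X_two_sq_dvd_cubic_zero
    (by simp [coeffs, mixedDet, rowDet, hu.eq_zero hπ])
  have hz1 : X 2 ^ 2 ∣ u.cubic 1 := X_two_sq_dvd_cubic_one
    (by simp [coeffs, mixedDet, rowDet, Cube.sw01, hu.eq_zero hπ])
  rcases hT with hT | hT
  · exact hu.stepI_drop hπ hT hz0 hz1 [] (by simp) ![1, 1, 1] (by decide) (by decide)
  · exact (hu.not_stepII (.inl hz0) hT).elim

/-- If the special slicing is one of the two that are used, then one of the two cubics vanishes modulo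
`π`, and no procedure applies. -/
lemma IsTypeA.goodStep' (hπ : Irreducible π) (h : S.IsTypeA π) : GoodStep K π 0 S.sw12.sw01 := by
  intro T hT
  obtain ⟨u, hu⟩ := (HasWeight.sw12 h).sw01.exists_reduces
  have hz0 : u.cubic 0 = 0 := by
    rw [cubic_zero_eq_ternaryCubic, ternaryCubic_eq_zero_iff]
    funext t
    fin_cases t <;> simp [coeffs, mixedDet, rowDet, hu.eq_zero hπ]
  rcases hT with hT | hT
  · exact absurd hz0 (hu.hasRepeatedLinearFactor hT).1.1
  · exact (hu.not_stepII (.inl (by rw [hz0]; exact dvd_zero _)) hT).elim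

lemma good_of_isTypeA (hπ : Irreducible π) (h : UpToSlots (IsTypeA π) S) : Good K π 1 S :=
  h.good (fun _ h => h.sw01) (fun _ h => h.goodStep hπ) fun _ h => h.goodStep' hπ

end TypeA

end Cube

/-! ### Operations on adapted bases and type D -/

namespace Cube

section Operations

variable {R : Type*} [CommRing R] [IsLocalRing R] {π : R} {s : ℕ} {a b c : Fin 3 → ℕ} {S : Cube R}
  {u : Cube (IsLocalRing.ResidueField R)}

lemma act0_transvection {A : Type*} [CommRing A] (p q : Fin 3) (t : A) (u : Cube A) :
    Cube.act0 (Matrix.transvection p q t) u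
      = fun i j k => u i j k + if i = p then t * u q j k else 0 := by
  funext i j k
  simp only [Cube.act0, Matrix.transvection, Matrix.add_apply, Matrix.one_apply, add_mul, ite_mul,
    one_mul, zero_mul, Finset.sum_add_distrib, Finset.sum_ite_eq, Finset.mem_univ, if_true,
    Matrix.single_apply]
  congr 1
  rw [Finset.sum_eq_single q (fun b _ hb => by simp [hb.symm]) (by simp)]
  simp [eq_comm]

/-- Adding a multiple of the slice `q` to the slice `p`, which has at most the same weight. -/
lemma Reduces.add0 (h : Reduces π s a b c S u) {p q : Fin 3} (hpq : p ≠ q) (hw : a p ≤ a q)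
    (t : IsLocalRing.ResidueField R) :
    Reduces π s a b c S fun i j k => u i j k + if i = p then t * u q j k else 0 := by
  rw [← act0_transvection]
  refine h.act0 _ (by simp [Matrix.det_transvection_of_ne _ _ hpq]) fun i j hij => ?_
  have h1 : i ≠ j := by rintro rfl; exact lt_irrefl _ hij
  have h2 : ¬ (p = i ∧ q = j) := by rintro ⟨rfl, rfl⟩; exact absurd hij (not_lt.2 hw)
  simp [Matrix.transvection, h1, h2]

lemma Reduces.add1 (h : Reduces π s a b c S u) {p q : Fin 3} (hpq : p ≠ q) (hw : b p ≤ b q)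
    (t : IsLocalRing.ResidueField R) :
    Reduces π s a b c S fun i j k => u i j k + if j = p then t * u i q k else 0 :=
  (h.sw01.add0 hpq hw t).sw01

lemma Reduces.add2 (h : Reduces π s a b c S u) {p q : Fin 3} (hpq : p ≠ q) (hw : c p ≤ c q)
    (t : IsLocalRing.ResidueField R) :
    Reduces π s a b c S fun i j k => u i j k + if k = p then t * u i j q else 0 :=
  (h.sw12.add1 hpq hw t).sw12

/-- Two slices of the same weight can be replaced by invertible combinations, one of which is
prescribed. -/
lemma Reduces.mix0 (h : Reduces π s a b c S u) {p q : Fin 3} (hpq : p ≠ q) (hw : a p = a q)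
    {x y : IsLocalRing.ResidueField R} (hxy : ¬ (x = 0 ∧ y = 0)) :
    ∃ α β, x * β - y * α ≠ 0 ∧ Reduces π s a b c S fun i j k =>
      if i = p then x * u p j k + y * u q j k
      else if i = q then α * u p j k + β * u q j k else u i j k := by
  obtain ⟨α, β, hd⟩ : ∃ α β, x * β - y * α ≠ 0 := by
    by_cases hx : x = 0
    · exact ⟨1, 0, by simpa [hx] using hxy⟩
    · exact ⟨0, 1, by simpa using hx⟩
  refine ⟨α, β, hd, ?_⟩
  have key : ∀ G : Matrix (Fin 3) (Fin 3) (IsLocalRing.ResidueField R),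
      (G = Matrix.of fun i j => if i = p then (if j = p then x else if j = q then y else 0)
        else if i = q then (if j = p then α else if j = q then β else 0)
        else if i = j then 1 else 0) → (G.det ≠ 0) ∧ Cube.act0 G u = fun i j k =>
      if i = p then x * u p j k + y * u q j k
      else if i = q then α * u p j k + β * u q j k else u i j k := by
    rintro G rfl
    constructor
    · rw [Matrix.det_fin_three]
      fin_cases p <;> fin_cases q <;> simp at hpq ⊢ <;> intro h0 <;> apply hd <;>
        linear_combination h0
    · funext i j k
      simp only [Cube.act0, Fin.sum_univ_three, Matrix.of_apply]
      fin_cases p <;> fin_cases q <;> first | exact absurd rfl hpq | skip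
      all_goals fin_cases i <;> simp [add_comm] <;> ring
  obtain ⟨h1, h2⟩ := key _ rfl
  rw [← h2]
  refine h.act0 _ h1 fun i j hij => ?_
  have hij' : i ≠ j := by rintro rfl; exact lt_irrefl _ hij
  rw [Matrix.of_apply]
  split_ifs <;> first | rfl | (subst_vars; omega)

lemma Reduces.mix1 (h : Reduces π s a b c S u) {p q : Fin 3} (hpq : p ≠ q) (hw : b p = b q)
    {x y : IsLocalRing.ResidueField R} (hxy : ¬ (x = 0 ∧ y = 0)) :
    ∃ α β, x * β - y * α ≠ 0 ∧ Reduces π s a b c S fun i j k =>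
      if j = p then x * u i p k + y * u i q k
      else if j = q then α * u i p k + β * u i q k else u i j k := by
  obtain ⟨α, β, hd, hu⟩ := h.sw01.mix0 hpq hw hxy
  exact ⟨α, β, hd, hu.sw01⟩

lemma Reduces.mix2 (h : Reduces π s a b c S u) {p q : Fin 3} (hpq : p ≠ q) (hw : c p = c q)
    {x y : IsLocalRing.ResidueField R} (hxy : ¬ (x = 0 ∧ y = 0)) :
    ∃ α β, x * β - y * α ≠ 0 ∧ Reduces π s a b c S fun i j k =>
      if k = p then x * u i j p + y * u i j q
      else if k = q then α * u i j p + β * u i j q else u i j k := by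
  obtain ⟨α, β, hd, hu⟩ := h.sw12.mix1 hpq hw hxy
  exact ⟨α, β, hd, hu.sw12⟩

end Operations

section Algebra

variable {k : Type*} [Field k]

lemma exists_kernel {p q r s : k} (h : p * s = q * r) :
    ∃ x y : k, ¬ (x = 0 ∧ y = 0) ∧ x * p + y * q = 0 ∧ x * r + y * s = 0 := by
  by_cases h1 : p = 0 ∧ q = 0
  · obtain ⟨rfl, rfl⟩ := h1
    by_cases h2 : r = 0 ∧ s = 0
    · obtain ⟨rfl, rfl⟩ := h2
      exact ⟨1, 0, by simp, by simp, by simp⟩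
    · exact ⟨s, -r, fun h => h2 ⟨by simpa using h.2, h.1⟩, by simp, by ring⟩
  · exact ⟨q, -p, fun h => h1 ⟨by simpa using h.2, h.1⟩, by ring, by linear_combination -h⟩

lemma exists_coeffs_eq {c : Fin 10 → k} (h : HasRepeatedLinearFactor (ternaryCubic c)) :
    ∃ l m : Fin 3 → k, l ≠ 0 ∧ c ≠ 0 ∧ c = sqMulCoeffs l m := by
  obtain ⟨h0, l, hl, hd⟩ := h
  obtain ⟨m, hm⟩ := exists_eq_sqMulCoeffs hd
  exact ⟨l, m, hl, fun hc => h0 ((ternaryCubic_eq_zero_iff c).2 hc), hm⟩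

/-- If the cubic `z (α x z + β y² + γ y z + δ z²)` has a repeated linear factor and `β ≠ 0`, then
`α = 0` and the quadratic form `β y² + γ y z + δ z²` is degenerate. -/
lemma eq_zero_of_hasRepeatedLinearFactor {c : Fin 10 → k}
    (h : HasRepeatedLinearFactor (ternaryCubic c)) (h0 : c 0 = 0) (h1 : c 1 = 0) (h3 : c 3 = 0)
    (h4 : c 4 = 0) (h5 : c 5 = 0) (h9 : c 9 = 0) (h6 : c 6 ≠ 0) :
    c 7 = 0 ∧ c 8 ^ 2 = 4 * c 6 * c 2 := by
  obtain ⟨l, m, -, -, rfl⟩ := exists_coeffs_eq h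
  simp only [sqMulCoeffs, Matrix.cons_val] at *
  have l1 : l 1 ≠ 0 := fun h => h6 (by simp [h])
  have m1 : m 1 = 0 := by simpa [l1] using h1
  have m0 : m 0 = 0 := by simpa [l1, m1] using h5
  have m2 : m 2 ≠ 0 := fun h => h6 (by simp [h, m1])
  have l0 : l 0 = 0 := by simpa [m0, m2] using h4
  simp only [m1, m0, l0]
  constructor <;> ring

end Algebra

section TypeD

variable {R K : Type*} [CommRing R] [IsDomain R] [IsDiscreteValuationRing R]
  [Field K] [Algebra R K] [IsFractionRing R K] {π : R} {S T : Cube R}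

/-- The procedures that use the two slicings other than the special one lower the level. -/
lemma IsTypeD.goodStep (hπ : Irreducible π) {n : ℕ} (h : S.IsTypeD π) : GoodStep K π n S := by
  intro T hT
  obtain ⟨u, hu⟩ := HasWeight.exists_reduces h
  have hz0 : X 2 ^ 2 ∣ u.cubic 0 := X_two_sq_dvd_cubic_zero
    (by simp (disch := decide) [coeffs, mixedDet, rowDet, hu.eq_zero hπ])
  have hz1 : X 2 ^ 2 ∣ u.cubic 1 := X_two_sq_dvd_cubic_one
    (by simp (disch := decide) [coeffs, mixedDet, rowDet, Cube.sw01, hu.eq_zero hπ])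
  rcases hT with hT | hT
  · exact hu.stepI_drop hπ hT hz0 hz1 [] (by simp) ![2, 1, 0] (by decide) (by decide)
  · exact (hu.not_stepII (.inl hz0) hT).elim

variable {u : Cube (IsLocalRing.ResidueField R)}

lemma not_isSaturated_of_weight (hπ : Irreducible π)
    (h : T.HasWeight π 0 ![1, 0, 0] ![0, 0, 0] ![0, 0, 0]) : ¬ T.IsSaturated := by
  intro hs
  obtain ⟨w, hw⟩ := h.exists_reduces
  have := (hw.saturated hs).1 (Pi.single 0 1) fun j k => by
    rw [Fin.sum_univ_three]
    simp only [Pi.single_eq_same, ne_eq, one_ne_zero, not_false_eq_true, Pi.single_eq_of_ne,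
      Fin.reduceEq, zero_mul, add_zero, one_mul]
    refine hw.eq_zero hπ ?_
    fin_cases j <;> fin_cases k <;> simp
  simpa using congr_fun this 0

/-- If the first cubic is divisible by `z²`, then procedure (i) leads to a cube whose first slice
vanishes. -/
lemma Reduces.stepI_typeD_of_eq_zero (hπ : Irreducible π)
    (hu : Reduces π 2 ![2, 1, 0] ![1, 1, 0] ![1, 1, 0] S u) (hT : StepI K π 0 1 S T)
    (h6 : u.coeffs 6 = 0) : ∃ r, LevelRatio K S T r ∧ (IsUnit r → ¬ T.IsSaturated) := by
  have hz0 : X 2 ^ 2 ∣ u.cubic 0 := X_two_sq_dvd_cubic_zero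
    ⟨by simp (disch := decide) [coeffs, mixedDet, rowDet, hu.eq_zero hπ],
      by simp (disch := decide) [coeffs, mixedDet, rowDet, hu.eq_zero hπ],
      by simp (disch := decide) [coeffs, mixedDet, rowDet, hu.eq_zero hπ],
      by simp (disch := decide) [coeffs, mixedDet, rowDet, hu.eq_zero hπ],
      by simp (disch := decide) [coeffs, mixedDet, rowDet, hu.eq_zero hπ], h6,
      by simp (disch := decide) [coeffs, mixedDet, rowDet, hu.eq_zero hπ]⟩
  have hz1 : X 2 ^ 2 ∣ u.cubic 1 := X_two_sq_dvd_cubic_one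
    (by simp (disch := decide) [coeffs, mixedDet, rowDet, Cube.sw01, hu.eq_zero hπ])
  obtain ⟨r, hr, hr'⟩ := hu.stepI hπ hT hz0 hz1 [] (by simp) ![1, 1, 0] (by decide) (by decide)
    (s' := 0) (a' := ![1, 0, 0]) (b' := ![0, 0, 0]) (c' := ![0, 0, 0]) (by decide)
  refine ⟨r, hr, fun hru => ?_⟩
  obtain ⟨-, w, hw, -⟩ := hr' hru
  exact not_isSaturated_of_weight hπ hw.toHasWeight

lemma swap_weights (x y z : ℕ) : ![x, y, z] ∘ (Equiv.swap 1 2 : Equiv.Perm (Fin 3)) = ![x, z, y] := by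
  funext i
  fin_cases i <;> rfl

/-- Procedure (i) for weights of type D, with the special slicing in the first place: if the level
stays the same and the new cube is saturated, then the coefficient of `x z²` in the first cubic
vanishes, and the new cube has weights of type A, up to permutations. -/
lemma Reduces.stepI_typeD (hπ : Irreducible π) (hsat : S.IsSaturated)
    (hu : Reduces π 2 ![2, 1, 0] ![1, 1, 0] ![1, 1, 0] S u) (hT : StepI K π 0 1 S T) :
    ∃ r, LevelRatio K S T r ∧ (IsUnit r → T.IsSaturated →
      u 0 2 2 * (u 2 0 0 * u 2 1 1 - u 2 0 1 * u 2 1 0) = 0 ∧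
      T.HasWeight π 1 ![1, 0, 1] ![0, 0, 0] ![1, 1, 0]) := by
  -- the shape of the first cubic in any frame of this type
  have shape : ∀ w, Reduces π 2 ![2, 1, 0] ![1, 1, 0] ![1, 1, 0] S w → w.coeffs 6 ≠ 0 →
      w.coeffs 7 = 0 ∧ w.coeffs 8 ^ 2 = 4 * w.coeffs 6 * w.coeffs 2 := by
    intro w hw h6
    have := (hw.hasRepeatedLinearFactor hT).1
    rw [cubic_zero_eq_ternaryCubic] at this
    exact eq_zero_of_hasRepeatedLinearFactor this
      (by simp (disch := decide) [coeffs, mixedDet, rowDet, hw.eq_zero hπ])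
      (by simp (disch := decide) [coeffs, mixedDet, rowDet, hw.eq_zero hπ])
      (by simp (disch := decide) [coeffs, mixedDet, rowDet, hw.eq_zero hπ])
      (by simp (disch := decide) [coeffs, mixedDet, rowDet, hw.eq_zero hπ])
      (by simp (disch := decide) [coeffs, mixedDet, rowDet, hw.eq_zero hπ])
      (by simp (disch := decide) [coeffs, mixedDet, rowDet, hw.eq_zero hπ]) h6
  by_cases h6 : u.coeffs 6 = 0
  · obtain ⟨r, hr, hr'⟩ := hu.stepI_typeD_of_eq_zero hπ hT h6
    exact ⟨r, hr, fun h1 h2 => absurd h2 (hr' h1)⟩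
  have hdet : u 0 2 2 * (u 2 0 0 * u 2 1 1 - u 2 0 1 * u 2 1 0) = 0 := by
    have := (shape u hu h6).1
    simp (disch := decide) [coeffs, mixedDet, rowDet, hu.eq_zero hπ] at this
    linear_combination this
  suffices ∃ r, LevelRatio K S T r ∧ (IsUnit r → T.IsSaturated →
      T.HasWeight π 1 ![1, 0, 1] ![0, 0, 0] ![1, 1, 0]) by
    obtain ⟨r, hr, hr'⟩ := this
    exact ⟨r, hr, fun h1 h2 => ⟨hdet, hr' h1 h2⟩⟩
  have h022 : u 0 2 2 ≠ 0 := by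
    intro h0
    have := (hu.saturated hsat).1 (Pi.single 0 1) fun j k => by
      fin_cases j <;> fin_cases k <;> simp (disch := decide) [Fin.sum_univ_three, hu.eq_zero hπ, h0]
    simpa using congr_fun this 0
  have hdet' := (mul_eq_zero.1 hdet).resolve_left h022
  obtain ⟨x, y, hxy, e0, e1⟩ := exists_kernel (sub_eq_zero.1 hdet')
  -- a first change of basis, in the last slicing, makes a column of the block vanish
  obtain ⟨α, β, -, hv⟩ := hu.mix2 (p := 0) (q := 1) (by decide) rfl hxy
  set v : Cube (IsLocalRing.ResidueField R) := _ with hvdef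
  change Reduces _ _ _ _ _ _ v at hv
  have v200 : v 2 0 0 = 0 := by simpa [hvdef] using e0
  have v210 : v 2 1 0 = 0 := by simpa [hvdef] using e1
  clear_value v
  by_cases g6 : v.coeffs 6 = 0
  · obtain ⟨r, hr, hr'⟩ := hv.stepI_typeD_of_eq_zero hπ hT g6
    exact ⟨r, hr, fun h1 h2 => absurd h2 (hr' h1)⟩
  have hq := (shape v hv g6).2
  have c6 : v.coeffs 6 = v 1 2 0 * (v 2 0 1 * v 1 1 2 - v 2 1 1 * v 1 0 2) := by
    simp (disch := decide) [coeffs, mixedDet, rowDet, hv.eq_zero hπ, v200, v210]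
    ring
  have c8 : v.coeffs 8 = v 1 2 0 * (v 2 0 1 * v 2 1 2 - v 2 1 1 * v 2 0 2)
      + v 2 2 0 * (v 2 0 1 * v 1 1 2 - v 2 1 1 * v 1 0 2) := by
    simp (disch := decide) [coeffs, mixedDet, rowDet, hv.eq_zero hπ, v200, v210]
    ring
  have c2 : v.coeffs 2 = v 2 2 0 * (v 2 0 1 * v 2 1 2 - v 2 1 1 * v 2 0 2) := by
    simp [coeffs, mixedDet, rowDet, v200, v210]
    ring
  rw [c6] at g6
  obtain ⟨g1, g2⟩ := mul_ne_zero_iff.1 g6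
  have hlin : v 1 2 0 * (v 2 0 1 * v 2 1 2 - v 2 1 1 * v 2 0 2)
      = v 2 2 0 * (v 2 0 1 * v 1 1 2 - v 2 1 1 * v 1 0 2) := by
    rw [c2, c6, c8] at hq
    rw [← sub_eq_zero, ← sq_eq_zero_iff]
    linear_combination hq
  -- a second one, in the first slicing, makes the double line of the first cubic equal to `y = 0`
  have hw := hv.add0 (p := 2) (q := 1) (by decide) (by decide) (-(v 2 2 0 / v 1 2 0))
  set w : Cube (IsLocalRing.ResidueField R) := _ with hwdef
  change Reduces _ _ _ _ _ _ w at hw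
  have w200 : w 2 0 0 = 0 := by simp (disch := decide) [hwdef, v200, hv.eq_zero hπ]
  have w210 : w 2 1 0 = 0 := by simp (disch := decide) [hwdef, v210, hv.eq_zero hπ]
  have w201 : w 2 0 1 = v 2 0 1 := by simp (disch := decide) [hwdef, hv.eq_zero hπ]
  have w211 : w 2 1 1 = v 2 1 1 := by simp (disch := decide) [hwdef, hv.eq_zero hπ]
  have hw2 : w 2 0 1 * w 2 1 2 = w 2 1 1 * w 2 0 2 := by
    rw [w201, w211]
    simp only [hwdef, if_true]
    field_simp
    linear_combination hlin
  have hρ : ¬ (w 2 0 1 = 0 ∧ w 2 1 1 = 0) := by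
    rw [w201, w211]
    rintro ⟨h1, h2⟩
    exact g2 (by rw [h1, h2]; ring)
  have w220 : w 2 2 0 = 0 := by
    simp only [hwdef, if_true]
    field_simp
    ring
  clear_value w
  -- a third one, in the last slicing, makes a further column vanish
  obtain ⟨t, ht0, ht1⟩ : ∃ t, w 2 0 2 + t * w 2 0 1 = 0 ∧ w 2 1 2 + t * w 2 1 1 = 0 := by
    by_cases h0 : w 2 0 1 = 0
    · have h1 : w 2 1 1 ≠ 0 := fun h => hρ ⟨h0, h⟩
      refine ⟨-(w 2 1 2 / w 2 1 1), ?_, by field_simp; ring⟩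
      rw [h0, zero_mul] at hw2
      simpa [h0, h1] using hw2.symm
    · refine ⟨-(w 2 0 2 / w 2 0 1), by field_simp; ring, ?_⟩
      field_simp
      linear_combination hw2
  have hz := hw.add2 (p := 2) (q := 1) (by decide) (by decide) t
  set z : Cube (IsLocalRing.ResidueField R) := _ with hzdef
  change Reduces _ _ _ _ _ _ z at hz
  have z200 : z 2 0 0 = 0 := by simp [hzdef, w200]
  have z210 : z 2 1 0 = 0 := by simp [hzdef, w210]
  have z220 : z 2 2 0 = 0 := by simp [hzdef, w220]
  have z202 : z 2 0 2 = 0 := by simpa [hzdef] using ht0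
  have z212 : z 2 1 2 = 0 := by simpa [hzdef] using ht1
  clear_value z
  have hz' := hz.perm (Equiv.swap 1 2) 1 1
  rw [swap_weights] at hz'
  have s1 : (Equiv.swap 1 2 : Equiv.Perm (Fin 3)) 1 = 2 := by decide
  have s2 : (Equiv.swap 1 2 : Equiv.Perm (Fin 3)) 2 = 1 := by decide
  have s0 : (Equiv.swap 1 2 : Equiv.Perm (Fin 3)) 0 = 0 := by decide
  obtain ⟨r, hr, hr'⟩ := hz'.stepI hπ hT
    (X_two_sq_dvd_cubic_zero (by
      simp (disch := decide) [coeffs, mixedDet, rowDet, s0, s1, s2, hz.eq_zero hπ, z200, z210, z220, z202, z212]))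
    (X_two_sq_dvd_cubic_one (by
      simp (disch := decide) [coeffs, mixedDet, rowDet, Cube.sw01, s0, s1, s2, hz.eq_zero hπ]))
    [(1, 0, 0), (1, 1, 0), (1, 0, 2), (1, 1, 2)] (by simp [s1, z200, z210, z202, z212])
    ![1, 0, 1] (by decide) (by decide)
    (s' := 1) (a' := ![1, 0, 1]) (b' := ![0, 0, 0]) (c' := ![1, 1, 0]) (by decide)
  refine ⟨r, hr, fun hru _ => ?_⟩
  obtain ⟨-, w, hw, -⟩ := hr' hru
  exact hw.toHasWeight

end TypeD

end Cube

/-! ### Weights of types D and B -/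

namespace Cube

section TypeDGood

/-- Weights of type A, up to permutations of the indices, for the special slicing in the second
place. -/
lemma upToSlots_isTypeA_of_hasWeight {R : Type*} [CommRing R] {π : R} {T : Cube R}
    (h : T.HasWeight π 1 ![1, 0, 1] ![0, 0, 0] ![1, 1, 0]) :
    UpToSlots (IsTypeA π) T := by
  have := h.perm (Equiv.swap 1 2) 1 1
  rw [swap_weights] at this
  exact .inr (.inl (HasWeight.sw12 this))

variable {R K : Type*} [CommRing R] [IsDomain R] [IsDiscreteValuationRing R]
  [Field K] [Algebra R K] [IsFractionRing R K] {π : R} {S T : Cube R}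

lemma good_of_isTypeD (hπ : Irreducible π) (hsat : S.IsSaturated) (h : UpToSlots (IsTypeD π) S) :
    Good K π 2 S := by
  have h' : UpToSlots (fun S => S.IsSaturated ∧ IsTypeD π S) S :=
    h.imp (fun h => ⟨hsat, h⟩) fun h => h.imp (fun h => ⟨hsat.sw12, h⟩)
      fun h => ⟨hsat.sw01.sw12, h⟩
  refine h'.good (fun S h => ⟨h.1.sw01, h.2.sw01⟩) (fun S h => h.2.goodStep hπ) fun S h T hT => ?_
  obtain ⟨u, hu⟩ := (HasWeight.sw12 h.2).sw01.exists_reduces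
  have hz1 : X 2 ^ 2 ∣ u.cubic 1 := X_two_sq_dvd_cubic_one
    (by simp (disch := decide) [coeffs, mixedDet, rowDet, Cube.sw01, hu.eq_zero hπ])
  rcases hT with hT | hT
  · obtain ⟨r, hr, hr'⟩ := hu.stepI_typeD hπ h.1.sw12.sw01 hT
    exact ⟨r, hr, fun h1 h2 => good_of_isTypeA hπ (upToSlots_isTypeA_of_hasWeight (hr' h1 h2).2)⟩
  · exact (hu.not_stepII (.inr hz1) hT).elim

/-- A saturated cube with weights of type D for which, in some adapted basis, the cubic of the
special slicing has a non-zero coefficient of `x z²`. -/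
def IsStrictTypeD (π : R) (S : Cube R) : Prop :=
  S.IsSaturated ∧ ∃ u, Reduces π 2 ![1, 1, 0] ![1, 1, 0] ![2, 1, 0] S u ∧
    u 2 2 0 * (u 0 0 2 * u 1 1 2 - u 0 1 2 * u 1 0 2) ≠ 0

/-- By `Reduces.stepI_typeD` the level can stay the same only if the coefficient of `x z²` vanishes. -/
lemma good_of_isStrictTypeD (hπ : Irreducible π) (h : IsStrictTypeD π S) : Good K π 1 S := by
  refine UpToSlots.good (P := IsStrictTypeD π) ?_ ?_ ?_ (.inl h)
  · rintro S ⟨hs, u, hu, h⟩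
    refine ⟨hs.sw01, u.sw01, hu.sw01, ?_⟩
    rwa [mul_comm (u 0 1 2)] at h
  · rintro S ⟨hs, u, hu, h⟩
    exact IsTypeD.goodStep hπ hu.toHasWeight
  · rintro S ⟨hs, u, hu', h⟩ T hT
    have hu := hu'.sw12.sw01
    have hz1 : X 2 ^ 2 ∣ u.sw12.sw01.cubic 1 := X_two_sq_dvd_cubic_one
      (by simp (disch := decide) [coeffs, mixedDet, rowDet, Cube.sw01, Cube.sw12, hu'.eq_zero hπ])
    rcases hT with hT | hT
    · obtain ⟨r, hr, hr'⟩ := hu.stepI_typeD hπ hs.sw12.sw01 hT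
      exact ⟨r, hr, fun h1 h2 => absurd (hr' h1 h2).1 h⟩
    · exact (hu.not_stepII (.inr hz1) hT).elim

end TypeDGood

section Lines

variable {k : Type*} [Field k]

lemma cubic_zero_act0 (G : Matrix (Fin 3) (Fin 3) k) (u : Cube k) :
    (Cube.act0 G u).cubic 0 = linSubst G (u.cubic 0) := by
  have := cubic_zero_act ![G, 1, 1] u
  rw [act_eq] at this
  change (Cube.act0 G (Cube.act1 1 (Cube.act2 1 u))).cubic 0
    = C ((1 : Matrix (Fin 3) (Fin 3) k).det * (1 : Matrix (Fin 3) (Fin 3) k).det)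
      * linSubst G (u.cubic 0) at this
  rw [act1_one, act2_one] at this
  simpa using this

lemma cubic_one_act0 (G : Matrix (Fin 3) (Fin 3) k) (u : Cube k) :
    (Cube.act0 G u).cubic 1 = C G.det * u.cubic 1 := by
  have := cubic_zero_act ![1, G, 1] u.sw01
  rw [act_eq] at this
  change (Cube.act0 1 (Cube.act1 G (Cube.act2 1 u.sw01))).cubic 0
    = C (G.det * (1 : Matrix (Fin 3) (Fin 3) k).det)
      * linSubst 1 (u.sw01.cubic 0) at this
  rw [act0_one, act2_one, linSubst_one, ← cubic_sw01 _ 0, Matrix.det_one, mul_one] at this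
  rw [show u.cubic 1 = u.sw01.cubic 0 from (cubic_sw01 u 1).symm, ← this]
  rfl

variable {R : Type*} [CommRing R] [IsLocalRing R] {π : R} {s : ℕ} {a b c : Fin 3 → ℕ} {S : Cube R}
  {u : Cube (IsLocalRing.ResidueField R)}

/-- A double line through `(1 : 0 : 0)` of the first cubic can be moved to `z = 0`, if the two last
slices have the same weight. -/
lemma Reduces.exists_sq_dvd_zero (h : Reduces π s a b c S u) (ha : a 1 = a 2)
    {l : Fin 3 → IsLocalRing.ResidueField R} (hl : l 0 = 0)
    (hd : (∑ t, C (l t) * X t) ^ 2 ∣ u.cubic 0) : ∃ w, Reduces π s a b c S w ∧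
      X 2 ^ 2 ∣ w.cubic 0 ∧ ∀ F, F ∣ u.cubic 1 → F ∣ w.cubic 1 := by
  obtain ⟨G, hG, h0, h1, hw⟩ : ∃ G : Matrix (Fin 3) (Fin 3) (IsLocalRing.ResidueField R),
      G.det ≠ 0 ∧ G.mulVec l 0 = 0 ∧ G.mulVec l 1 = 0 ∧ ∀ i j, a j < a i → G i j = 0 := by
    by_cases h1 : l 1 = 0
    · refine ⟨1, by simp, by simpa using hl, by simpa using h1, fun i j hij => ?_⟩
      exact Matrix.one_apply_ne (by rintro rfl; exact lt_irrefl _ hij)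
    · refine ⟨!![1, 0, 0; 0, l 2, -l 1; 0, 1, 0], by simpa [Matrix.det_fin_three] using h1,
        by simpa [Matrix.mulVec, dotProduct, Fin.sum_univ_three] using hl,
        by simp [Matrix.mulVec, dotProduct, Fin.sum_univ_three]; ring, fun i j hij => ?_⟩
      fin_cases i <;> fin_cases j <;> simp at hij ⊢ <;> omega
  refine ⟨Cube.act0 G u, h.act0 G hG hw, ?_, fun F hF => ?_⟩
  · have := map_dvd (linSubst G) hd
    rw [map_pow, linSubst_linear, ← cubic_zero_act0] at this
    refine dvd_trans ?_ this
    apply pow_dvd_pow_of_dvd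
    rw [Fin.sum_univ_three, h0, h1]
    simp
  · rw [cubic_one_act0]
    exact hF.mul_left _

lemma Reduces.exists_sq_dvd_one (h : Reduces π s a b c S u) (hb : b 1 = b 2)
    {l : Fin 3 → IsLocalRing.ResidueField R} (hl : l 0 = 0)
    (hd : (∑ t, C (l t) * X t) ^ 2 ∣ u.cubic 1) : ∃ w, Reduces π s a b c S w ∧
      X 2 ^ 2 ∣ w.cubic 1 ∧ ∀ F, F ∣ u.cubic 0 → F ∣ w.cubic 0 := by
  obtain ⟨w, hw, h1, h2⟩ := h.sw01.exists_sq_dvd_zero hb hl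
    (by rwa [show u.sw01.cubic 0 = u.cubic 1 from cubic_sw01 u 1])
  refine ⟨w.sw01, hw.sw01, ?_, fun F hF => ?_⟩
  · rwa [show w.sw01.cubic 1 = w.cubic 0 from cubic_sw01 w 0]
  · rw [show w.sw01.cubic 0 = w.cubic 1 from cubic_sw01 w 1]
    exact h2 F (by rwa [show u.sw01.cubic 1 = u.cubic 0 from cubic_sw01 u 0])

/-- A double line of a cubic that is singular at `(1 : 0 : 0)` passes through that point. -/
lemma exists_line {c : Fin 10 → k} (h : HasRepeatedLinearFactor (ternaryCubic c)) (h0 : c 0 = 0)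
    (h3 : c 3 = 0) (h4 : c 4 = 0) : ∃ l : Fin 3 → k, l 0 = 0 ∧
      (∑ t, C (l t) * X t) ^ 2 ∣ ternaryCubic c := by
  obtain ⟨l, m, -, hc, rfl⟩ := exists_coeffs_eq h
  refine ⟨l, ?_, ?_⟩
  · by_contra hl
    simp only [sqMulCoeffs, Matrix.cons_val] at h0 h3 h4
    have m0 : m 0 = 0 := by simpa [hl] using h0
    have m1 : m 1 = 0 := by simpa [hl, m0] using h3
    have m2 : m 2 = 0 := by simpa [hl, m0] using h4
    apply hc
    funext t
    fin_cases t <;> simp [sqMulCoeffs, m0, m1, m2]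
  · exact ⟨_, ternaryCubic_sqMulCoeffs l m⟩

lemma coeffs_eq_zero_of_sq_dvd {v : Cube k} (h : X 2 ^ 2 ∣ v.cubic 0) :
    v.coeffs 1 = 0 ∧ v.coeffs 6 = 0 := by
  rw [cubic_zero_eq_ternaryCubic, X_two_sq_dvd_iff] at h
  exact ⟨h.2.1, h.2.2.2.2.2.1⟩

end Lines

section TypeB

/-- The algebra of type B. Here `Y₁ y + Y₂ z` and `Z₁ y + Z₂ z` are linear factors of the first two
cubics. The other factors are binary quadratic forms, given by the determinants of two pencils. -/
lemma typeB_eq_zero {k : Type*} [Field k] {p q r s t v x y Y₁ Y₂ Z₁ Z₂ : k}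
    (h1 : Y₁ * (p * s - q * r) = 0)
    (h2 : Y₁ * (p * y - q * x + t * s - v * r) + Y₂ * (p * s - q * r) = 0)
    (h3 : Z₁ * (p * v - q * t) = 0)
    (h4 : Z₁ * (p * y - q * x + r * v - s * t) + Z₂ * (p * v - q * t) = 0)
    (hpq : ¬ (p = 0 ∧ q = 0)) (hY : ¬ (Y₁ = 0 ∧ Y₂ = 0)) (hZ : ¬ (Z₁ = 0 ∧ Z₂ = 0))
    (hf : ¬ (p * s - q * r = 0 ∧ p * y - q * x + t * s - v * r = 0 ∧ t * y - v * x = 0)) :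
    Y₁ = 0 ∧ p * s = q * r := by
  by_cases hY1 : Y₁ = 0
  · have hY2 : Y₂ ≠ 0 := fun h => hY ⟨hY1, h⟩
    exact ⟨hY1, by simpa [hY1, hY2, sub_eq_zero] using h2⟩
  · exfalso
    have d1 : p * s - q * r = 0 := (mul_eq_zero.1 h1).resolve_left hY1
    have d2 : p * y - q * x + t * s - v * r = 0 := by simpa [d1, hY1] using h2
    -- otherwise the second cubic vanishes
    have d3 : p * v - q * t = 0 := by
      by_contra hne
      have hZ1 : Z₁ = 0 := (mul_eq_zero.1 h3).resolve_right hne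
      have hZ2 : Z₂ = 0 := by simpa [hZ1, hne] using h4
      exact hZ ⟨hZ1, hZ2⟩
    refine hf ⟨d1, d2, ?_⟩
    by_cases hp : p = 0
    · have hq : q ≠ 0 := fun h => hpq ⟨hp, h⟩
      have e : t * s - v * r = 0 := (mul_eq_zero.1 (show q * (t * s - v * r) = 0 by
        linear_combination v * d1 - s * d3)).resolve_left hq
      exact (mul_eq_zero.1 (show q * (t * y - v * x) = 0 by
        linear_combination v * d2 - y * d3 - v * e)).resolve_left hq
    · have e : t * s - v * r = 0 := (mul_eq_zero.1 (show p * (t * s - v * r) = 0 by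
        linear_combination t * d1 - r * d3)).resolve_left hp
      exact (mul_eq_zero.1 (show p * (t * y - v * x) = 0 by
        linear_combination t * d2 - x * d3 - t * e)).resolve_left hp

variable {R K : Type*} [CommRing R] [IsDomain R] [IsDiscreteValuationRing R]
  [Field K] [Algebra R K] [IsFractionRing R K] {π : R} {S T : Cube R}
  {u : Cube (IsLocalRing.ResidueField R)}

/-- For weights of type B the first cubic is the product of the linear form `u₁₀₂ y + u₂₀₂ z` and a
binary quadratic form in `y`, `z`. -/
lemma Reduces.coeffs_typeB (hπ : Irreducible π)
    (hu : Reduces π 1 ![1, 0, 0] ![1, 0, 0] ![1, 1, 0] S u) : u.coeffs =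
      ![0, u 1 0 2 * (u 1 1 0 * u 1 2 1 - u 1 1 1 * u 1 2 0),
        u 2 0 2 * (u 2 1 0 * u 2 2 1 - u 2 1 1 * u 2 2 0), 0, 0, 0,
        u 1 0 2 * (u 1 1 0 * u 2 2 1 - u 1 1 1 * u 2 2 0 + u 2 1 0 * u 1 2 1 - u 2 1 1 * u 1 2 0)
          + u 2 0 2 * (u 1 1 0 * u 1 2 1 - u 1 1 1 * u 1 2 0), 0,
        u 2 0 2 * (u 1 1 0 * u 2 2 1 - u 1 1 1 * u 2 2 0 + u 2 1 0 * u 1 2 1 - u 2 1 1 * u 1 2 0)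
          + u 1 0 2 * (u 2 1 0 * u 2 2 1 - u 2 1 1 * u 2 2 0), 0] := by
  have z : ∀ j, u 0 0 j = 0 := fun j => by
    fin_cases j <;> exact hu.eq_zero hπ (by decide)
  have z010 : u 0 1 0 = 0 := hu.eq_zero hπ (by decide)
  have z011 : u 0 1 1 = 0 := hu.eq_zero hπ (by decide)
  have z020 : u 0 2 0 = 0 := hu.eq_zero hπ (by decide)
  have z021 : u 0 2 1 = 0 := hu.eq_zero hπ (by decide)
  have z100 : u 1 0 0 = 0 := hu.eq_zero hπ (by decide)
  have z101 : u 1 0 1 = 0 := hu.eq_zero hπ (by decide)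
  have z200 : u 2 0 0 = 0 := hu.eq_zero hπ (by decide)
  have z201 : u 2 0 1 = 0 := hu.eq_zero hπ (by decide)
  simp only [coeffs, mixedDet, rowDet, z, z010, z011, z020, z021, z100, z101, z200, z201]
  congr! 1
  · ring
  · funext t
    fin_cases t <;> simp <;> ring

/-- The conditions on the two factors that express that the first cubic is non-zero and divisible by
`z²`. -/
lemma Reduces.typeB_facts (hπ : Irreducible π)
    (hu : Reduces π 1 ![1, 0, 0] ![1, 0, 0] ![1, 1, 0] S u) (h0 : u.cubic 0 ≠ 0)
    (hd : X 2 ^ 2 ∣ u.cubic 0) :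
    u 1 0 2 * (u 1 1 0 * u 1 2 1 - u 1 1 1 * u 1 2 0) = 0 ∧
    u 1 0 2 * (u 1 1 0 * u 2 2 1 - u 1 1 1 * u 2 2 0 + u 2 1 0 * u 1 2 1 - u 2 1 1 * u 1 2 0)
          + u 2 0 2 * (u 1 1 0 * u 1 2 1 - u 1 1 1 * u 1 2 0) = 0 ∧
    ¬ (u 1 0 2 = 0 ∧ u 2 0 2 = 0) ∧
    ¬ (u 1 1 0 * u 1 2 1 - u 1 1 1 * u 1 2 0 = 0 ∧ u 1 1 0 * u 2 2 1 - u 1 1 1 * u 2 2 0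
      + u 2 1 0 * u 1 2 1 - u 2 1 1 * u 1 2 0 = 0 ∧
      u 2 1 0 * u 2 2 1 - u 2 1 1 * u 2 2 0 = 0) := by
  rw [cubic_zero_eq_ternaryCubic, ne_eq, ternaryCubic_eq_zero_iff] at h0
  obtain ⟨h1, h6⟩ := coeffs_eq_zero_of_sq_dvd hd
  rw [hu.coeffs_typeB hπ] at h0 h1 h6
  refine ⟨h1, h6, ?_, ?_⟩
  · rintro ⟨e1, e2⟩
    apply h0
    rw [e1, e2]
    funext t
    fin_cases t <;> simp
  · rintro ⟨e1, e2, e3⟩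
    apply h0
    rw [e1, e2, e3]
    funext t
    fin_cases t <;> simp

/-- Procedure (i) for weights of type B, with the special slicing in the last place: unless the level
drops, the new cube has weights of type A, or of type D with the additional property that lets the
next procedure lower the level. -/
lemma Reduces.stepI_typeB (hπ : Irreducible π)
    (hu : Reduces π 1 ![1, 0, 0] ![1, 0, 0] ![1, 1, 0] S u) (hT : StepI K π 0 1 S T) :
    ∃ r, LevelRatio K S T r ∧ (IsUnit r → T.IsSaturated → Good K π 1 T) := by
  obtain ⟨w, hw, hw0, hw1⟩ : ∃ w, Reduces π 1 ![1, 0, 0] ![1, 0, 0] ![1, 1, 0] S w ∧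
      X 2 ^ 2 ∣ w.cubic 0 ∧ X 2 ^ 2 ∣ w.cubic 1 := by
    have h0 := (hu.hasRepeatedLinearFactor hT).1
    rw [cubic_zero_eq_ternaryCubic] at h0
    obtain ⟨l, hl, hd⟩ := exists_line h0
      (by simp (disch := decide) [coeffs, mixedDet, rowDet, hu.eq_zero hπ])
      (by simp (disch := decide) [coeffs, mixedDet, rowDet, hu.eq_zero hπ])
      (by simp (disch := decide) [coeffs, mixedDet, rowDet, hu.eq_zero hπ])
    rw [← cubic_zero_eq_ternaryCubic] at hd
    obtain ⟨v, hv, hv0, -⟩ := hu.exists_sq_dvd_zero rfl hl hd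
    have h1 := (hv.hasRepeatedLinearFactor hT).2
    rw [cubic_one_eq_ternaryCubic] at h1
    obtain ⟨l, hl, hd⟩ := exists_line h1
      (by simp (disch := decide) [coeffs, mixedDet, rowDet, Cube.sw01, hv.eq_zero hπ])
      (by simp (disch := decide) [coeffs, mixedDet, rowDet, Cube.sw01, hv.eq_zero hπ])
      (by simp (disch := decide) [coeffs, mixedDet, rowDet, Cube.sw01, hv.eq_zero hπ])
    rw [← cubic_one_eq_ternaryCubic] at hd
    obtain ⟨w, hw, hw1, hw0⟩ := hv.exists_sq_dvd_one rfl hl hd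
    exact ⟨w, hw, hw0 _ hv0, hw1⟩
  by_cases hA : w 1 1 0 = 0 ∧ w 1 1 1 = 0
  · refine hw.stepI_good hπ hT hw0 hw1 [(1, 1, 0), (1, 1, 1)] (by simp [hA]) ![1, 1, 0]
      (by decide) (by decide) 1 ![1, 0, 1] ![1, 0, 1] ![0, 0, 0] (by decide) fun h _ => ?_
    have := h.perm (Equiv.swap 1 2) (Equiv.swap 1 2) 1
    rw [swap_weights] at this
    exact good_of_isTypeA hπ (.inl this)
  obtain ⟨a1, a6, hY, hq0⟩ := hw.typeB_facts hπ (hw.hasRepeatedLinearFactor hT).1.1 hw0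
  obtain ⟨b1, b6, hZ, hq1⟩ := hw.sw01.typeB_facts hπ
    (by rw [show w.sw01.cubic 0 = w.cubic 1 from cubic_sw01 w 1]
        exact (hw.hasRepeatedLinearFactor hT).2.1)
    (by rwa [show w.sw01.cubic 0 = w.cubic 1 from cubic_sw01 w 1])
  simp only [Cube.sw01] at b1 b6 hZ hq1
  obtain ⟨w102, d0⟩ := typeB_eq_zero a1 a6 b1 b6 hA hY hZ hq0
  obtain ⟨w012, d1⟩ := typeB_eq_zero b1 b6 a1 a6 hA hZ hY hq1
  have w202 : w 2 0 2 ≠ 0 := fun h => hY ⟨w102, h⟩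
  have w022 : w 0 2 2 ≠ 0 := fun h => hZ ⟨w012, h⟩
  -- normalize the two first columns, then the last one
  obtain ⟨α, β, hαβ, hv⟩ := hw.mix2 (p := 1) (q := 0) (by decide) rfl (x := w 1 1 0)
    (y := -w 1 1 1) (fun h => hA ⟨h.1, by simpa using h.2⟩)
  set v : Cube (IsLocalRing.ResidueField R) := _ with hvdef
  change Reduces _ _ _ _ _ _ v at hv
  have v110 : v 1 1 0 ≠ 0 := by
    have : v 1 1 0 = w 1 1 0 * β - -w 1 1 1 * α := by simp [hvdef]; ring
    rwa [this]
  have v111 : v 1 1 1 = 0 := by simp [hvdef]; ring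
  have v121 : v 1 2 1 = 0 := by simp [hvdef]; linear_combination d0
  have v211 : v 2 1 1 = 0 := by simp [hvdef]; linear_combination d1
  have v102 : v 1 0 2 = 0 := by simpa [hvdef] using w102
  have v012 : v 0 1 2 = 0 := by simpa [hvdef] using w012
  have v202 : v 2 0 2 ≠ 0 := by simpa [hvdef] using w202
  have v022 : v 0 2 2 ≠ 0 := by simpa [hvdef] using w022
  clear_value v
  have hz := hv.add2 (p := 2) (q := 0) (by decide) (by decide) (-(v 1 1 2 / v 1 1 0))
  set z : Cube (IsLocalRing.ResidueField R) := _ with hzdef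
  change Reduces _ _ _ _ _ _ z at hz
  have z110 : z 1 1 0 ≠ 0 := by simpa [hzdef] using v110
  have z111 : z 1 1 1 = 0 := by simpa [hzdef] using v111
  have z121 : z 1 2 1 = 0 := by simpa [hzdef] using v121
  have z211 : z 2 1 1 = 0 := by simpa [hzdef] using v211
  have z112 : z 1 1 2 = 0 := by simp [hzdef]; field_simp; ring
  have z102 : z 1 0 2 = 0 := by simp (disch := decide) [hzdef, v102, hv.eq_zero hπ]
  have z012 : z 0 1 2 = 0 := by simp (disch := decide) [hzdef, v012, hv.eq_zero hπ]
  have z202 : z 2 0 2 ≠ 0 := by simpa (disch := decide) [hzdef, hv.eq_zero hπ] using v202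
  have z022 : z 0 2 2 ≠ 0 := by simpa (disch := decide) [hzdef, hv.eq_zero hπ] using v022
  clear_value z
  obtain ⟨r, hr, hr'⟩ := hz.stepI hπ hT
    (X_two_sq_dvd_cubic_zero (by
      simp (disch := decide) [coeffs, mixedDet, rowDet, hz.eq_zero hπ, z111, z121, z211, z102]))
    (X_two_sq_dvd_cubic_one (by
      simp (disch := decide) [coeffs, mixedDet, rowDet, Cube.sw01, hz.eq_zero hπ, z111, z121, z211,
        z012]))
    [(1, 0, 2), (0, 1, 2), (1, 1, 1), (1, 1, 2), (1, 2, 1), (2, 1, 1)]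
    (by simp [z102, z012, z111, z112, z121, z211]) ![0, 1, 1] (by decide) (by decide)
    (s' := 2) (a' := ![1, 0, 1]) (b' := ![1, 0, 1]) (c' := ![2, 1, 0]) (by decide)
  refine ⟨r, hr, fun hru hs => ?_⟩
  obtain ⟨-, y, hy, hyz, hy0⟩ := hr' hru
  have hp := hy.perm (Equiv.swap 1 2) (Equiv.swap 1 2) 1
  rw [swap_weights] at hp
  refine good_of_isStrictTypeD hπ ⟨hs, _, hp, ?_⟩
  have s1 : (Equiv.swap 1 2 : Equiv.Perm (Fin 3)) 1 = 2 := by decide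
  have s2 : (Equiv.swap 1 2 : Equiv.Perm (Fin 3)) 2 = 1 := by decide
  have s0 : (Equiv.swap 1 2 : Equiv.Perm (Fin 3)) 0 = 0 := by decide
  simp only [s0, s1, s2, Equiv.Perm.coe_one, id]
  rw [hyz 1 1 0 (by decide), hyz 0 2 2 (by decide), hyz 2 0 2 (by decide), hy0 2 2 2 (by decide)]
  simp [z110, z022, z202]

lemma Reduces.sw01_coeffs_one_typeB (hπ : Irreducible π)
    (hu : Reduces π 1 ![1, 1, 0] ![1, 0, 0] ![1, 0, 0] S u) :
    u.sw01.coeffs 1 = u 2 1 0 * (u 0 1 1 * u 1 1 2 - u 0 1 2 * u 1 1 1) := by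
  simp (disch := decide) [coeffs, mixedDet, rowDet, Cube.sw01, hu.eq_zero hπ]
  ring

lemma Reduces.sw01_coeffs_six_typeB (hπ : Irreducible π)
    (hu : Reduces π 1 ![1, 1, 0] ![1, 0, 0] ![1, 0, 0] S u) :
    u.sw01.coeffs 6 = u 2 1 0 * (u 0 1 1 * u 1 2 2 - u 0 1 2 * u 1 2 1
      + u 0 2 1 * u 1 1 2 - u 0 2 2 * u 1 1 1)
      + u 2 2 0 * (u 0 1 1 * u 1 1 2 - u 0 1 2 * u 1 1 1) := by
  simp (disch := decide) [coeffs, mixedDet, rowDet, Cube.sw01, hu.eq_zero hπ]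
  ring

/-- The special slicing in the first place: the first cubic is divisible by `z²`. -/
lemma Reduces.stepI_typeB' (hπ : Irreducible π)
    (hu : Reduces π 1 ![1, 1, 0] ![1, 0, 0] ![1, 0, 0] S u) (hT : StepI K π 0 1 S T) :
    ∃ r, LevelRatio K S T r ∧ (IsUnit r → T.IsSaturated → Good K π 1 T) := by
  obtain ⟨w, hw, hw1⟩ : ∃ w, Reduces π 1 ![1, 1, 0] ![1, 0, 0] ![1, 0, 0] S w ∧
      X 2 ^ 2 ∣ w.cubic 1 := by
    have h1 := (hu.hasRepeatedLinearFactor hT).2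
    rw [cubic_one_eq_ternaryCubic] at h1
    obtain ⟨l, hl, hd⟩ := exists_line h1
      (by simp (disch := decide) [coeffs, mixedDet, rowDet, Cube.sw01, hu.eq_zero hπ])
      (by simp (disch := decide) [coeffs, mixedDet, rowDet, Cube.sw01, hu.eq_zero hπ])
      (by simp (disch := decide) [coeffs, mixedDet, rowDet, Cube.sw01, hu.eq_zero hπ])
    rw [← cubic_one_eq_ternaryCubic] at hd
    obtain ⟨w, hw, hw1, -⟩ := hu.exists_sq_dvd_one rfl hl hd
    exact ⟨w, hw, hw1⟩
  have hf1 := (hw.hasRepeatedLinearFactor hT).2.1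
  rw [cubic_one_eq_ternaryCubic, ne_eq, ternaryCubic_eq_zero_iff] at hf1
  obtain ⟨b1, b6⟩ := coeffs_eq_zero_of_sq_dvd (v := w.sw01)
    (by rwa [show w.sw01.cubic 0 = w.cubic 1 from cubic_sw01 w 1])
  rw [hw.sw01_coeffs_one_typeB hπ] at b1
  rw [hw.sw01_coeffs_six_typeB hπ] at b6
  have hY : ¬ (w 2 1 0 = 0 ∧ w 2 2 0 = 0) := by
    rintro ⟨h1, h2⟩
    apply hf1
    funext t
    fin_cases t <;>
      simp (disch := decide) [coeffs, mixedDet, rowDet, Cube.sw01, hw.eq_zero hπ, h1, h2]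
  have hdet : w 0 1 1 * w 1 1 2 = w 0 1 2 * w 1 1 1 := by
    by_cases h1 : w 2 1 0 = 0
    · have h2 : w 2 2 0 ≠ 0 := fun h => hY ⟨h1, h⟩
      simpa [h1, h2, sub_eq_zero] using b6
    · simpa [h1, sub_eq_zero] using b1
  obtain ⟨x, y, hxy, e0, e1⟩ := exists_kernel hdet
  obtain ⟨α, β, hαβ, hv⟩ := hw.mix2 (p := 2) (q := 1) (by decide) rfl (x := y) (y := x)
    (fun h => hxy h.symm)
  set v : Cube (IsLocalRing.ResidueField R) := _ with hvdef
  change Reduces _ _ _ _ _ _ v at hv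
  have v012 : v 0 1 2 = 0 := by simp [hvdef]; linear_combination e0
  have v112 : v 1 1 2 = 0 := by simp [hvdef]; linear_combination e1
  have v6 : v 2 1 0 * (v 0 1 1 * v 1 2 2 - v 0 1 2 * v 1 2 1
      + v 0 2 1 * v 1 1 2 - v 0 2 2 * v 1 1 1)
      + v 2 2 0 * (v 0 1 1 * v 1 1 2 - v 0 1 2 * v 1 1 1) = 0 := by
    simp [hvdef]
    linear_combination (y * β - x * α) * b6
  clear_value v
  refine hv.stepI_good hπ hT
    (X_two_sq_dvd_cubic_zero (by
      simp (disch := decide) [coeffs, mixedDet, rowDet, hv.eq_zero hπ]))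
    (X_two_sq_dvd_cubic_one ⟨?_, ?_, ?_, ?_, ?_, ?_, ?_⟩)
    [(0, 1, 2), (1, 1, 2)] (by simp [v012, v112]) ![1, 0, 1] (by decide) (by decide)
    1 ![0, 0, 0] ![1, 0, 1] ![1, 1, 0] (by decide) fun h _ => ?_
  · simp (disch := decide) [coeffs, mixedDet, rowDet, Cube.sw01, hv.eq_zero hπ]
  · rw [hv.sw01_coeffs_one_typeB hπ, v012, v112]
    ring
  · simp (disch := decide) [coeffs, mixedDet, rowDet, Cube.sw01, hv.eq_zero hπ]
  · simp (disch := decide) [coeffs, mixedDet, rowDet, Cube.sw01, hv.eq_zero hπ]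
  · simp (disch := decide) [coeffs, mixedDet, rowDet, Cube.sw01, hv.eq_zero hπ]
  · rw [hv.sw01_coeffs_six_typeB hπ, v6]
  · simp (disch := decide) [coeffs, mixedDet, rowDet, Cube.sw01, hv.eq_zero hπ]
  · have := h.perm 1 (Equiv.swap 1 2) 1
    rw [swap_weights] at this
    exact good_of_isTypeA hπ (.inr (.inr (HasWeight.sw01 this).sw12))

lemma good_of_isTypeB (hπ : Irreducible π) (h : UpToSlots (IsTypeB π) S) : Good K π 2 S := by
  refine h.good (fun S h => h.sw01) (fun S h T hT => ?_) fun S h T hT => ?_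
  · obtain ⟨u, hu⟩ := HasWeight.exists_reduces h
    rcases hT with hT | hT
    · exact hu.stepI_typeB hπ hT
    · refine hu.stepII_drop hπ hT ?_ ?_ [] (by simp) ![2, 2, 1] (by decide) (by decide)
      · rw [cubic_zero_eq_ternaryCubic, hu.coeffs_typeB hπ]
        exact isSingularPoint_ternaryCubic rfl rfl rfl
      · rw [show u.cubic 1 = u.sw01.cubic 0 from (cubic_sw01 u 1).symm, cubic_zero_eq_ternaryCubic,
          hu.sw01.coeffs_typeB hπ]
        exact isSingularPoint_ternaryCubic rfl rfl rfl
  · obtain ⟨u, hu⟩ := (HasWeight.sw12 h).sw01.exists_reduces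
    have hz0 : X 2 ^ 2 ∣ u.cubic 0 := X_two_sq_dvd_cubic_zero (by
      simp (disch := decide) [coeffs, mixedDet, rowDet, hu.eq_zero hπ])
    rcases hT with hT | hT
    · exact hu.stepI_typeB' hπ hT
    · exact (hu.not_stepII (.inl hz0) hT).elim

end TypeB

end Cube

/-! ### Weights of types C and E -/

namespace Cube

section Slots

variable {R : Type*} [CommRing R] {π : R} {T : Cube R}

lemma upToSlots_isTypeB_of_first {x : ℕ × ℕ} (hx : x = (1, 0) ∨ x = (0, 1))
    (h : T.HasWeight π 1 ![1, x.1, x.2] ![1, 0, 0] ![1, 0, 0]) : UpToSlots (IsTypeB π) T := by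
  rcases hx with rfl | rfl
  · exact .inr (.inr (HasWeight.sw01 h).sw12)
  · have := h.perm (Equiv.swap 1 2) 1 1
    rw [swap_weights] at this
    exact .inr (.inr (HasWeight.sw01 this).sw12)

lemma upToSlots_isTypeB_of_second {x : ℕ × ℕ} (hx : x = (1, 0) ∨ x = (0, 1))
    (h : T.HasWeight π 1 ![1, 0, 0] ![1, x.1, x.2] ![1, 0, 0]) : UpToSlots (IsTypeB π) T := by
  rcases hx with rfl | rfl
  · exact .inr (.inl (HasWeight.sw12 h))
  · have := h.perm 1 (Equiv.swap 1 2) 1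
    rw [swap_weights] at this
    exact .inr (.inl (HasWeight.sw12 this))

lemma upToSlots_isTypeB_of_third {x : ℕ × ℕ} (hx : x = (1, 0) ∨ x = (0, 1))
    (h : T.HasWeight π 1 ![1, 0, 0] ![1, 0, 0] ![1, x.1, x.2]) : UpToSlots (IsTypeB π) T := by
  rcases hx with rfl | rfl
  · exact .inl h
  · have := h.perm 1 1 (Equiv.swap 1 2)
    rw [swap_weights] at this
    exact .inl this

lemma UpToSlots.of_sw01 {A : Type*} {P : Cube A → Prop} (hP : ∀ S, P S → P S.sw01) {S : Cube A}
    (h : UpToSlots P S.sw01) : UpToSlots P S := by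
  rcases h with h | h | h
  exacts [.inl (hP _ h), .inr (.inr h), .inr (.inl h)]

lemma UpToSlots.of_sw12 {A : Type*} {P : Cube A → Prop} (hP : ∀ S, P S → P S.sw01) {S : Cube A}
    (h : UpToSlots P S.sw12) : UpToSlots P S := by
  rcases h with h | h | h
  exacts [.inr (.inl h), .inl h, .inr (.inr (hP _ h))]

end Slots

section TypeC

variable {R K : Type*} [CommRing R] [IsDomain R] [IsDiscreteValuationRing R]
  [Field K] [Algebra R K] [IsFractionRing R K] {π : R} {S T : Cube R}
  {u : Cube (IsLocalRing.ResidueField R)}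

/-- If the weights of type C cannot be replaced by weights of type B, then certain coefficients do
not vanish. -/
lemma Reduces.typeC_ne_zero (hπ : Irreducible π) (hB : ¬ UpToSlots (IsTypeB π) S)
    (hu : Reduces π 2 ![2, 1, 0] ![2, 1, 0] ![1, 0, 0] S u) :
    u 1 2 0 ≠ 0 ∧ u 2 1 0 ≠ 0 ∧ u 0 2 1 * u 2 0 2 - u 0 2 2 * u 2 0 1 ≠ 0 := by
  refine ⟨fun h => hB ?_, fun h => hB ?_, fun h => hB ?_⟩
  · exact upToSlots_isTypeB_of_first (.inl rfl)
      (hu.hasWeight hπ [(1, 2, 0)] (by simpa using h) (by decide))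
  · exact upToSlots_isTypeB_of_second (.inl rfl)
      (hu.hasWeight hπ [(2, 1, 0)] (by simpa using h) (by decide))
  · obtain ⟨x, y, hxy, e0, e1⟩ := exists_kernel (sub_eq_zero.1 h)
    obtain ⟨α, β, -, hv⟩ := hu.mix2 (p := 2) (q := 1) (by decide) rfl (x := y) (y := x)
      (fun h => hxy h.symm)
    refine upToSlots_isTypeB_of_third (.inr rfl)
      (hv.hasWeight hπ [(0, 2, 2), (2, 0, 2)] ?_ (by decide))
    simp only [List.mem_cons, List.not_mem_nil, or_false, forall_eq_or_imp, forall_eq, if_true]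
    exact ⟨by linear_combination e0, by linear_combination e1⟩

lemma Reduces.typeC_coeffs_eq_zero (hπ : Irreducible π)
    (hu : Reduces π 2 ![2, 1, 0] ![2, 1, 0] ![1, 0, 0] S u) : u.coeffs 0 = 0 ∧ u.coeffs 1 = 0 ∧
      u.coeffs 3 = 0 ∧ u.coeffs 4 = 0 ∧ u.coeffs 5 = 0 ∧ u.coeffs 9 = 0 := by
  simp (disch := decide) [coeffs, mixedDet, rowDet, hu.eq_zero hπ]

lemma Reduces.typeC_coeffs_six (hπ : Irreducible π)
    (hu : Reduces π 2 ![2, 1, 0] ![2, 1, 0] ![1, 0, 0] S u) :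
    u.coeffs 6 = u 1 2 0 * (u 2 0 1 * u 1 1 2 - u 2 0 2 * u 1 1 1) := by
  simp (disch := decide) [coeffs, mixedDet, rowDet, hu.eq_zero hπ]
  ring

/-- Under the conditions of `Reduces.typeC_ne_zero`, the coefficient of `x z²` in the first cubic does
not vanish. So a repeated linear factor forces the coefficient of `y² z` to vanish. -/
lemma Reduces.typeC_eq (hπ : Irreducible π) (h120 : u 1 2 0 ≠ 0) (h210 : u 2 1 0 ≠ 0)
    (hdet : u 0 2 1 * u 2 0 2 - u 0 2 2 * u 2 0 1 ≠ 0)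
    (hu : Reduces π 2 ![2, 1, 0] ![2, 1, 0] ![1, 0, 0] S u)
    (h : HasRepeatedLinearFactor (u.cubic 0)) : u 2 0 1 * u 1 1 2 = u 2 0 2 * u 1 1 1 := by
  rw [cubic_zero_eq_ternaryCubic] at h
  obtain ⟨h0, h1, h3, h4, h5, h9⟩ := hu.typeC_coeffs_eq_zero hπ
  by_contra hne
  have h7 := (eq_zero_of_hasRepeatedLinearFactor h h0 h1 h3 h4 h5 h9 (by
    rw [hu.typeC_coeffs_six hπ]
    exact mul_ne_zero h120 (sub_ne_zero.2 hne))).1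
  have e7 : u.coeffs 7 = u 2 1 0 * (u 0 2 1 * u 2 0 2 - u 0 2 2 * u 2 0 1) := by
    simp (disch := decide) [coeffs, mixedDet, rowDet, hu.eq_zero hπ]
    ring
  rw [e7] at h7
  exact mul_ne_zero h210 hdet h7

lemma Reduces.typeC_sq_dvd (hπ : Irreducible π)
    (hu : Reduces π 2 ![2, 1, 0] ![2, 1, 0] ![1, 0, 0] S u)
    (h : u 2 0 1 * u 1 1 2 = u 2 0 2 * u 1 1 1) : X 2 ^ 2 ∣ u.cubic 0 := by
  obtain ⟨h0, h1, h3, h4, h5, h9⟩ := hu.typeC_coeffs_eq_zero hπ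
  exact X_two_sq_dvd_cubic_zero ⟨h0, h1, h3, h4, h5,
    by rw [hu.typeC_coeffs_six hπ, h, sub_self, mul_zero], h9⟩

lemma Reduces.typeC_isSingularPoint (hπ : Irreducible π)
    (hu : Reduces π 2 ![2, 1, 0] ![2, 1, 0] ![1, 0, 0] S u) :
    IsSingularPoint (u.cubic 0) (![1, 0, 0] : Fin 3 → IsLocalRing.ResidueField R) := by
  rw [cubic_zero_eq_ternaryCubic]
  obtain ⟨h0, h1, h3, h4, h5, h9⟩ := hu.typeC_coeffs_eq_zero hπ
  exact isSingularPoint_ternaryCubic h0 h3 h4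

lemma cubic_zero_sw01 {A : Type*} [CommRing A] (u : Cube A) : u.sw01.cubic 0 = u.cubic 1 :=
  cubic_sw01 u 1

lemma cubic_zero_sw12_sw01 {A : Type*} [CommRing A] (u : Cube A) :
    u.sw12.sw01.cubic 0 = u.cubic 2 :=
  (cubic_sw01 u.sw12 1).trans (cubic_sw12 u 2)

lemma cubic_one_sw12_sw01 {A : Type*} [CommRing A] (u : Cube A) :
    u.sw12.sw01.cubic 1 = u.cubic 0 :=
  (cubic_sw01 u.sw12 0).trans (cubic_sw12 u 0)

/-- Procedure (i) lowers the level, and procedure (ii) leads to weights of type A. -/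
lemma IsTypeC.goodStep (hπ : Irreducible π) (hB : ¬ UpToSlots (IsTypeB π) S)
    (h : S.IsTypeC π) : GoodStep K π 2 S := by
  intro T hT
  obtain ⟨u, hu⟩ := HasWeight.exists_reduces h
  rcases hT with hT | hT
  · obtain ⟨h120, h210, hdet⟩ := hu.typeC_ne_zero hπ hB
    have e0 := hu.typeC_eq hπ h120 h210 hdet (hu.hasRepeatedLinearFactor hT).1
    have e1 := hu.sw01.typeC_eq hπ h210 h120
      (by intro h; apply hdet; simp only [Cube.sw01] at h; linear_combination -h)
      (by rw [cubic_zero_sw01]; exact (hu.hasRepeatedLinearFactor hT).2)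
    simp only [Cube.sw01] at e1
    have h111 : u 1 1 1 = 0 := (mul_eq_zero.1 (show (u 0 2 1 * u 2 0 2 - u 0 2 2 * u 2 0 1)
      * u 1 1 1 = 0 by linear_combination u 2 0 1 * e1 - u 0 2 1 * e0)).resolve_left hdet
    have h112 : u 1 1 2 = 0 := (mul_eq_zero.1 (show (u 0 2 1 * u 2 0 2 - u 0 2 2 * u 2 0 1)
      * u 1 1 2 = 0 by linear_combination u 2 0 2 * e1 - u 0 2 2 * e0)).resolve_left hdet
    have hz1 := hu.sw01.typeC_sq_dvd hπ e1
    rw [cubic_zero_sw01] at hz1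
    exact hu.stepI_drop hπ hT (hu.typeC_sq_dvd hπ e0) hz1 [(1, 1, 1), (1, 1, 2)]
      (by simp [h111, h112]) ![1, 1, 1] (by decide) (by decide)
  · have h1 := hu.sw01.typeC_isSingularPoint hπ
    rw [cubic_zero_sw01] at h1
    exact hu.stepII_good hπ hT (hu.typeC_isSingularPoint hπ) h1 [] (by simp) ![2, 1, 1] (by decide)
      (by decide) 1 ![1, 1, 0] ![1, 1, 0] ![0, 0, 0] (by decide)
      fun h _ => (good_of_isTypeA hπ (.inl h)).succ

/-- Procedure (i) leads to weights of type B, and procedure (ii) to weights of type A. -/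
lemma IsTypeC.goodStep' (hπ : Irreducible π) (hB : ¬ UpToSlots (IsTypeB π) S)
    (h : S.IsTypeC π) : GoodStep K π 2 S.sw12.sw01 := by
  intro T hT
  obtain ⟨u, hu⟩ := HasWeight.exists_reduces h
  rcases hT with hT | hT
  · obtain ⟨h120, h210, hdet⟩ := hu.typeC_ne_zero hπ hB
    have hrep := (hu.sw12.sw01.hasRepeatedLinearFactor hT).2
    rw [cubic_one_sw12_sw01] at hrep
    have e0 := hu.typeC_eq hπ h120 h210 hdet hrep
    -- the two proportional linear factors of the third cubic are moved to `z`
    obtain ⟨α, β, -, hw⟩ := hu.mix2 (p := 1) (q := 2) (by decide) rfl (x := u 2 0 2)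
      (y := -u 2 0 1) (by
        rintro ⟨h1, h2⟩
        exact hdet (by rw [h1, neg_eq_zero.1 h2]; ring))
    set w : Cube (IsLocalRing.ResidueField R) := _ with hwdef
    change Reduces _ _ _ _ _ _ w at hw
    have w201 : w 2 0 1 = 0 := by simp [hwdef]; ring
    have w111 : w 1 1 1 = 0 := by simp [hwdef]; linear_combination -e0
    clear_value w
    have hz1 := hw.typeC_sq_dvd hπ (by rw [w201, w111]; ring)
    rw [← cubic_one_sw12_sw01] at hz1
    refine hw.sw12.sw01.stepI_good hπ hT (X_two_sq_dvd_cubic_zero (by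
        simp (disch := decide) [coeffs, mixedDet, rowDet, Cube.sw01, Cube.sw12, hw.eq_zero hπ,
          w201, w111])) hz1 [(1, 2, 0), (1, 1, 1)] (by simp [Cube.sw01, Cube.sw12, w201, w111])
      ![1, 1, 0] (by decide) (by decide) 1 ![1, 0, 1] ![1, 0, 0] ![1, 0, 0] (by decide)
      fun h _ => good_of_isTypeB hπ (upToSlots_isTypeB_of_first (.inr rfl) h)
  · have h1 := hu.typeC_isSingularPoint hπ
    rw [← cubic_one_sw12_sw01] at h1
    refine hu.sw12.sw01.stepII_good hπ hT ?_ h1 [] (by simp) ![2, 1, 1] (by decide)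
      (by decide) 1 ![0, 0, 0] ![1, 1, 0] ![1, 1, 0] (by decide)
      fun h _ => (good_of_isTypeA hπ (.inr (.inr (HasWeight.sw01 h).sw12))).succ
    rw [cubic_zero_eq_ternaryCubic]
    apply isSingularPoint_ternaryCubic <;>
      simp (disch := decide) [coeffs, mixedDet, rowDet, Cube.sw01, Cube.sw12, hu.eq_zero hπ]

lemma good_of_isTypeC (hπ : Irreducible π) (hB : ¬ UpToSlots (IsTypeB π) S)
    (h : UpToSlots (IsTypeC π) S) : Good K π 3 S := by
  have hP : ∀ S, IsTypeB π S → IsTypeB π S.sw01 := fun S h => h.sw01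
  have h' : UpToSlots (fun S => IsTypeC π S ∧ ¬ UpToSlots (IsTypeB π) S) S :=
    h.imp (fun h => ⟨h, hB⟩) fun h => h.imp (fun h => ⟨h, fun h => hB (h.of_sw12 hP)⟩)
      fun h => ⟨h, fun h => hB ((h.of_sw12 hP).of_sw01 hP)⟩
  exact h'.good (fun S h => ⟨h.1.sw01, fun h' => h.2 (h'.of_sw01 hP)⟩)
    (fun S h => h.1.goodStep hπ h.2) fun S h => h.1.goodStep' hπ h.2

end TypeC

section TypeE

variable {R K : Type*} [CommRing R] [IsDomain R] [IsDiscreteValuationRing R]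
  [Field K] [Algebra R K] [IsFractionRing R K] {π : R} {S T : Cube R}
  {u : Cube (IsLocalRing.ResidueField R)}

/-- If the weights of type E cannot be replaced by weights of type B or D, then certain coefficients
do not vanish. -/
lemma Reduces.typeE_ne_zero (hπ : Irreducible π) (hsat : S.IsSaturated)
    (hB : ¬ UpToSlots (IsTypeB π) S) (hD : ¬ UpToSlots (IsTypeD π) S)
    (hu : Reduces π 3 ![2, 1, 0] ![2, 1, 0] ![3, 1, 0] S u) :
    u 2 2 0 ≠ 0 ∧ u 1 1 1 ≠ 0 ∧ u 0 1 2 ≠ 0 ∧ u 1 0 2 ≠ 0 := by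
  refine ⟨fun h => ?_, fun h => hD ?_, fun h => hB ?_, fun h => hB ?_⟩
  · have := (hu.saturated hsat).2.2 (Pi.single 0 1) fun i j => by
      fin_cases i <;> fin_cases j <;>
        simp (disch := decide) [Fin.sum_univ_three, hu.eq_zero hπ, h]
    simpa using congr_fun this 0
  · exact .inl (hu.hasWeight hπ [(1, 1, 1)] (by simpa using h) (by decide))
  · exact upToSlots_isTypeB_of_second (.inl rfl)
      (hu.hasWeight hπ [(0, 1, 2)] (by simpa using h) (by decide))
  · exact upToSlots_isTypeB_of_first (.inl rfl)
      (hu.hasWeight hπ [(1, 0, 2)] (by simpa using h) (by decide))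

lemma Reduces.typeE_coeffs (hπ : Irreducible π)
    (hu : Reduces π 3 ![2, 1, 0] ![2, 1, 0] ![3, 1, 0] S u) : u.coeffs =
      ![0, 0, u 2 0 1 * u 2 1 2 * u 2 2 0 - u 2 0 2 * u 2 1 1 * u 2 2 0, 0, 0, 0,
        -(u 1 0 2 * u 1 1 1 * u 2 2 0), u 2 0 1 * u 0 1 2 * u 2 2 0,
        u 2 0 1 * u 1 1 2 * u 2 2 0 - u 1 0 2 * u 2 1 1 * u 2 2 0 - u 2 0 2 * u 1 1 1 * u 2 2 0,
        0] := by
  funext t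
  fin_cases t <;> simp (disch := decide) [coeffs, mixedDet, rowDet, hu.eq_zero hπ] <;> ring

/-- The first cubic is `z` times a quadratic form with a non-zero coefficient of `y²`, so a repeated
linear factor forces that form to be a square in `y` and `z`, up to a scalar. -/
lemma Reduces.typeE_eq (hπ : Irreducible π)
    (h : u 2 2 0 ≠ 0 ∧ u 1 1 1 ≠ 0 ∧ u 0 1 2 ≠ 0 ∧ u 1 0 2 ≠ 0)
    (hu : Reduces π 3 ![2, 1, 0] ![2, 1, 0] ![3, 1, 0] S u)
    (hrep : HasRepeatedLinearFactor (u.cubic 0)) :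
    u 2 0 1 = 0 ∧ u 1 0 2 * u 2 1 1 = u 2 0 2 * u 1 1 1 := by
  obtain ⟨h220, h111, h012, h102⟩ := h
  rw [cubic_zero_eq_ternaryCubic, hu.typeE_coeffs hπ] at hrep
  obtain ⟨h7, h8⟩ := eq_zero_of_hasRepeatedLinearFactor hrep rfl rfl rfl rfl rfl rfl
    (neg_ne_zero.2 (mul_ne_zero (mul_ne_zero h102 h111) h220))
  have h201 : u 2 0 1 = 0 := by
    change u 2 0 1 * u 0 1 2 * u 2 2 0 = 0 at h7
    simpa [h012, h220] using h7
  refine ⟨h201, ?_⟩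
  simp only [Matrix.cons_val, h201] at h8
  rw [← sub_eq_zero, ← sq_eq_zero_iff]
  refine (mul_eq_zero.1 (?_ : u 2 2 0 ^ 2 * _ = 0)).resolve_left (pow_ne_zero 2 h220)
  linear_combination h8

lemma Reduces.typeE_isSingularPoint (hπ : Irreducible π)
    (hu : Reduces π 3 ![2, 1, 0] ![2, 1, 0] ![3, 1, 0] S u) :
    IsSingularPoint (u.cubic 0) (![1, 0, 0] : Fin 3 → IsLocalRing.ResidueField R) := by
  rw [cubic_zero_eq_ternaryCubic, hu.typeE_coeffs hπ]
  exact isSingularPoint_ternaryCubic rfl rfl rfl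

/-- Both procedures lead to weights of type D. -/
lemma IsTypeE.goodStep (hπ : Irreducible π) (hsat : S.IsSaturated)
    (hB : ¬ UpToSlots (IsTypeB π) S) (hD : ¬ UpToSlots (IsTypeD π) S)
    (h : S.IsTypeE π) : GoodStep K π 2 S := by
  intro T hT
  obtain ⟨u, hu⟩ := HasWeight.exists_reduces h
  rcases hT with hT | hT
  · have facts : ∀ v, Reduces π 3 ![2, 1, 0] ![2, 1, 0] ![3, 1, 0] S v →
        v 2 2 0 ≠ 0 ∧ v 1 1 1 ≠ 0 ∧ (v 2 0 1 = 0 ∧ v 1 0 2 * v 2 1 1 = v 2 0 2 * v 1 1 1) ∧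
        v 0 2 1 = 0 ∧ v 0 1 2 * v 1 2 1 = v 0 2 2 * v 1 1 1 := by
      intro v hv
      have hne := hv.typeE_ne_zero hπ hsat hB hD
      refine ⟨hne.1, hne.2.1, hv.typeE_eq hπ hne (hv.hasRepeatedLinearFactor hT).1, ?_⟩
      have hr : HasRepeatedLinearFactor (v.sw01.cubic 0) := by
        rw [cubic_zero_sw01]
        exact (hv.hasRepeatedLinearFactor hT).2
      have e := Reduces.typeE_eq hπ (u := v.sw01) ⟨hne.1, hne.2.1, hne.2.2.2, hne.2.2.1⟩
        hv.sw01 hr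
      exact e
    have h111 := (facts u hu).2.1
    -- the double lines of the first two cubics are moved to `y = 0`
    have hv := hu.add0 (p := 2) (q := 1) (by decide) (by decide) (-(u 2 1 1 / u 1 1 1))
    set v : Cube (IsLocalRing.ResidueField R) := _ with hvdef
    change Reduces _ _ _ _ _ _ v at hv
    have v211 : v 2 1 1 = 0 := by simp [hvdef]; field_simp; ring
    clear_value v
    have g111 := (facts v hv).2.1
    have hw := hv.add1 (p := 2) (q := 1) (by decide) (by decide) (-(v 1 2 1 / v 1 1 1))
    set w : Cube (IsLocalRing.ResidueField R) := _ with hwdef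
    change Reduces _ _ _ _ _ _ w at hw
    have w211 : w 2 1 1 = 0 := by simpa [hwdef] using v211
    have w121 : w 1 2 1 = 0 := by simp [hwdef]; field_simp; ring
    clear_value w
    have w220 := (facts w hw).1
    -- two further entries are removed by means of `w 2 2 0`
    have hx := hw.add2 (p := 1) (q := 0) (by decide) (by decide) (-(w 2 2 1 / w 2 2 0))
    set x : Cube (IsLocalRing.ResidueField R) := _ with hxdef
    change Reduces _ _ _ _ _ _ x at hx
    have x211 : x 2 1 1 = 0 := by simp (disch := decide) [hxdef, w211, hw.eq_zero hπ]
    have x121 : x 1 2 1 = 0 := by simp (disch := decide) [hxdef, w121, hw.eq_zero hπ]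
    have x221 : x 2 2 1 = 0 := by simp [hxdef]; field_simp; ring
    clear_value x
    have x220 := (facts x hx).1
    have hy := hx.add2 (p := 2) (q := 0) (by decide) (by decide) (-(x 2 2 2 / x 2 2 0))
    set y : Cube (IsLocalRing.ResidueField R) := _ with hydef
    change Reduces _ _ _ _ _ _ y at hy
    have y211 : y 2 1 1 = 0 := by simpa [hydef] using x211
    have y121 : y 1 2 1 = 0 := by simpa [hydef] using x121
    have y221 : y 2 2 1 = 0 := by simpa [hydef] using x221
    have y222 : y 2 2 2 = 0 := by simp [hydef]; field_simp; ring
    clear_value y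
    obtain ⟨y220, y111, ⟨y201, y202⟩, y021, y022⟩ := facts y hy
    replace y202 : y 2 0 2 = 0 := by simpa [y211, y111] using y202
    replace y022 : y 0 2 2 = 0 := by simpa [y121, y111] using y022
    have hp := hy.perm (Equiv.swap 1 2) (Equiv.swap 1 2) 1
    rw [swap_weights] at hp
    have s1 : (Equiv.swap 1 2 : Equiv.Perm (Fin 3)) 1 = 2 := by decide
    have s2 : (Equiv.swap 1 2 : Equiv.Perm (Fin 3)) 2 = 1 := by decide
    have s0 : (Equiv.swap 1 2 : Equiv.Perm (Fin 3)) 0 = 0 := by decide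
    refine hp.stepI_good hπ hT
      (X_two_sq_dvd_cubic_zero (by
        simp (disch := decide) [coeffs, mixedDet, rowDet, s0, s1, s2, hy.eq_zero hπ, y211, y121,
          y221, y222, y201, y202, y021, y022]))
      (X_two_sq_dvd_cubic_one (by
        simp (disch := decide) [coeffs, mixedDet, rowDet, Cube.sw01, s0, s1, s2, hy.eq_zero hπ,
          y211, y121, y221, y222, y201, y202, y021, y022]))
      [(0, 1, 1), (1, 0, 1), (1, 1, 1), (0, 1, 2), (1, 0, 2), (1, 1, 2)]
      (by simp [s0, s1, y021, y201, y221, y022, y202, y222]) ![0, 1, 1] (by decide) (by decide)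
      2 ![1, 0, 1] ![1, 0, 1] ![2, 1, 0] (by decide) fun h hs => ?_
    have := h.perm (Equiv.swap 1 2) (Equiv.swap 1 2) 1
    rw [swap_weights] at this
    exact good_of_isTypeD hπ hs (.inl this)
  · have h1 := hu.sw01.typeE_isSingularPoint hπ
    rw [cubic_zero_sw01] at h1
    exact hu.stepII_good hπ hT (hu.typeE_isSingularPoint hπ) h1 [] (by simp) ![2, 1, 1] (by decide)
      (by decide) 2 ![1, 1, 0] ![1, 1, 0] ![2, 1, 0] (by decide)
      fun h hs => good_of_isTypeD hπ hs (.inl h)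

/-- Procedure (i) leads to weights of type B, and procedure (ii) to weights of type D. -/
lemma IsTypeE.goodStep' (hπ : Irreducible π) (hsat : S.IsSaturated)
    (hB : ¬ UpToSlots (IsTypeB π) S) (hD : ¬ UpToSlots (IsTypeD π) S)
    (h : S.IsTypeE π) : GoodStep K π 2 S.sw12.sw01 := by
  intro T hT
  obtain ⟨u, hu⟩ := HasWeight.exists_reduces h
  rcases hT with hT | hT
  · have facts : ∀ v, Reduces π 3 ![2, 1, 0] ![2, 1, 0] ![3, 1, 0] S v →
        v 1 1 1 ≠ 0 ∧ v 2 0 1 = 0 ∧ v 1 0 2 * v 2 1 1 = v 2 0 2 * v 1 1 1 := by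
      intro v hv
      have hne := hv.typeE_ne_zero hπ hsat hB hD
      have hrep := (hv.sw12.sw01.hasRepeatedLinearFactor hT).2
      rw [cubic_one_sw12_sw01] at hrep
      exact ⟨hne.2.1, hv.typeE_eq hπ hne hrep⟩
    have h111 := (facts u hu).1
    have hv := hu.add0 (p := 2) (q := 1) (by decide) (by decide) (-(u 2 1 1 / u 1 1 1))
    set v : Cube (IsLocalRing.ResidueField R) := _ with hvdef
    change Reduces _ _ _ _ _ _ v at hv
    have v211 : v 2 1 1 = 0 := by simp [hvdef]; field_simp; ring
    clear_value v
    obtain ⟨v111, v201, v202⟩ := facts v hv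
    replace v202 : v 2 0 2 = 0 := by simpa [v211, v111] using v202
    have hp := hv.perm (Equiv.swap 1 2) 1 1
    rw [swap_weights] at hp
    have s1 : (Equiv.swap 1 2 : Equiv.Perm (Fin 3)) 1 = 2 := by decide
    have s2 : (Equiv.swap 1 2 : Equiv.Perm (Fin 3)) 2 = 1 := by decide
    have s0 : (Equiv.swap 1 2 : Equiv.Perm (Fin 3)) 0 = 0 := by decide
    exact hp.sw12.sw01.stepI_good hπ hT
      (X_two_sq_dvd_cubic_zero (by
        simp (disch := decide) [coeffs, mixedDet, rowDet, Cube.sw01, Cube.sw12, s0, s1, s2,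
          hv.eq_zero hπ, v211, v201, v202]))
      (X_two_sq_dvd_cubic_one (by
        simp (disch := decide) [coeffs, mixedDet, rowDet, Cube.sw01, Cube.sw12, s0, s1, s2,
          hv.eq_zero hπ, v211, v201, v202]))
      [(1, 1, 0), (1, 1, 1), (2, 1, 0)]
      (by simp [Cube.sw01, Cube.sw12, s1, v201, v211, v202]) ![1, 1, 0] (by decide) (by decide)
      1 ![1, 0, 0] ![1, 0, 1] ![1, 0, 0] (by decide)
      fun h _ => good_of_isTypeB hπ (upToSlots_isTypeB_of_second (.inr rfl) h)
  · have h1 := hu.typeE_isSingularPoint hπ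
    rw [← cubic_one_sw12_sw01] at h1
    refine hu.sw12.sw01.stepII_good hπ hT ?_ h1 [] (by simp) ![2, 1, 1] (by decide)
      (by decide) 2 ![2, 1, 0] ![1, 1, 0] ![1, 1, 0] (by decide)
      fun h hs => good_of_isTypeD hπ hs (.inr (.inr (HasWeight.sw01 h).sw12))
    rw [cubic_zero_eq_ternaryCubic]
    apply isSingularPoint_ternaryCubic <;>
      simp (disch := decide) [coeffs, mixedDet, rowDet, Cube.sw01, Cube.sw12, hu.eq_zero hπ]

lemma good_of_isTypeE (hπ : Irreducible π) (hsat : S.IsSaturated)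
    (hB : ¬ UpToSlots (IsTypeB π) S) (hD : ¬ UpToSlots (IsTypeD π) S)
    (h : UpToSlots (IsTypeE π) S) : Good K π 3 S := by
  have hPB : ∀ S, IsTypeB π S → IsTypeB π S.sw01 := fun S h => h.sw01
  have hPD : ∀ S, IsTypeD π S → IsTypeD π S.sw01 := fun S h => h.sw01
  have h' : UpToSlots (fun S => S.IsSaturated ∧ IsTypeE π S ∧ ¬ UpToSlots (IsTypeB π) S ∧
      ¬ UpToSlots (IsTypeD π) S) S :=
    h.imp (fun h => ⟨hsat, h, hB, hD⟩) fun h => h.imp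
      (fun h => ⟨hsat.sw12, h, fun h => hB (h.of_sw12 hPB), fun h => hD (h.of_sw12 hPD)⟩)
      fun h => ⟨hsat.sw01.sw12, h, fun h => hB ((h.of_sw12 hPB).of_sw01 hPB),
        fun h => hD ((h.of_sw12 hPD).of_sw01 hPD)⟩
  exact h'.good (fun S h => ⟨h.1.sw01, h.2.1.sw01, fun h' => h.2.2.1 (h'.of_sw01 hPB),
      fun h' => h.2.2.2 (h'.of_sw01 hPD)⟩)
    (fun S h => h.2.1.goodStep hπ h.1 h.2.2.1 h.2.2.2)
    fun S h => h.2.1.goodStep' hπ h.1 h.2.2.1 h.2.2.2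

/-- Three procedures suffice. -/
lemma IsNonMinimal.good (hπ : Irreducible π) (hsat : S.IsSaturated) (h : S.IsNonMinimal K) :
    Good K π 3 S := by
  by_cases hB : UpToSlots (IsTypeB π) S
  · exact (good_of_isTypeB hπ hB).succ
  by_cases hD : UpToSlots (IsTypeD π) S
  · exact (good_of_isTypeD hπ hsat hD).succ
  rcases h.exists_type hπ hsat with h | h | h | h | h
  exacts [(good_of_isTypeA hπ h).succ.succ, absurd h hB, good_of_isTypeC hπ hB h, absurd h hD,
    good_of_isTypeE hπ hsat hB hD h]

end TypeE

end Cube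

/-! ### Cubics of the form `α x z² + b(y, z)` -/

section BinaryCubics

variable {k : Type*} [Field k]

/-- A double root, in the separable closure, of a binary cubic with coefficients in `k` lies in `k`:
a second conjugate double root would give the cubic too many roots. -/
lemma exists_double_root {a b c d : k} (hab : ¬ (a = 0 ∧ b = 0)) {t : SeparableClosure k}
    (h : algebraMap k (SeparableClosure k) a * t ^ 3 + algebraMap k (SeparableClosure k) b * t ^ 2
      + algebraMap k (SeparableClosure k) c * t + algebraMap k (SeparableClosure k) d = 0)
    (h' : 3 * algebraMap k (SeparableClosure k) a * t ^ 2
      + 2 * algebraMap k (SeparableClosure k) b * t + algebraMap k (SeparableClosure k) c = 0) :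
    ∃ x : k, a * x ^ 3 + b * x ^ 2 + c * x + d = 0 ∧ 3 * a * x ^ 2 + 2 * b * x + c = 0 := by
  set φ := algebraMap k (SeparableClosure k) with hφ
  have fixed : ∀ σ : SeparableClosure k ≃ₐ[k] SeparableClosure k, σ t = t := by
    intro σ
    by_contra hne
    have g := congrArg σ h
    have g' := congrArg σ h'
    simp only [map_add, map_mul, map_pow, hφ, AlgEquiv.commutes, map_zero, map_ofNat] at g g'
    rw [← hφ] at g g'
    have hd : σ t - t ≠ 0 := sub_ne_zero.2 hne
    have e1 : φ b + 3 * φ a * t + φ a * (σ t - t) = 0 := by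
      refine (mul_eq_zero.1 (?_ : (σ t - t) ^ 2 * _ = 0)).resolve_left (pow_ne_zero 2 hd)
      linear_combination g - h - (σ t - t) * h'
    have e2 : 2 * (φ b + 3 * φ a * t) + 3 * φ a * (σ t - t) = 0 := by
      refine (mul_eq_zero.1 (?_ : (σ t - t) * _ = 0)).resolve_left hd
      linear_combination g' - h'
    have a0 : φ a = 0 := by
      refine (mul_eq_zero.1 (?_ : (σ t - t) * _ = 0)).resolve_left hd
      linear_combination e2 - 2 * e1
    have b0 : φ b = 0 := by simpa [a0] using e1
    exact hab ⟨by simpa [hφ] using a0, by simpa [hφ] using b0⟩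
  obtain ⟨x, hx⟩ := (InfiniteGalois.mem_bot_iff_fixed t).2 fixed
  change φ x = t at hx
  refine ⟨x, φ.injective ?_, φ.injective ?_⟩
  · simpa [← hx] using h
  · simpa [← hx, map_ofNat φ] using h'

/-- A non-zero cubic `α x z² + b(y, z)` either has `(1 : 0 : 0)` as its only singular point or has
a repeated linear factor. -/
lemma exists_isUniqueSingularPoint_or_hasRepeatedLinearFactor {c : Fin 10 → k}
    (hc : ternaryCubic c ≠ 0) (h0 : c 0 = 0) (h3 : c 3 = 0) (h4 : c 4 = 0) (h5 : c 5 = 0)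
    (h9 : c 9 = 0) : (∃ p, IsUniqueSingularPoint (ternaryCubic c) p) ∨
      HasRepeatedLinearFactor (ternaryCubic c) := by
  by_cases h16 : c 1 = 0 ∧ c 6 = 0
  · exact .inr (Cube.hasRepeatedLinearFactor_of_X_two_sq_dvd hc
      ((X_two_sq_dvd_iff c).2 ⟨h0, h16.1, h3, h4, h5, h16.2, h9⟩))
  by_cases hs : c 7 = 0 ∧ ∃ x, c 1 * x ^ 3 + c 6 * x ^ 2 + c 8 * x + c 2 = 0 ∧
      3 * c 1 * x ^ 2 + 2 * c 6 * x + c 8 = 0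
  · obtain ⟨h7, x, e, e'⟩ := hs
    refine .inr ⟨hc, ![0, 1, -x], fun h => by simpa using congr_fun h 1, ?_⟩
    have : c = sqMulCoeffs ![0, 1, -x] ![0, c 1, c 6 + 2 * x * c 1] := by
      funext t
      fin_cases t <;> simp [sqMulCoeffs, *]
      · linear_combination e - x * e'
      · linear_combination e'
    rw [this, ternaryCubic_sqMulCoeffs]
    exact dvd_mul_right _ _
  refine .inl ⟨![1, 0, 0], Cube.isSingularPoint_ternaryCubic h0 h3 h4, fun q hq => ⟨q 0, ?_⟩⟩
  have f := hq.2.1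
  have fx := hq.2.2 0
  have fy := hq.2.2 1
  have fz := hq.2.2 2
  rw [aeval_ternaryCubic] at f
  rw [aeval_pderiv_zero_ternaryCubic] at fx
  rw [aeval_pderiv_one_ternaryCubic] at fy
  rw [aeval_pderiv_two_ternaryCubic] at fz
  simp only [h0, h3, h4, h5, h9, map_zero, zero_mul, add_zero, zero_add, mul_zero] at f fx fy fz
  have q2 : q 2 = 0 := by
    by_contra hq2
    have h7 : c 7 = 0 := by simpa [hq2] using fx
    refine hs ⟨h7, exists_double_root h16 (t := q 1 / q 2) ?_ ?_⟩
    · field_simp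
      simp only [h7, map_zero] at f
      linear_combination f
    · field_simp
      linear_combination fy
  have q1 : q 1 = 0 := by
    by_contra hq1
    simp only [q2] at f fz
    exact h16 ⟨by simpa [hq1] using f, by simpa [hq1] using fz⟩
  funext t
  fin_cases t <;> simp [q1, q2]

/-- Two of the three cubics have a repeated linear factor, or two of them have a unique singular
point. -/
def IsAdmissible (f : Fin 3 → MvPolynomial (Fin 3) k) : Prop :=
  (∃ i j, i ≠ j ∧ HasRepeatedLinearFactor (f i) ∧ HasRepeatedLinearFactor (f j)) ∨
    ∃ i j, i ≠ j ∧ (∃ p, IsUniqueSingularPoint (f i) p) ∧ ∃ p, IsUniqueSingularPoint (f j) p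

lemma IsAdmissible.of_forall {f : Fin 3 → MvPolynomial (Fin 3) k}
    (h : ∀ i, (∃ p, IsUniqueSingularPoint (f i) p) ∨ HasRepeatedLinearFactor (f i)) :
    IsAdmissible f := by
  rcases h 0 with h0 | h0 <;> rcases h 1 with h1 | h1 <;> rcases h 2 with h2 | h2
  exacts [.inr ⟨0, 1, by decide, h0, h1⟩, .inr ⟨0, 1, by decide, h0, h1⟩,
    .inr ⟨0, 2, by decide, h0, h2⟩, .inl ⟨1, 2, by decide, h1, h2⟩,
    .inr ⟨1, 2, by decide, h1, h2⟩, .inl ⟨0, 2, by decide, h0, h2⟩,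
    .inl ⟨0, 1, by decide, h0, h1⟩, .inl ⟨0, 1, by decide, h0, h1⟩]

lemma IsAdmissible.of_comp {f g : Fin 3 → MvPolynomial (Fin 3) k} {σ : Fin 3 → Fin 3}
    (hσ : Function.Injective σ) (e : ∀ i, g (σ i) = f i) (h : IsAdmissible f) :
    IsAdmissible g := by
  rcases h with ⟨i, j, hij, hi, hj⟩ | ⟨i, j, hij, hi, hj⟩
  · exact .inl ⟨σ i, σ j, hσ.ne hij, by rwa [e], by rwa [e]⟩
  · exact .inr ⟨σ i, σ j, hσ.ne hij, by rwa [e], by rwa [e]⟩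

end BinaryCubics

namespace Cube

section Admissible

variable {R : Type*} [CommRing R] [IsLocalRing R] {S V : Cube R}

lemma IsAdmissible.of_sw01 (h : IsAdmissible S.sw01.redCubic) : IsAdmissible S.redCubic :=
  h.of_comp (Function.LeftInverse.injective idx01_idx01) fun i => redCubic_sw01 S.sw01 i

lemma IsAdmissible.of_sw12 (h : IsAdmissible S.sw12.redCubic) : IsAdmissible S.redCubic :=
  h.of_comp (Function.LeftInverse.injective idx12_idx12) fun i => redCubic_sw12 S.sw12 i

lemma Reduces.isAdmissible {π : R} {s : ℕ} {a b c : Fin 3 → ℕ}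
    {u : Cube (IsLocalRing.ResidueField R)} (hu : Reduces π s a b c S u)
    (h : IsAdmissible u.cubic) : IsAdmissible S.redCubic := by
  obtain ⟨V, hV, -, rfl⟩ := hu
  have e : (V.map (IsLocalRing.residue R)).cubic = V.redCubic :=
    funext fun i => (redCubic_eq V i).symm
  rw [e] at h
  rcases h with ⟨i, j, hij, hi, hj⟩ | ⟨i, j, hij, hi, hj⟩
  · exact .inl ⟨i, j, hij, hV.symm.hasRepeatedLinearFactor hi, hV.symm.hasRepeatedLinearFactor hj⟩
  · exact .inr ⟨i, j, hij, hV.symm.exists_isUniqueSingularPoint hi,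
      hV.symm.exists_isUniqueSingularPoint hj⟩

end Admissible

end Cube

/-! ### The two situations for types A, C and E -/

namespace Cube

section Criteria

variable {k : Type*} [Field k] {u : Cube k}

lemma cubic_zero_ne_zero (t : Fin 10) (h : u.coeffs t ≠ 0) : u.cubic 0 ≠ 0 := by
  rw [cubic_zero_eq_ternaryCubic, Ne, ternaryCubic_eq_zero_iff]
  exact fun h0 => h (congr_fun h0 t)

lemma cubic_zero_isUniqueSingularPoint_or (hne : u.cubic 0 ≠ 0) (h : u.coeffs 0 = 0 ∧
    u.coeffs 3 = 0 ∧ u.coeffs 4 = 0 ∧ u.coeffs 5 = 0 ∧ u.coeffs 9 = 0) :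
    (∃ p, IsUniqueSingularPoint (u.cubic 0) p) ∨ HasRepeatedLinearFactor (u.cubic 0) := by
  rw [cubic_zero_eq_ternaryCubic] at hne ⊢
  exact exists_isUniqueSingularPoint_or_hasRepeatedLinearFactor hne h.1 h.2.1 h.2.2.1 h.2.2.2.1
    h.2.2.2.2

lemma cubic_zero_hasRepeatedLinearFactor (hne : u.cubic 0 ≠ 0) (h : u.coeffs 0 = 0 ∧
    u.coeffs 1 = 0 ∧ u.coeffs 3 = 0 ∧ u.coeffs 4 = 0 ∧ u.coeffs 5 = 0 ∧ u.coeffs 6 = 0 ∧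
    u.coeffs 9 = 0) : HasRepeatedLinearFactor (u.cubic 0) :=
  hasRepeatedLinearFactor_of_X_two_sq_dvd hne (X_two_sq_dvd_cubic_zero h)

end Criteria

section Types

variable {R K : Type*} [CommRing R] [IsDomain R] [IsDiscreteValuationRing R]
  [Field K] [Algebra R K] [IsFractionRing R K] {π : R} {S T : Cube R}
  {u : Cube (IsLocalRing.ResidueField R)}

lemma Reduces.typeA_cubic_zero (hπ : Irreducible π) (hsat : S.IsSaturated)
    (hu : Reduces π 1 ![1, 1, 0] ![1, 1, 0] ![0, 0, 0] S u) :
    HasRepeatedLinearFactor (u.cubic 0) := by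
  refine cubic_zero_hasRepeatedLinearFactor (fun h => ?_)
    (by simp (disch := decide) [coeffs, mixedDet, rowDet, hu.eq_zero hπ])
  obtain ⟨-, s1, s2⟩ := hu.saturated hsat
  rw [cubic_zero_eq_ternaryCubic, ternaryCubic_eq_zero_iff] at h
  have h7 := congr_fun h 7
  have h8 := congr_fun h 8
  have h2 := congr_fun h 2
  simp (disch := decide) [coeffs, mixedDet, rowDet, hu.eq_zero hπ] at h7 h8 h2
  -- the cross product of two rows is orthogonal to all rows
  have hp := s2 ![u 2 0 1 * u 2 1 2 - u 2 0 2 * u 2 1 1, u 2 0 2 * u 2 1 0 - u 2 0 0 * u 2 1 2,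
    u 2 0 0 * u 2 1 1 - u 2 0 1 * u 2 1 0] (by
      intro i j
      fin_cases i <;> fin_cases j <;>
        simp (disch := decide) [Fin.sum_univ_three, hu.eq_zero hπ]
      · linear_combination h7
      · linear_combination h8
      · ring
      · ring
      · linear_combination h2)
  have p0 := congr_fun hp 0
  have p1 := congr_fun hp 1
  have p2 := congr_fun hp 2
  simp only [Matrix.cons_val, Pi.zero_apply] at p0 p1 p2
  have hr : ∀ t, u 2 0 t = 0 := by
    intro t
    have := s1 ![u 2 1 t, -u 2 0 t, 0] (by
      intro i l
      fin_cases i <;> fin_cases l <;> fin_cases t <;>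
        simp (disch := decide) [Fin.sum_univ_three, hu.eq_zero hπ] <;> grind)
    simpa using congr_fun this 1
  have := s1 ![1, 0, 0] (by
    intro i l
    fin_cases i <;> fin_cases l <;>
      simp (disch := decide) [Fin.sum_univ_three, hu.eq_zero hπ, hr])
  simpa using congr_fun this 0

lemma IsTypeA.isAdmissible (hπ : Irreducible π) (hsat : S.IsSaturated) (h : S.IsTypeA π) :
    IsAdmissible S.redCubic := by
  obtain ⟨u, hu⟩ := HasWeight.exists_reduces h
  have h1 := hu.sw01.typeA_cubic_zero hπ hsat.sw01
  rw [cubic_zero_sw01] at h1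
  exact hu.isAdmissible (.inl ⟨0, 1, by decide, hu.typeA_cubic_zero hπ hsat, h1⟩)

lemma IsTypeC.isAdmissible (hπ : Irreducible π) (hB : ¬ UpToSlots (IsTypeB π) S)
    (h : S.IsTypeC π) : IsAdmissible S.redCubic := by
  obtain ⟨u, hu⟩ := HasWeight.exists_reduces h
  obtain ⟨h120, h210, hdet⟩ := hu.typeC_ne_zero hπ hB
  have h0 : u.cubic 0 ≠ 0 := cubic_zero_ne_zero 7 (by
    simp (disch := decide) [coeffs, mixedDet, rowDet, hu.eq_zero hπ]
    grind)
  have h1 : u.sw01.cubic 0 ≠ 0 := cubic_zero_ne_zero 7 (by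
    simp (disch := decide) [coeffs, mixedDet, rowDet, Cube.sw01, hu.eq_zero hπ]
    grind)
  by_cases hν : u 1 1 1 = 0 ∧ u 1 1 2 = 0
  · refine hu.isAdmissible (.inl ⟨0, 1, by decide, cubic_zero_hasRepeatedLinearFactor h0
      (by simp (disch := decide) [coeffs, mixedDet, rowDet, hu.eq_zero hπ, hν]), ?_⟩)
    rw [← cubic_zero_sw01]
    exact cubic_zero_hasRepeatedLinearFactor h1
      (by simp (disch := decide) [coeffs, mixedDet, rowDet, Cube.sw01, hu.eq_zero hπ, hν])
  have h2 : u.sw12.sw01.cubic 0 ≠ 0 := by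
    intro h
    rw [cubic_zero_eq_ternaryCubic, ternaryCubic_eq_zero_iff] at h
    have e1 := congr_fun h 1
    have e6 := congr_fun h 6
    have e8 := congr_fun h 8
    have e2 := congr_fun h 2
    simp (disch := decide) [coeffs, mixedDet, rowDet, Cube.sw01, Cube.sw12, hu.eq_zero hπ]
      at e1 e6 e8 e2
    grind
  refine hu.isAdmissible (.of_forall fun i => ?_)
  fin_cases i
  · exact cubic_zero_isUniqueSingularPoint_or h0
      (by simp (disch := decide) [coeffs, mixedDet, rowDet, hu.eq_zero hπ])
  · have := cubic_zero_isUniqueSingularPoint_or h1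
      (by simp (disch := decide) [coeffs, mixedDet, rowDet, Cube.sw01, hu.eq_zero hπ])
    rwa [cubic_zero_sw01] at this
  · have := cubic_zero_isUniqueSingularPoint_or h2
      (by simp (disch := decide) [coeffs, mixedDet, rowDet, Cube.sw01, Cube.sw12, hu.eq_zero hπ])
    rwa [cubic_zero_sw12_sw01] at this

lemma IsTypeE.isAdmissible (hπ : Irreducible π) (hsat : S.IsSaturated)
    (hB : ¬ UpToSlots (IsTypeB π) S) (hD : ¬ UpToSlots (IsTypeD π) S)
    (h : S.IsTypeE π) : IsAdmissible S.redCubic := by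
  obtain ⟨u, hu⟩ := HasWeight.exists_reduces h
  obtain ⟨h220, h111, h012, h102⟩ := hu.typeE_ne_zero hπ hsat hB hD
  refine hu.isAdmissible (.of_forall fun i => ?_)
  fin_cases i
  · exact cubic_zero_isUniqueSingularPoint_or
      (cubic_zero_ne_zero 6 (by rw [hu.typeE_coeffs hπ]; simp [h220, h111, h102]))
      (by simp [hu.typeE_coeffs hπ])
  · have := cubic_zero_isUniqueSingularPoint_or (u := u.sw01)
      (cubic_zero_ne_zero 6 (by rw [hu.sw01.typeE_coeffs hπ]; simp [Cube.sw01, h220, h111, h012]))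
      (by simp [hu.sw01.typeE_coeffs hπ])
    rwa [cubic_zero_sw01] at this
  · have := cubic_zero_isUniqueSingularPoint_or (u := u.sw12.sw01)
      (cubic_zero_ne_zero 7 (by
        simp (disch := decide) [coeffs, mixedDet, rowDet, Cube.sw01, Cube.sw12, hu.eq_zero hπ,
          h220, h102, h012]))
      (by simp (disch := decide) [coeffs, mixedDet, rowDet, Cube.sw01, Cube.sw12, hu.eq_zero hπ])
    rwa [cubic_zero_sw12_sw01] at this

end Types

end Cube

/-! ### The two situations for types B and D -/

section Pencils

variable {k : Type*} [Field k]

lemma exists_relation {ι : Type*} {f g : ι → k} (h : ∀ s t, f s * g t = f t * g s) :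
    ∃ x y : k, ¬ (x = 0 ∧ y = 0) ∧ ∀ t, x * f t + y * g t = 0 := by
  by_cases hf : ∀ s, f s = 0
  · exact ⟨1, 0, by simp, by simp [hf]⟩
  · push Not at hf
    obtain ⟨s, hs⟩ := hf
    exact ⟨g s, -f s, fun h => hs (by simpa using h.2), fun t => by linear_combination -h s t⟩

/-- The `2 × 2` matrices of a pencil of singular matrices have a common left kernel or a common
right kernel. -/
lemma exists_common_kernel {p q r s p' q' r' s' : k} (h : p * s - q * r = 0)
    (h' : p' * s' - q' * r' = 0) (hm : p * s' + p' * s - q * r' - q' * r = 0) :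
    (∃ x y : k, ¬ (x = 0 ∧ y = 0) ∧ x * p + y * r = 0 ∧ x * q + y * s = 0 ∧
      x * p' + y * r' = 0 ∧ x * q' + y * s' = 0) ∨
    ∃ x y : k, ¬ (x = 0 ∧ y = 0) ∧ x * p + y * q = 0 ∧ x * r + y * s = 0 ∧
      x * p' + y * q' = 0 ∧ x * r' + y * s' = 0 := by
  by_cases hr : p * r' - p' * r = 0 ∧ q * s' - q' * s = 0 ∧ p * s' - q' * r = 0
  · obtain ⟨x, y, hxy, e⟩ := exists_relation (f := ![p, q, p', q']) (g := ![r, s, r', s']) (by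
      intro a b
      fin_cases a <;> fin_cases b <;> simp <;> grind)
    exact .inl ⟨x, y, hxy, e 0, e 1, e 2, e 3⟩
  · have hc : p * q' - p' * q = 0 ∧ r * s' - r' * s = 0 ∧ p * s' - q * r' = 0 := by
      by_contra hc
      grind
    obtain ⟨x, y, hxy, e⟩ := exists_relation (f := ![p, r, p', r']) (g := ![q, s, q', s']) (by
      intro a b
      fin_cases a <;> fin_cases b <;> simp <;> grind)
    exact .inr ⟨x, y, hxy, e 0, e 1, e 2, e 3⟩

/-- A singular point on the line `x = 0` contradicts the uniqueness of the singular point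
`(1 : 0 : 0)`. -/
lemma not_isUniqueSingularPoint {f : MvPolynomial (Fin 3) k} {y z : k} (hyz : ¬ (y = 0 ∧ z = 0))
    (h : IsSingularPoint f (![1, 0, 0] : Fin 3 → k))
    (h' : IsSingularPoint f (![0, y, z] : Fin 3 → k)) (p : Fin 3 → k) :
    ¬ IsUniqueSingularPoint f p := by
  rintro ⟨-, hp⟩
  obtain ⟨c, hc⟩ := hp _ ((isSingularPoint_algebraMap_iff (L := SeparableClosure k) _ _).2 h)
  obtain ⟨c', hc'⟩ := hp _ ((isSingularPoint_algebraMap_iff (L := SeparableClosure k) _ _).2 h')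
  have e0 := congr_fun hc 0
  have e1 := congr_fun hc 1
  have e2 := congr_fun hc 2
  have e1' := congr_fun hc' 1
  have e2' := congr_fun hc' 2
  simp only [Matrix.cons_val, map_one, map_zero] at e0 e1 e2 e1' e2'
  have hc0 : c ≠ 0 := fun h0 => by simp [h0] at e0
  rw [(mul_eq_zero.1 e1.symm).resolve_left hc0, mul_zero] at e1'
  rw [(mul_eq_zero.1 e2.symm).resolve_left hc0, mul_zero] at e2'
  exact hyz ⟨by simpa using e1', by simpa using e2'⟩

end Pencils

namespace Cube

section Types

variable {R K : Type*} [CommRing R] [IsDomain R] [IsDiscreteValuationRing R]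
  [Field K] [Algebra R K] [IsFractionRing R K] {π : R} {S T : Cube R}
  {u : Cube (IsLocalRing.ResidueField R)}

lemma Reduces.typeD_ne_zero (hπ : Irreducible π) (hsat : S.IsSaturated)
    (hu : Reduces π 2 ![1, 1, 0] ![1, 1, 0] ![2, 1, 0] S u) : u 2 2 0 ≠ 0 := by
  intro h
  have := (hu.saturated hsat).2.2 (Pi.single 0 1) fun i j => by
    fin_cases i <;> fin_cases j <;>
      simp (disch := decide) [Fin.sum_univ_three, hu.eq_zero hπ, h]
  simpa using congr_fun this 0

/-- For weights of type D the first cubic is divisible by `z²`. By saturation it vanishes only if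
the entries `u₂₀₁` and `u₂₁₁` do. -/
lemma Reduces.typeD_cubic_zero (hπ : Irreducible π) (hsat : S.IsSaturated)
    (hu : Reduces π 2 ![1, 1, 0] ![1, 1, 0] ![2, 1, 0] S u)
    (ha : ¬ (u 2 0 1 = 0 ∧ u 2 1 1 = 0)) : HasRepeatedLinearFactor (u.cubic 0) := by
  refine cubic_zero_hasRepeatedLinearFactor (fun h => ha ?_)
    (by simp (disch := decide) [coeffs, mixedDet, rowDet, hu.eq_zero hπ])
  have h220 := hu.typeD_ne_zero hπ hsat
  rw [cubic_zero_eq_ternaryCubic, ternaryCubic_eq_zero_iff] at h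
  have h7 := congr_fun h 7
  have h8 := congr_fun h 8
  have h2 := congr_fun h 2
  simp (disch := decide) [coeffs, mixedDet, rowDet, hu.eq_zero hπ] at h7 h8 h2
  have := (hu.saturated hsat).2.1 ![u 2 1 1, -u 2 0 1, 0] (by
    intro i l
    fin_cases i <;> fin_cases l <;>
      simp (disch := decide) [Fin.sum_univ_three, hu.eq_zero hπ] <;> grind)
  exact ⟨by simpa using congr_fun this 1, by simpa using congr_fun this 0⟩

/-- If the first cubic may vanish, then the cubic of the special slicing has a repeated factor. -/
lemma Reduces.typeD_cubic_two (hπ : Irreducible π) (hsat : S.IsSaturated)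
    (hu : Reduces π 2 ![1, 1, 0] ![1, 1, 0] ![2, 1, 0] S u)
    (h201 : u 2 0 1 = 0) (h211 : u 2 1 1 = 0) : HasRepeatedLinearFactor (u.cubic 2) := by
  rw [← cubic_zero_sw12_sw01]
  have h220 := hu.typeD_ne_zero hπ hsat
  refine cubic_zero_hasRepeatedLinearFactor (fun h => ?_)
    (by simp (disch := decide) [coeffs, mixedDet, rowDet, Cube.sw01, Cube.sw12, hu.eq_zero hπ,
      h201, h211])
  obtain ⟨s0, s1, -⟩ := hu.saturated hsat
  rw [cubic_zero_eq_ternaryCubic, ternaryCubic_eq_zero_iff] at h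
  have h7 := congr_fun h 7
  have h8 := congr_fun h 8
  have h2 := congr_fun h 2
  simp (disch := decide) [coeffs, mixedDet, rowDet, Cube.sw01, Cube.sw12, hu.eq_zero hπ,
    h201, h211] at h7 h8 h2
  -- all `2 × 2` minors of the matrix of the `u i j 2` with `j ≤ 1` vanish
  have hm := s0 ![u 2 0 2 * u 1 1 2 - u 2 1 2 * u 1 0 2, u 2 1 2 * u 0 0 2 - u 2 0 2 * u 0 1 2, 0]
    (by
      intro j l
      fin_cases j <;> fin_cases l <;>
        simp (disch := decide) [Fin.sum_univ_three, hu.eq_zero hπ, h201, h211] <;> grind)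
  have m0 := congr_fun hm 0
  have m1 := congr_fun hm 1
  simp only [Matrix.cons_val, Pi.zero_apply] at m0 m1
  have hz : ∀ i, u i 0 2 = 0 := by
    intro t
    have := s1 ![u t 1 2, -u t 0 2, 0] (by
      intro i l
      fin_cases i <;> fin_cases l <;> fin_cases t <;>
        simp (disch := decide) [Fin.sum_univ_three, hu.eq_zero hπ, h201, h211] <;> grind)
    simpa using congr_fun this 1
  have := s1 ![1, 0, 0] (by
    intro i l
    fin_cases i <;> fin_cases l <;>
      simp (disch := decide) [Fin.sum_univ_three, hu.eq_zero hπ, h201, hz])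
  simpa using congr_fun this 0

lemma IsTypeD.isAdmissible (hπ : Irreducible π) (hsat : S.IsSaturated) (h : S.IsTypeD π) :
    IsAdmissible S.redCubic := by
  have key : ∀ S : Cube R, S.IsSaturated → ∀ u : Cube (IsLocalRing.ResidueField R),
      Reduces π 2 ![1, 1, 0] ![1, 1, 0] ![2, 1, 0] S u → u 2 0 1 = 0 → u 2 1 1 = 0 →
      IsAdmissible S.redCubic := by
    intro S hsat u hu h201 h211
    have h220 := hu.typeD_ne_zero hπ hsat
    have h1 := hu.sw01.typeD_cubic_zero hπ hsat.sw01 (by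
      rintro ⟨h021, h121⟩
      simp only [Cube.sw01] at h021 h121
      have := (hu.saturated hsat).2.2 ![-u 2 2 1, u 2 2 0, 0] (by
        intro i j
        fin_cases i <;> fin_cases j <;>
          simp (disch := decide) [Fin.sum_univ_three, hu.eq_zero hπ, h021, h121, h201, h211]
        ring)
      exact h220 (by simpa using congr_fun this 1))
    rw [cubic_zero_sw01] at h1
    exact hu.isAdmissible
      (.inl ⟨1, 2, by decide, h1, hu.typeD_cubic_two hπ hsat h201 h211⟩)
  obtain ⟨u, hu⟩ := HasWeight.exists_reduces h
  by_cases ha : u 2 0 1 = 0 ∧ u 2 1 1 = 0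
  · exact key S hsat u hu ha.1 ha.2
  by_cases hb : u 0 2 1 = 0 ∧ u 1 2 1 = 0
  · exact IsAdmissible.of_sw01 (key S.sw01 hsat.sw01 u.sw01 hu.sw01 hb.1 hb.2)
  have h1 := hu.sw01.typeD_cubic_zero hπ hsat.sw01 hb
  rw [cubic_zero_sw01] at h1
  exact hu.isAdmissible (.inl ⟨0, 1, by decide, hu.typeD_cubic_zero hπ hsat ha, h1⟩)

lemma Reduces.typeB_ne_zero (hπ : Irreducible π) (hsat : S.IsSaturated)
    (hu : Reduces π 1 ![1, 0, 0] ![1, 0, 0] ![1, 1, 0] S u) :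
    ¬ (u 1 0 2 = 0 ∧ u 2 0 2 = 0) := by
  rintro ⟨h1, h2⟩
  have := (hu.saturated hsat).2.1 ![1, 0, 0] (by
    intro i l
    fin_cases i <;> fin_cases l <;>
      simp (disch := decide) [Fin.sum_univ_three, hu.eq_zero hπ, h1, h2])
  simpa using congr_fun this 0

/-- For weights of type B, if the first cubic vanishes, then the other two have a repeated linear
factor. -/
lemma Reduces.typeB_isAdmissible_of_eq_zero (hπ : Irreducible π) (hsat : S.IsSaturated)
    (hu : Reduces π 1 ![1, 0, 0] ![1, 0, 0] ![1, 1, 0] S u) (h : u.cubic 0 = 0) :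
    IsAdmissible S.redCubic := by
  have hn := hu.typeB_ne_zero hπ hsat
  rw [cubic_zero_eq_ternaryCubic, ternaryCubic_eq_zero_iff] at h
  have h1 := congr_fun h 1
  have h6 := congr_fun h 6
  have h8 := congr_fun h 8
  have h2 := congr_fun h 2
  simp (disch := decide) [coeffs, mixedDet, rowDet, hu.eq_zero hπ] at h1 h6 h8 h2
  -- the quadratic cofactor of `f₀` vanishes
  have hq : u 1 1 0 * u 1 2 1 - u 1 1 1 * u 1 2 0 = 0 ∧
      u 2 1 0 * u 2 2 1 - u 2 1 1 * u 2 2 0 = 0 ∧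
      u 1 1 0 * u 2 2 1 + u 2 1 0 * u 1 2 1 - u 1 1 1 * u 2 2 0 - u 2 1 1 * u 1 2 0 = 0 := by
    by_cases hn1 : u 1 0 2 = 0
    · have hn2 : u 2 0 2 ≠ 0 := fun h => hn ⟨hn1, h⟩
      grind
    · grind
  obtain ⟨x, y, hxy, e⟩ | ⟨x, y, hxy, e⟩ := exists_common_kernel hq.1 hq.2.1 hq.2.2
  · obtain ⟨α, β, -, hv⟩ := hu.mix1 (p := 1) (q := 2) (by decide) rfl hxy
    set v : Cube (IsLocalRing.ResidueField R) := _ with hvdef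
    change Reduces _ _ _ _ _ _ v at hv
    have v110 : v 1 1 0 = 0 := by simpa [hvdef] using e.1
    have v111 : v 1 1 1 = 0 := by simpa [hvdef] using e.2.1
    have v210 : v 2 1 0 = 0 := by simpa [hvdef] using e.2.2.1
    have v211 : v 2 1 1 = 0 := by simpa [hvdef] using e.2.2.2
    clear_value v
    obtain ⟨-, s1, s2⟩ := hv.saturated hsat
    have hm := hv.sw01.typeB_ne_zero hπ hsat.sw01
    have hn := hv.typeB_ne_zero hπ hsat
    simp only [Cube.sw01] at hm
    have hV : v 1 2 0 * v 2 2 1 - v 1 2 1 * v 2 2 0 ≠ 0 := by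
      intro h
      obtain ⟨x, y, hxy, e1, e2⟩ := exists_kernel (sub_eq_zero.1 h)
      have := s2 ![x, y, 0] (by
        intro i j
        fin_cases i <;> fin_cases j <;>
          simp (disch := decide) [Fin.sum_univ_three, hv.eq_zero hπ, v110, v111, v210, v211, e1, e2])
      exact hxy ⟨by simpa using congr_fun this 0, by simpa using congr_fun this 1⟩
    refine hv.isAdmissible (.inl ⟨1, 2, by decide, ?_, ?_⟩)
    · rw [← cubic_zero_sw01]
      refine cubic_zero_hasRepeatedLinearFactor (fun h => ?_)
        (by simp (disch := decide) [coeffs, mixedDet, rowDet, Cube.sw01, hv.eq_zero hπ, v110, v111,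
          v210, v211])
      rw [cubic_zero_eq_ternaryCubic, ternaryCubic_eq_zero_iff] at h
      have h8 := congr_fun h 8
      have h2 := congr_fun h 2
      simp (disch := decide) [coeffs, mixedDet, rowDet, Cube.sw01, hv.eq_zero hπ, v110, v111,
          v210, v211] at h8 h2
      grind
    · rw [← cubic_zero_sw12_sw01]
      refine cubic_zero_hasRepeatedLinearFactor (fun h => ?_)
        (by simp (disch := decide) [coeffs, mixedDet, rowDet, Cube.sw01, Cube.sw12, hv.eq_zero hπ,
          v110, v111, v210, v211])
      rw [cubic_zero_eq_ternaryCubic, ternaryCubic_eq_zero_iff] at h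
      have h7 := congr_fun h 7
      have h8 := congr_fun h 8
      have h2 := congr_fun h 2
      simp (disch := decide) [coeffs, mixedDet, rowDet, Cube.sw01, Cube.sw12, hv.eq_zero hπ,
        v110, v111, v210, v211] at h7 h8 h2
      by_cases h012 : v 0 1 2 = 0
      · have h022 : v 0 2 2 ≠ 0 := fun h => hm ⟨h012, h⟩
        have hd : v 1 0 2 * v 2 1 2 - v 2 0 2 * v 1 1 2 = 0 := by
          simp only [h012] at h2
          grind
        have r1 := s1 ![v 1 1 2, -v 1 0 2, 0] (by
          intro i l
          fin_cases i <;> fin_cases l <;>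
            simp (disch := decide) [Fin.sum_univ_three, hv.eq_zero hπ, v110, v111, v210, v211,
              h012] <;> grind)
        have r2 := s1 ![v 2 1 2, -v 2 0 2, 0] (by
          intro i l
          fin_cases i <;> fin_cases l <;>
            simp (disch := decide) [Fin.sum_univ_three, hv.eq_zero hπ, v110, v111, v210, v211,
              h012] <;> grind)
        exact hn ⟨by simpa using congr_fun r1 1, by simpa using congr_fun r2 1⟩
      · replace h7 : v 1 2 0 * v 2 0 2 = v 1 0 2 * v 2 2 0 :=
          mul_left_cancel₀ h012 (by linear_combination h7)
        replace h8 : v 1 2 1 * v 2 0 2 = v 1 0 2 * v 2 2 1 :=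
          mul_left_cancel₀ h012 (by linear_combination h8)
        exact hn ⟨mul_right_cancel₀ hV (by linear_combination v 1 2 1 * h7 - v 1 2 0 * h8),
          mul_right_cancel₀ hV (by linear_combination v 2 2 1 * h7 - v 2 2 0 * h8)⟩
  · have := (hu.saturated hsat).2.2 ![x, y, 0] (by
      intro i j
      fin_cases i <;> fin_cases j <;>
        simp (disch := decide) [Fin.sum_univ_three, hu.eq_zero hπ, e])
    exact absurd ⟨by simpa using congr_fun this 0, by simpa using congr_fun this 1⟩ hxy

/-- For weights of type B, if the cubic of the special slicing vanishes, which is expressed by `h`,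
then the linear factor of the first cubic divides its quadratic cofactor. -/
lemma Reduces.typeB_hasRepeatedLinearFactor (hπ : Irreducible π) (hsat : S.IsSaturated)
    (hu : Reduces π 1 ![1, 0, 0] ![1, 0, 0] ![1, 1, 0] S u) (hne : u.cubic 0 ≠ 0)
    (h : ∀ l : Fin 3, l ≠ 2 → u 0 1 2 * (u 1 0 2 * u 2 2 l - u 2 0 2 * u 1 2 l)
      = u 0 2 2 * (u 1 0 2 * u 2 1 l - u 2 0 2 * u 1 1 l)) :
    HasRepeatedLinearFactor (u.cubic 0) := by
  have hm := hu.sw01.typeB_ne_zero hπ hsat.sw01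
  have hn := hu.typeB_ne_zero hπ hsat
  simp only [Cube.sw01] at hm
  have k0 := h 0 (by decide)
  have k1 := h 1 (by decide)
  have hd : (u 1 0 2 * u 2 1 0 - u 2 0 2 * u 1 1 0) * (u 1 0 2 * u 2 2 1 - u 2 0 2 * u 1 2 1)
      = (u 1 0 2 * u 2 1 1 - u 2 0 2 * u 1 1 1) * (u 1 0 2 * u 2 2 0 - u 2 0 2 * u 1 2 0) := by
    by_cases h012 : u 0 1 2 = 0
    · have h022 : u 0 2 2 ≠ 0 := fun h => hm ⟨h012, h⟩
      refine mul_left_cancel₀ h022 ?_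
      linear_combination (u 1 0 2 * u 2 2 0 - u 2 0 2 * u 1 2 0) * k1 -
        (u 1 0 2 * u 2 2 1 - u 2 0 2 * u 1 2 1) * k0
    · refine mul_left_cancel₀ h012 ?_
      linear_combination (u 1 0 2 * u 2 1 0 - u 2 0 2 * u 1 1 0) * k1 -
        (u 1 0 2 * u 2 1 1 - u 2 0 2 * u 1 1 1) * k0
  refine (cubic_zero_isUniqueSingularPoint_or hne
    (by simp (disch := decide) [coeffs, mixedDet, rowDet, hu.eq_zero hπ])).resolve_left ?_
  -- the linear factor `u₁₀₂ y + u₂₀₂ z` divides its cofactor, and gives a second singular point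
  rintro ⟨p, hp⟩
  refine not_isUniqueSingularPoint (y := u 2 0 2) (z := -u 1 0 2)
    (fun h => hn ⟨neg_eq_zero.1 h.2, h.1⟩) ?_ ?_ p hp
  · rw [cubic_zero_eq_ternaryCubic]
    apply isSingularPoint_ternaryCubic <;>
      simp (disch := decide) [coeffs, mixedDet, rowDet, hu.eq_zero hπ]
  · rw [cubic_zero_eq_ternaryCubic]
    refine ⟨fun h => hn ⟨by simpa using congr_fun h 2, by simpa using congr_fun h 1⟩, ?_,
      fun t => ?_⟩
    · rw [aeval_ternaryCubic]
      simp (disch := decide) [coeffs, mixedDet, rowDet, hu.eq_zero hπ]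
      ring
    · fin_cases t
      · refine (aeval_pderiv_zero_ternaryCubic _ _).trans ?_
        simp (disch := decide) [coeffs, mixedDet, rowDet, hu.eq_zero hπ]
      · refine (aeval_pderiv_one_ternaryCubic _ _).trans ?_
        simp (disch := decide) [coeffs, mixedDet, rowDet, hu.eq_zero hπ]
        linear_combination u 1 0 2 * hd
      · refine (aeval_pderiv_two_ternaryCubic _ _).trans ?_
        simp (disch := decide) [coeffs, mixedDet, rowDet, hu.eq_zero hπ]
        linear_combination u 2 0 2 * hd

lemma IsTypeB.isAdmissible (hπ : Irreducible π) (hsat : S.IsSaturated) (h : S.IsTypeB π) :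
    IsAdmissible S.redCubic := by
  obtain ⟨u, hu⟩ := HasWeight.exists_reduces h
  by_cases h0 : u.cubic 0 = 0
  · exact hu.typeB_isAdmissible_of_eq_zero hπ hsat h0
  by_cases h1 : u.sw01.cubic 0 = 0
  · exact IsAdmissible.of_sw01 (hu.sw01.typeB_isAdmissible_of_eq_zero hπ hsat.sw01 h1)
  by_cases h2 : u.sw12.sw01.cubic 0 = 0
  · rw [cubic_zero_eq_ternaryCubic, ternaryCubic_eq_zero_iff] at h2
    have e7 := congr_fun h2 7
    have e8 := congr_fun h2 8
    simp (disch := decide) [coeffs, mixedDet, rowDet, Cube.sw01, Cube.sw12, hu.eq_zero hπ] at e7 e8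
    have r1 := hu.sw01.typeB_hasRepeatedLinearFactor hπ hsat.sw01 h1 (by
      intro l hl
      obtain rfl | rfl : l = 0 ∨ l = 1 := by lia
      · simp only [Cube.sw01]; linear_combination -e7
      · simp only [Cube.sw01]; linear_combination -e8)
    rw [cubic_zero_sw01] at r1
    refine hu.isAdmissible (.inl ⟨0, 1, by decide,
      hu.typeB_hasRepeatedLinearFactor hπ hsat h0 ?_, r1⟩)
    intro l hl
    obtain rfl | rfl : l = 0 ∨ l = 1 := by lia
    · linear_combination -e7
    · linear_combination -e8
  refine hu.isAdmissible (.of_forall fun i => ?_)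
  fin_cases i
  · exact cubic_zero_isUniqueSingularPoint_or h0
      (by simp (disch := decide) [coeffs, mixedDet, rowDet, hu.eq_zero hπ])
  · have := cubic_zero_isUniqueSingularPoint_or h1
      (by simp (disch := decide) [coeffs, mixedDet, rowDet, Cube.sw01, hu.eq_zero hπ])
    rwa [cubic_zero_sw01] at this
  · have := cubic_zero_hasRepeatedLinearFactor h2
      (by simp (disch := decide) [coeffs, mixedDet, rowDet, Cube.sw01, Cube.sw12, hu.eq_zero hπ])
    rw [cubic_zero_sw12_sw01] at this
    exact .inr this

lemma UpToSlots.isAdmissible {P : Cube R → Prop}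
    (hP : ∀ S, S.IsSaturated → P S → IsAdmissible S.redCubic) (hsat : S.IsSaturated)
    (h : UpToSlots P S) : IsAdmissible S.redCubic := by
  rcases h with h | h | h
  · exact hP S hsat h
  · exact IsAdmissible.of_sw12 (hP _ hsat.sw12 h)
  · exact IsAdmissible.of_sw01 (IsAdmissible.of_sw12 (hP _ hsat.sw01.sw12 h))

/-- One of the two situations holds for a saturated non-minimal cube. -/
lemma IsNonMinimal.isAdmissible (hπ : Irreducible π) (hsat : S.IsSaturated)
    (h : S.IsNonMinimal K) : IsAdmissible S.redCubic := by
  have hPB : ∀ S, IsTypeB π S → IsTypeB π S.sw01 := fun S h => h.sw01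
  have hPD : ∀ S, IsTypeD π S → IsTypeD π S.sw01 := fun S h => h.sw01
  by_cases hB : UpToSlots (IsTypeB π) S
  · exact hB.isAdmissible (fun S hs h => h.isAdmissible hπ hs) hsat
  by_cases hD : UpToSlots (IsTypeD π) S
  · exact hD.isAdmissible (fun S hs h => h.isAdmissible hπ hs) hsat
  rcases h.exists_type hπ hsat with h | h | h | h | h
  · exact h.isAdmissible (fun S hs h => h.isAdmissible hπ hs) hsat
  · exact absurd h hB
  · rcases h with h | h | h
    · exact h.isAdmissible hπ hB
    · exact IsAdmissible.of_sw12 (h.isAdmissible hπ fun h => hB (h.of_sw12 hPB))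
    · exact IsAdmissible.of_sw01 (IsAdmissible.of_sw12
        (h.isAdmissible hπ fun h => hB ((h.of_sw12 hPB).of_sw01 hPB)))
  · exact absurd h hD
  · rcases h with h | h | h
    · exact h.isAdmissible hπ hsat hB hD
    · exact IsAdmissible.of_sw12 (h.isAdmissible hπ hsat.sw12 (fun h => hB (h.of_sw12 hPB))
        fun h => hD (h.of_sw12 hPD))
    · exact IsAdmissible.of_sw01 (IsAdmissible.of_sw12
        (h.isAdmissible hπ hsat.sw01.sw12 (fun h => hB ((h.of_sw12 hPB).of_sw01 hPB))
          fun h => hD ((h.of_sw12 hPD).of_sw01 hPD)))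

end Types

end Cube

/-! ### Existence of the procedures -/

section Alignment

variable {k : Type*} [Field k]

/-- A point can be moved to `(1 : 0 : 0)`. -/
lemma exists_matrix_first_row {v : Fin 3 → k} (hv : v ≠ 0) :
    ∃ G : Matrix (Fin 3) (Fin 3) k, G.det ≠ 0 ∧ G 0 = v := by
  by_cases h0 : v 0 = 0
  · by_cases h1 : v 1 = 0
    · have h2 : v 2 ≠ 0 := fun h2 => hv (by ext t; fin_cases t <;> assumption)
      exact ⟨!![v 0, v 1, v 2; 1, 0, 0; 0, 1, 0], by simp [Matrix.det_fin_three, h2],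
      by ext t; fin_cases t <;> rfl⟩
    · exact ⟨!![v 0, v 1, v 2; 1, 0, 0; 0, 0, 1], by simp [Matrix.det_fin_three, h1],
      by ext t; fin_cases t <;> rfl⟩
  · exact ⟨!![v 0, v 1, v 2; 0, 1, 0; 0, 0, 1], by simp [Matrix.det_fin_three, h0],
      by ext t; fin_cases t <;> rfl⟩

/-- A line can be moved to `z = 0`. -/
lemma exists_matrix_mulVec_eq {l : Fin 3 → k} (hl : l ≠ 0) :
    ∃ G : Matrix (Fin 3) (Fin 3) k, G.det ≠ 0 ∧ G.mulVec l = ![0, 0, 1] := by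
  obtain ⟨H, hH, h0⟩ := exists_matrix_first_row hl
  have hP : (H.submatrix (Equiv.swap 0 2) id).det ≠ 0 := by
    rw [Matrix.det_permute]
    exact mul_ne_zero (by simp) hH
  set P := (H.submatrix (Equiv.swap 0 2) id).transpose with hPdef
  have hP' : IsUnit P.det := by
    rw [hPdef, Matrix.det_transpose]
    exact hP.isUnit
  have e : P.mulVec ![0, 0, 1] = l := by
    rw [← h0]
    ext t
    simp [hPdef, Matrix.mulVec, dotProduct, Fin.sum_univ_three]
  refine ⟨P⁻¹, ?_, ?_⟩
  · exact (Matrix.isUnit_nonsing_inv_det P hP').ne_zero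
  · rw [← e, Matrix.mulVec_mulVec, Matrix.nonsing_inv_mul _ hP', Matrix.one_mulVec]

end Alignment

namespace Cube

section Existence

variable {R K : Type*} [CommRing R] [IsDomain R] [IsDiscreteValuationRing R]
  [Field K] [Algebra R K] {π : R} {S T : Cube R}

/-- Vectors that are linearly independent modulo `π` satisfy no linear relation. -/
lemma eq_zero_of_residue_independent (hπ : Irreducible π) {ι : Type*} {U : Fin 3 → ι → R}
    (hU : ∀ c : Fin 3 → IsLocalRing.ResidueField R,
      (∀ t, ∑ i, c i * IsLocalRing.residue R (U i t) = 0) → c = 0)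
    {x : Fin 3 → R} (hx : ∀ t, ∑ i, x i * U i t = 0) : x = 0 := by
  have key : ∀ n : ℕ, ∃ y : Fin 3 → R, (∀ i, x i = π ^ n * y i) ∧ ∀ t, ∑ i, y i * U i t = 0 := by
    intro n
    induction n with
    | zero => exact ⟨x, by simp, hx⟩
    | succ n ih =>
      obtain ⟨y, hy, hrel⟩ := ih
      have h0 := hU (fun i => IsLocalRing.residue R (y i)) fun t => by
        have := congrArg (IsLocalRing.residue R) (hrel t)
        simpa using this
      choose z hz using fun i => (dvd_iff_residue_eq_zero hπ (y i)).2 (congr_fun h0 i)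
      refine ⟨z, fun i => by rw [hy, hz]; ring, fun t => mul_left_cancel₀ hπ.ne_zero ?_⟩
      rw [mul_zero, ← hrel t, Finset.mul_sum]
      exact Finset.sum_congr rfl fun i _ => by rw [hz i]; ring
  funext i
  by_contra hne
  obtain ⟨n, hn⟩ := IsDiscreteValuationRing.associated_pow_irreducible hne hπ
  obtain ⟨y, hy, -⟩ := key (n + 1)
  have hd : π ^ (n + 1) ∣ π ^ n := (Dvd.intro _ (hy i).symm).trans hn.dvd
  exact absurd ((pow_dvd_pow_iff hπ.ne_zero hπ.not_isUnit).1 hd) (by omega)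

/-- The remaining component of a transformation can be chosen, by the Smith normal form. -/
lemma SliceIndependent.exists_transform [IsFractionRing R K] (hπ : Irreducible π) {U : Cube R}
    (hU : U.SliceIndependent 2) (d : Fin 3 → ℕ) :
    ∃ T : Cube R, Transform K (Matrix.diagonal fun i => algebraMap R K π ^ d i) 0 1 U T := by
  have hinj := IsFractionRing.injective R K
  set W : Matrix (Fin 3) (Fin 3 × Fin 3) R :=
    Matrix.of fun l t => π ^ d t.1 * π ^ d t.2 * U t.1 t.2 l with hWdef
  have hW : LinearIndependent R fun i => W i := by
    rw [Fintype.linearIndependent_iff]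
    intro x hx
    refine congr_fun (eq_zero_of_residue_independent hπ (ι := Fin 3 × Fin 3)
      (U := fun l t => U t.1 t.2 l)
      (fun c hc => (sliceIndependent_two_iff U).1 hU c fun i j => hc (i, j)) fun t => ?_)
    have := congr_fun hx t
    simp only [Finset.sum_apply, Pi.smul_apply, smul_eq_mul, Pi.zero_apply, hWdef,
      Matrix.of_apply] at this
    refine mul_left_cancel₀ (mul_ne_zero (pow_ne_zero (d t.1) hπ.ne_zero)
      (pow_ne_zero (d t.2) hπ.ne_zero)) ?_
    rw [mul_zero, ← this, Finset.mul_sum]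
    exact Finset.sum_congr rfl fun i _ => by ring
  obtain ⟨P, a, Y, hP, ha, hY, e⟩ := exists_smith W hW
  set B : Matrix (Fin 3) (Fin 3) K := (P * Matrix.diagonal a).map (algebraMap R K) with hB
  have hBu : IsUnit B.det := by
    have : B.det = algebraMap R K (P * Matrix.diagonal a).det := (RingHom.map_det _ _).symm
    rw [this, Matrix.det_mul, Matrix.det_diagonal, isUnit_iff_ne_zero]
    exact fun h => mul_ne_zero hP.ne_zero (Finset.prod_ne_zero_iff.2 fun i _ => ha i)
      ((map_eq_zero_iff _ hinj).1 h)
  have hπK : algebraMap R K π ≠ 0 := fun h => hπ.ne_zero ((map_eq_zero_iff _ hinj).1 h)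
  have hDu : IsUnit (Matrix.diagonal fun i => algebraMap R K π ^ d i).det := by
    rw [Matrix.det_diagonal, isUnit_iff_ne_zero]
    exact Finset.prod_ne_zero_iff.2 fun i _ => pow_ne_zero _ hπK
  have hBi : IsUnit B⁻¹.det := Matrix.isUnit_nonsing_inv_det B hBu
  let gD : Matrix.GeneralLinearGroup (Fin 3) K := ((Matrix.isUnit_iff_isUnit_det _).2 hDu).unit
  let gB : Matrix.GeneralLinearGroup (Fin 3) K := ((Matrix.isUnit_iff_isUnit_det _).2 hBi).unit
  refine ⟨fun i j l => Y l (i, j), ![gD, gD, gB], rfl, rfl, ?_, fun m h0 h1 => ?_⟩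
  · have hY' : ∀ t, B.mulVec (fun l => algebraMap R K (Y l t))
        = fun l => algebraMap R K (W l t) := by
      intro t
      funext l
      rw [e]
      simp only [hB, Matrix.mulVec, dotProduct, Matrix.map_apply, Matrix.mul_apply (N := Y), map_sum,
        map_mul]
    have e2 : (Cube.map (algebraMap R K) fun i j l => Y l (i, j)) =
        act2 B⁻¹ fun i j l => algebraMap R K (W l (i, j)) := by
      funext i j l
      have := congrArg (fun w => B⁻¹.mulVec w l) (hY' (i, j))
      simp only [Matrix.mulVec_mulVec, Matrix.nonsing_inv_mul _ hBu, Matrix.one_mulVec] at this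
      exact this
    rw [e2, glAct, act_eq]
    change _ = act0 (Matrix.diagonal fun i => algebraMap R K π ^ d i)
      (act1 (Matrix.diagonal fun i => algebraMap R K π ^ d i) (act2 B⁻¹ (U.map (algebraMap R K))))
    funext i j l
    simp [act0, act1, act2, Matrix.diagonal_apply, hWdef, Cube.map, Finset.mul_sum]
    exact Finset.sum_congr rfl fun x _ => by ring
  · obtain rfl : m = 2 := by lia
    rw [sliceIndependent_two_iff]
    intro c hc
    refine funext (Fintype.linearIndependent_iff.1 hY c ?_)
    funext t
    simpa using hc t.1 t.2

/-- Invertible matrices over the residue field, for the first two slicings, lift to an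
equivalence. -/
lemma exists_equivalent_redCubic (S : Cube R)
    {G H : Matrix (Fin 3) (Fin 3) (IsLocalRing.ResidueField R)} (hG : G.det ≠ 0) (hH : H.det ≠ 0) :
    ∃ U : Cube R, S.Equivalent U ∧
      (∃ u, u ≠ 0 ∧ U.redCubic 0 = C u * linSubst G (S.redCubic 0)) ∧
      ∃ u, u ≠ 0 ∧ U.redCubic 1 = C u * linSubst H (S.redCubic 1) := by
  obtain ⟨M, hM, rfl, -⟩ := exists_lift_matrix G hG
  obtain ⟨N, hN, rfl, -⟩ := exists_lift_matrix H hH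
  let g : Fin 3 → Matrix.GeneralLinearGroup (Fin 3) R :=
    ![((Matrix.isUnit_iff_isUnit_det _).2 hM).unit, ((Matrix.isUnit_iff_isUnit_det _).2 hN).unit, 1]
  exact ⟨S.glAct g, ⟨g, rfl⟩, exists_redCubic_glAct g S 0, exists_redCubic_glAct g S 1⟩

lemma exists_stepI_zero_one [IsFractionRing R K] (hπ : Irreducible π) (hsat : S.IsSaturated)
    (h0 : HasRepeatedLinearFactor (S.redCubic 0)) (h1 : HasRepeatedLinearFactor (S.redCubic 1)) :
    ∃ T, StepI K π 0 1 S T := by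
  have align : ∀ {f : MvPolynomial (Fin 3) (IsLocalRing.ResidueField R)},
      HasRepeatedLinearFactor f → ∃ G : Matrix (Fin 3) (Fin 3) (IsLocalRing.ResidueField R),
        G.det ≠ 0 ∧ ∀ u, u ≠ 0 → C u * linSubst G f ≠ 0 ∧ X 2 ^ 2 ∣ C u * linSubst G f := by
    rintro f ⟨hf, l, hl, hd⟩
    obtain ⟨G, hG, e⟩ := exists_matrix_mulVec_eq hl
    refine ⟨G, hG, fun u hu => ⟨?_, ?_⟩⟩
    · exact mul_ne_zero (by simpa using hu)
        fun h0 => hf (linSubst_injective hG.isUnit (by rw [h0, map_zero]))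
    · rw [X_two_sq_eq, ← e, ← linSubst_linear, ← map_pow]
      exact (map_dvd _ hd).mul_left _
  obtain ⟨G, hG, eG⟩ := align h0
  obtain ⟨H, hH, eH⟩ := align h1
  obtain ⟨U, hU, ⟨u, hu, e0⟩, v, hv, e1⟩ := exists_equivalent_redCubic S hG hH
  obtain ⟨T, hT⟩ := (hsat.equivalent hU 2).exists_transform (K := K) hπ ![0, 0, 1]
  refine ⟨T, by decide, U, hU, e0 ▸ eG u hu, e1 ▸ eH v hv, ?_⟩
  convert hT using 2
  funext t
  fin_cases t <;> simp

lemma exists_stepII_zero_one [IsFractionRing R K] (hπ : Irreducible π) (hsat : S.IsSaturated)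
    (h0 : ∃ p, IsUniqueSingularPoint (S.redCubic 0) p)
    (h1 : ∃ p, IsUniqueSingularPoint (S.redCubic 1) p) : ∃ T, StepII K π 0 1 S T := by
  have align : ∀ {f : MvPolynomial (Fin 3) (IsLocalRing.ResidueField R)},
      (∃ p, IsUniqueSingularPoint f p) →
      ∃ G : Matrix (Fin 3) (Fin 3) (IsLocalRing.ResidueField R),
        G.det ≠ 0 ∧ ∀ u, u ≠ 0 → IsUniqueSingularPoint (C u * linSubst G f) ![1, 0, 0] := by
    rintro f ⟨p, hp⟩
    obtain ⟨G, hG, e⟩ := exists_matrix_first_row hp.1.1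
    refine ⟨G, hG, fun u hu => ?_⟩
    have := hp.C_mul_linSubst hu hG.isUnit
    have ep : Matrix.vecMul ![1, 0, 0] G = p := by
      rw [← e]
      ext t
      simp [Matrix.vecMul, dotProduct, Fin.sum_univ_three]
    rwa [← ep, Matrix.vecMul_vecMul, Matrix.mul_nonsing_inv _ hG.isUnit, Matrix.vecMul_one] at this
  obtain ⟨G, hG, eG⟩ := align h0
  obtain ⟨H, hH, eH⟩ := align h1
  obtain ⟨U, hU, ⟨u, hu, e0⟩, v, hv, e1⟩ := exists_equivalent_redCubic S hG hH
  obtain ⟨T, hT⟩ := (hsat.equivalent hU 2).exists_transform (K := K) hπ ![0, 1, 1]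
  refine ⟨T, by decide, U, hU, e0 ▸ eG u hu, e1 ▸ eH v hv, ?_⟩
  convert hT using 2
  funext t
  fin_cases t <;> simp

/-- A construction that uses two of the three slicings, and that is compatible with permutations of
the slicings, need only be carried out for the first two. -/
lemma of_zero_one {Q : Fin 3 → Cube R → Prop} {P : Fin 3 → Fin 3 → Cube R → Prop}
    (symm : ∀ i j S, P i j S → P j i S)
    (p01 : ∀ i j S, P i j S.sw01 → P (idx01 i) (idx01 j) S)
    (p12 : ∀ i j S, P i j S.sw12 → P (idx12 i) (idx12 j) S)
    (q01 : ∀ i S, Q i S → Q (idx01 i) S.sw01) (q12 : ∀ i S, Q i S → Q (idx12 i) S.sw12)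
    (key : ∀ S : Cube R, S.IsSaturated → Q 0 S → Q 1 S → P 0 1 S) (hsat : S.IsSaturated)
    {i j : Fin 3} (hij : i ≠ j) (hi : Q i S) (hj : Q j S) : P i j S := by
  have key' : ∀ S : Cube R, S.IsSaturated → Q 0 S → Q 2 S → P 0 2 S := fun S hs h0 h2 =>
    p12 0 1 S (key S.sw12 hs.sw12 (q12 0 S h0) (q12 2 S h2))
  have key'' : ∀ S : Cube R, S.IsSaturated → Q 1 S → Q 2 S → P 1 2 S := fun S hs h1 h2 =>
    p01 0 2 S (key' S.sw01 hs.sw01 (q01 1 S h1) (q01 2 S h2))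
  fin_cases i <;> fin_cases j
  exacts [absurd rfl hij, key S hsat hi hj, key' S hsat hi hj, symm _ _ _ (key S hsat hj hi),
    absurd rfl hij, key'' S hsat hi hj, symm _ _ _ (key' S hsat hj hi),
    symm _ _ _ (key'' S hsat hj hi), absurd rfl hij]

lemma exists_stepI [IsFractionRing R K] (hπ : Irreducible π) (hsat : S.IsSaturated) {i j : Fin 3}
    (hij : i ≠ j) (hi : HasRepeatedLinearFactor (S.redCubic i))
    (hj : HasRepeatedLinearFactor (S.redCubic j)) : ∃ T, StepI K π i j S T :=
  of_zero_one (Q := fun i S => HasRepeatedLinearFactor (S.redCubic i))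
    (P := fun i j S => ∃ T, StepI K π i j S T) (fun _ _ _ ⟨T, hT⟩ => ⟨T, hT.symm⟩)
    (fun _ _ _ ⟨T, hT⟩ => ⟨T.sw01, hT.sw01⟩) (fun _ _ _ ⟨T, hT⟩ => ⟨T.sw12, hT.sw12⟩)
    (fun i S h => by rwa [redCubic_sw01]) (fun i S h => by rwa [redCubic_sw12])
    (fun _ hs h0 h1 => exists_stepI_zero_one hπ hs h0 h1) hsat hij hi hj

lemma exists_stepII [IsFractionRing R K] (hπ : Irreducible π) (hsat : S.IsSaturated) {i j : Fin 3}
    (hij : i ≠ j) (hi : ∃ p, IsUniqueSingularPoint (S.redCubic i) p)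
    (hj : ∃ p, IsUniqueSingularPoint (S.redCubic j) p) : ∃ T, StepII K π i j S T :=
  of_zero_one (Q := fun i S => ∃ p, IsUniqueSingularPoint (S.redCubic i) p)
    (P := fun i j S => ∃ T, StepII K π i j S T) (fun _ _ _ ⟨T, hT⟩ => ⟨T, hT.symm⟩)
    (fun _ _ _ ⟨T, hT⟩ => ⟨T.sw01, hT.sw01⟩) (fun _ _ _ ⟨T, hT⟩ => ⟨T.sw12, hT.sw12⟩)
    (fun i S h => by rwa [redCubic_sw01]) (fun i S h => by rwa [redCubic_sw12])
    (fun _ hs h0 h1 => exists_stepII_zero_one hπ hs h0 h1) hsat hij hi hj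

end Existence

end Cube

/-! ### Comparison of levels -/

namespace Cube

section Levels

variable {R K : Type*} [CommRing R] [IsDomain R] [IsDiscreteValuationRing R]
  [Field K] [Algebra R K] [IsFractionRing R K] {π : R} {S T : Cube R} {r : R}

lemma LevelRatio.discVal_le (h : LevelRatio K S T r) : T.discVal ≤ S.discVal := by
  rw [discVal, discVal, h.disc, IsDiscreteValuationRing.addVal_mul]
  exact le_add_self

lemma LevelRatio.disc_ne_zero (h : LevelRatio K S T r) (hns : S.disc ≠ 0) : T.disc ≠ 0 :=
  fun h0 => hns (by rw [h.disc, h0, mul_zero])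

lemma LevelRatio.isUnit (h : LevelRatio K S T r) (hns : S.disc ≠ 0)
    (he : T.discVal = S.discVal) : IsUnit r := by
  have hT := h.disc_ne_zero hns
  rw [discVal, discVal, h.disc] at he
  obtain ⟨c, hc⟩ := IsDiscreteValuationRing.addVal_le_iff_dvd.1 he.ge
  refine isUnit_of_dvd_one ((dvd_pow_self r (n := 12) (by norm_num)).trans ⟨c, ?_⟩)
  exact mul_right_cancel₀ hT (by linear_combination hc)

lemma IsNonMinimal.of_fracEquivalent (h : S.IsNonMinimal K) (e : S.FracEquivalent K T)
    (he : T.discVal = S.discVal) : T.IsNonMinimal K := by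
  obtain ⟨U, hU, hlt⟩ := h
  exact ⟨U, Equivalent.trans (Equivalent.symm e) hU, hlt.trans_eq he.symm⟩

/-- Among the cubes given by `n` procedures there is one of smaller level, or one that is not
saturated. -/
lemma Good.exists_lt {n : ℕ} (hns : S.disc ≠ 0) (h : Good K π n S) (T : ℕ → Cube R) (h0 : T 0 = S)
    (hT : ∀ m < n, (T m).Step K π (T (m + 1))) :
    ∃ m, 1 ≤ m ∧ m ≤ n ∧ (¬ (T m).IsSaturated ∨ (T m).discVal < S.discVal) := by
  induction n generalizing S T with
  | zero => exact h.elim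
  | succ n ih =>
    subst h0
    obtain ⟨r, hr, hgood⟩ := h (T 1) (hT 0 n.succ_pos)
    by_cases hs : (T 1).IsSaturated
    · rcases hr.discVal_le.lt_or_eq with hlt | he
      · exact ⟨1, le_rfl, by omega, .inr hlt⟩
      · obtain ⟨m, h1, hm, hd⟩ := ih (hr.disc_ne_zero hns) (hgood (hr.isUnit hns he) hs)
          (fun m => T (m + 1)) rfl fun m hm => hT (m + 1) (by omega)
        exact ⟨m + 1, by omega, by omega, hd.imp id fun h => h.trans_eq he⟩
    · exact ⟨1, le_rfl, by omega, .inl hs⟩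

end Levels

end Cube

theorem mainTheorem2 {R K : Type*} [CommRing R] [IsDomain R] [IsDiscreteValuationRing R]
    [Field K] [Algebra R K] [IsFractionRing R K] (π : R) (hπ : Irreducible π)
    (S : Cube R) (hns : S.disc ≠ 0) (hsat : S.IsSaturated) (hnm : S.IsNonMinimal K) :
    -- one of the two situations holds
    ((∃ i j, i ≠ j ∧ HasRepeatedLinearFactor (S.redCubic i) ∧
        HasRepeatedLinearFactor (S.redCubic j)) ∨
      (∃ i j, i ≠ j ∧ (∃ p, IsUniqueSingularPoint (S.redCubic i) p) ∧
        (∃ p, IsUniqueSingularPoint (S.redCubic j) p))) ∧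
    -- the procedures can be carried out, whichever two of the cubics are chosen
    (∀ i j, i ≠ j → HasRepeatedLinearFactor (S.redCubic i) →
      HasRepeatedLinearFactor (S.redCubic j) → ∃ T, S.StepI K π i j T) ∧
    (∀ i j, i ≠ j → (∃ p, IsUniqueSingularPoint (S.redCubic i) p) →
      (∃ p, IsUniqueSingularPoint (S.redCubic j) p) → ∃ T, S.StepII K π i j T) ∧
    -- they give an integral cube of the same or smaller level; if the new cube is saturated and has
    -- the same level, then it is again non-minimal, so that the procedures can be repeated
    (∀ T : Cube R, S.Step K π T →
      S.FracEquivalent K T ∧ T.disc ≠ 0 ∧ T.discVal ≤ S.discVal ∧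
        (T.IsSaturated → T.discVal = S.discVal → T.IsNonMinimal K)) ∧
    -- at most three iterations are needed
    (∀ T : ℕ → Cube R, T 0 = S → (∀ n < 3, (T n).Step K π (T (n + 1))) →
      ∃ n, 1 ≤ n ∧ n ≤ 3 ∧ (¬ (T n).IsSaturated ∨ (T n).discVal < S.discVal)) := by
  have hgood := hnm.good hπ hsat
  refine ⟨hnm.isAdmissible hπ hsat, fun i j hij hi hj => Cube.exists_stepI hπ hsat hij hi hj,
    fun i j hij hi hj => Cube.exists_stepII hπ hsat hij hi hj, fun T hT => ?_, hgood.exists_lt hns⟩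
  obtain ⟨r, hr, -⟩ := hgood T hT
  exact ⟨hr.fracEquivalent, hr.disc_ne_zero hns, hr.discVal_le,
    fun _ he => hnm.of_fracEquivalent hr.fracEquivalent he⟩
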